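/- Graphs are finite, simple and undirected. A trigraph on a vertex set $V$ has as nodes the classes of a partition of $V$ and carries two mutually exclusive adjacency relations, black and red, between distinct nodes. Contracting two distinct nodes $X,Y$ replaces them by the node $X\cup Y$, whose neighbours are the nodes other than $X,Y$ that are (black or red) neighbours of $X$ or of $Y$; the black neighbours of $X\cup Y$ are the common black neighbours of $X$ and $Y$, its other neighbours are red, and all other adjacencies are unchanged. The twin-width $\mathrm{tww}(G)$ of a graph $G=(V,E)$ with $n\ge 1$ vertices is the least $d$ for which there are trigraphs $\mathbf G_n,\dots,\mathbf G_1$, in each of which every node has at most $d$ red neighbours, such that $\mathbf G_n$ is $G$ itself (singleton nodes, the edges of $G$ black, no red edges), $\mathbf G_1$ has the single node $V$, and $\mathbf G_i$ arises from $\mathbf G_{i+1}$ by one contraction. For a positive integer $r$ and a linear order $L$ on $V(G)$, a vertex $u$ is strongly $r$-reachable from $v$ if $u\le_L v$ and there is a path of length at most $r$ between $u$ and $v$ all of whose inner vertices $w$ satisfy $v<_L w$. The strong $r$-colouring number $\mathrm{scol}_r(G)$ is the minimum, over all linear orders $L$ on $V(G)$, of the maximum, over all vertices $v$, of the number of vertices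 strongly $r$-reachable from $v$. A $2$-lift of a graph $H$ is a graph with vertices $v_1,v_2$ for every vertex $v$ of $H$ and, for every edge $uv$ of $H$, either the two edges $u_1v_1,u_2v_2$ or the two edges $u_1v_2,u_2v_1$. **Lemma.** Let $\Delta\ge 7$, $r\ge 1$ and $g\ge 4r+1$ be integers. There is a $\Delta$-regular graph $G$ with girth at least $g$, with $2\Delta-1\le \mathrm{tww}(G)\le 2\Delta$ and with $$\mathrm{scol}_r(G)\ \ge\ \frac{\Delta}{2}\Bigl(\frac{\Delta-2}{4}\Bigr)^{2^{\lfloor\log_2 r\rfloor}-1}\ \ge\ \frac{\mathrm{tww}(G)}{4}\Bigl(\frac{\mathrm{tww}(G)-4}{8}\Bigr)^{2^{\lfloor\log_2 r\rfloor}-1}.$$ Moreover, $G$ can be chosen as the last graph of a finite sequence $G_0,G_1,\dots,G_k$ with $G_0=K_{\Delta+1}$ in which every $G_{i+1}$ is obtained, up to isomorphism, from $G_i$ by a finite sequence of $2$-lifts and has girth at least twice the girth of $G_i$. -/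

import Mathlib

/-! ### Trigraphs, contraction sequences and twin-width -/

/-- A trigraph on a finite vertex set `V`: its nodes are the classes of a partition of `V`, and it
carries two exclusive (symmetric, irreflexive) adjacency relations between nodes. -/
structure Trigraph (V : Type*) [Fintype V] [DecidableEq V] where
  /-- the nodes: a partition of the vertex set into nonempty classes -/
  nodes : Finpartition (Finset.univ : Finset V)
  /-- the black adjacency -/
  black : SimpleGraph (Finset V)
  /-- the red adjacency -/
  red : SimpleGraph (Finset V)
  black_mem : ∀ X Y, black.Adj X Y → X ∈ nodes.parts
  red_mem : ∀ X Y, red.Adj X Y → X ∈ nodes.parts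
  exclusive : ∀ X Y, black.Adj X Y → ¬ red.Adj X Y

namespace Trigraph

variable {V : Type*} [Fintype V] [DecidableEq V]

/-- The trigraph whose nodes are the singletons, with the edges of `G` as black edges and
without red edges. -/
def ofGraph (G : SimpleGraph V) : Trigraph V where
  nodes := ⊥
  black := G.map fun v => ({v} : Finset V)
  red := ⊥
  black_mem := by
    intro X Y h
    obtain ⟨-, u, v, -, rfl, rfl⟩ := h
    simp
  red_mem := by
    intro X Y h
    exact absurd h (by simp)
  exclusive := by
    intro X Y _
    simp

/-- The set of neighbours of a node, along black or red edges. -/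
def neighbors (T : Trigraph V) (X : Finset V) : Set (Finset V) :=
  {Z | T.black.Adj X Z ∨ T.red.Adj X Z}

/-- A `d`-trigraph: every node has at most `d` red neighbours. -/
def RedDegreeLE (T : Trigraph V) (d : ℕ) : Prop :=
  ∀ X ∈ T.nodes.parts, (T.red.neighborSet X).ncard ≤ d

/-- `T'` is obtained from `T` by contracting the two distinct nodes `X` and `Y`. The nodes `X`, `Y`
themselves no longer exist in `T'`, hence they are removed from the neighbourhood of `X ∪ Y`. The
red neighbours of `X ∪ Y` in `T'` are its neighbours that are not black neighbours. -/
structure IsContraction (T T' : Trigraph V) (X Y : Finset V) : Prop where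
  left_mem : X ∈ T.nodes.parts
  right_mem : Y ∈ T.nodes.parts
  ne : X ≠ Y
  parts_eq : T'.nodes.parts = insert (X ∪ Y) (T.nodes.parts \ {X, Y})
  neighbors_union : T'.neighbors (X ∪ Y) = (T.neighbors X ∪ T.neighbors Y) \ {X, Y}
  black_union : T'.black.neighborSet (X ∪ Y) = T.black.neighborSet X ∩ T.black.neighborSet Y
  black_other : ∀ Z ∈ T.nodes.parts \ {X, Y}, ∀ W ∈ T.nodes.parts \ {X, Y},
    (T'.black.Adj Z W ↔ T.black.Adj Z W)
  red_other : ∀ Z ∈ T.nodes.parts \ {X, Y}, ∀ W ∈ T.nodes.parts \ {X, Y},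
    (T'.red.Adj Z W ↔ T.red.Adj Z W)

end Trigraph

/-- `G` has a `d`-contraction sequence `T n, …, T 1`, where `n` is the number of vertices. -/
def SimpleGraph.HasContractionSequence {V : Type*} [Fintype V] [DecidableEq V]
    (G : SimpleGraph V) (d : ℕ) : Prop :=
  ∃ T : ℕ → Trigraph V,
    T (Fintype.card V) = Trigraph.ofGraph G ∧
    (T 1).nodes.parts = {Finset.univ} ∧
    (∀ i, 1 ≤ i → i < Fintype.card V → ∃ X Y, (T (i + 1)).IsContraction (T i) X Y) ∧
    ∀ i, 1 ≤ i → i ≤ Fintype.card V → (T i).RedDegreeLE d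

/-- The twin-width of a finite graph: the minimum `d` for which there is a `d`-contraction
sequence (one exists as soon as the graph has a vertex). -/
noncomputable def SimpleGraph.twinWidth {V : Type*} [Fintype V] [DecidableEq V]
    (G : SimpleGraph V) : ℕ :=
  sInf {d | G.HasContractionSequence d}

/-! ### Strong colouring numbers -/

/-- The set of vertices that are strongly `r`-reachable from `v` with respect to the linear
order `L`. -/
def SimpleGraph.strongReach {V : Type*} (G : SimpleGraph V) (L : LinearOrder V) (r : ℕ) (v : V) :
    Set V :=
  {u | L.le u v ∧ ∃ p : G.Walk v u, p.IsPath ∧ p.length ≤ r ∧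
    ∀ w ∈ p.support, w ≠ v → w ≠ u → L.lt v w}

/-- The strong `r`-colouring number of a finite graph: the minimum over all linear orders of the
maximum number of strongly `r`-reachable vertices. -/
noncomputable def SimpleGraph.strongColoringNumber {V : Type*} [Fintype V] (G : SimpleGraph V)
    (r : ℕ) : ℕ :=
  ⨅ L : LinearOrder V, Finset.univ.sup fun v => (G.strongReach L r v).ncard

/-! ### 2-lifts -/

/-- The `2`-lift of `G` in which the edge `uv` is replaced by two crossing edges if `σ s(u, v)`
is `true`, and by two parallel edges otherwise. -/
def SimpleGraph.twoLift {V : Type} (G : SimpleGraph V) (σ : Sym2 V → Bool) :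
    SimpleGraph (V × Bool) where
  Adj x y := G.Adj x.1 y.1 ∧ y.2 = (x.2 ^^ σ s(x.1, y.1))
  symm := ⟨by
    rintro ⟨u, a⟩ ⟨v, b⟩ ⟨h, hb⟩
    refine ⟨h.symm, ?_⟩
    have e : s(v, u) = s(u, v) := Sym2.eq_swap
    simp only at hb ⊢
    rw [e, hb]
    cases a <;> cases σ s(u, v) <;> rfl⟩
  loopless := ⟨fun x h => G.loopless.irrefl x.1 h.1⟩

/-- `H` is (up to isomorphism) obtained from `G` by a finite sequence of `2`-lifts. -/
inductive SimpleGraph.IsIteratedTwoLift {V : Type} (G : SimpleGraph V) :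
    {W : Type} → SimpleGraph W → Prop
  | refl : IsIteratedTwoLift G G
  | lift {W W' : Type} {H : SimpleGraph W} {H' : SimpleGraph W'} (σ : Sym2 W → Bool) :
      IsIteratedTwoLift G H → Nonempty (H' ≃g H.twoLift σ) → IsIteratedTwoLift G H'

/-- `H` is the last graph of a finite sequence of graphs that starts with `G`, in which each graph
arises from its predecessor by a finite sequence of `2`-lifts and has at least twice its girth. -/
inductive SimpleGraph.IsGirthDoublingTower {V : Type} (G : SimpleGraph V) :
    {W : Type} → SimpleGraph W → Prop
  | refl : IsGirthDoublingTower G G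
  | step {W W' : Type} {H : SimpleGraph W} {H' : SimpleGraph W'} :
      IsGirthDoublingTower G H → H.IsIteratedTwoLift H' → 2 * H.girth ≤ H'.girth →
      IsGirthDoublingTower G H'

/-! ### Indicator values and sums over lists of a given length -/

/-! Put q = Δ - 1 and fix a linear order of the vertices. Call a non-backtracking walk a descent if
its last vertex is the first one after the start that does not exceed the start. Up to the girth
such walks are paths, the end of a descent with at most R steps is strongly R-reachable from its
start, and distinct descents from one vertex have distinct ends
(`sum_descents_le_ncard_strongReach`). So it suffices to bound the average number of descents per
vertex. Divided by (q + 1) q ^ (R - 1) this average is `exitTotal`, and `exitTotal_two_pow` shows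
that it is at least ((q - 1) / (4 q)) ^ (R - 1) / 2 when R is a power of two.

Two ways of cutting walks drive this bound. First, glue two descents at their common start, leaving
it along distinct edges: the result is a walk whose inner minimum exceeds both ends, and read from
its higher end it is again a descent (`sum_exitCorr_le`). Inclusion-exclusion then bounds the
probability that a vertex is the strict minimum of a two-sided walk with s steps on either side by
the correlations of exits with total time above s (`surviveCorr_le`). Conversely, that probability
decays no faster than 1/s, since the minimum of a longer walk must lie somewhere (`le_surviveCorr`).
Hence exits at late times cannot all be rare. Second, let two descents share an initial segment and
then split: their tails, glued at the branching vertex, form a descent whose length does not depend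
on the shared segment. This controls second moments (`exitEnergy_succ_le`), and Cauchy-Schwarz
returns to means (`exitMean_sq_le`). If `exitTotal` were below the bound, every mean up to time R
would be bounded by a small multiple of a power of q. The second principle would then make all late
exits too rare for the first (`exitTotal_large`). This asymptotic argument covers R ≥ 16; R = 1, 2,
4 are direct, and R = 8 is a finer version that ends in a numerical check (`exitTotal_eight`).

For the graph, start with the complete graph. Lifting once for each edge, with signs supported on
the preimages of that edge, makes every closed walk of the final lift cover each edge of the base an
even number of times. The projection of a cycle contains a cycle of the base, all of whose edges are
covered at least twice, so the girth doubles (`two_mul_girth_le_length`, `exists_girth_doubling`).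

For the upper bound on twin-width, contract the two vertices of each fibre of the last lift, one
fibre at a time. A class then sees at most two classes over each of Δ neighbours, and the remaining
quotient is the previous graph (`collapsible_twoLift`). For the lower bound, suppose that all red
degrees stay at most 2 Δ - 2. In girth at least 9 every class then has at most two vertices, those
of a pair are at distance at most two, and every pair keeps red degree at least 2 Δ - 2. Merging a
pair with anything else exceeds the allowed red degree (`PairInvariant.of_isContraction`), so the
one-class trigraph is never reached. -/

open Classical in
/-- The indicator of a proposition, as a real number. -/
noncomputable def ind (P : Prop) : ℝ := if P then 1 else 0

@[simp] lemma ind_true : ind True = 1 := by simp [ind]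

@[simp] lemma ind_false : ind False = 0 := by simp [ind]

lemma ind_of {P : Prop} (h : P) : ind P = 1 := by simp [ind, h]

lemma ind_of_not {P : Prop} (h : ¬ P) : ind P = 0 := by simp [ind, h]

lemma ind_nonneg (P : Prop) : 0 ≤ ind P := by unfold ind; split_ifs <;> norm_num

lemma ind_le_one (P : Prop) : ind P ≤ 1 := by unfold ind; split_ifs <;> norm_num

lemma ind_and (P Q : Prop) : ind (P ∧ Q) = ind P * ind Q := by
  by_cases hP : P <;> by_cases hQ : Q <;> simp [ind, hP, hQ]

lemma ind_mul_self (P : Prop) : ind P * ind P = ind P := by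
  by_cases hP : P <;> simp [ind, hP]

lemma ind_mono {P Q : Prop} (h : P → Q) : ind P ≤ ind Q := by
  by_cases hP : P
  · rw [ind_of hP, ind_of (h hP)]
  · rw [ind_of_not hP]; exact ind_nonneg Q

lemma ind_congr {P Q : Prop} (h : P ↔ Q) : ind P = ind Q := by rw [propext h]

lemma ind_or_of_exclusive {P Q : Prop} (h : P → ¬ Q) : ind (P ∨ Q) = ind P + ind Q := by
  by_cases hP : P
  · simp [ind, hP, h hP]
  · by_cases hQ : Q <;> simp [ind, hP, hQ]

/-- The lists of length `n` over a finite type. -/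
noncomputable def listsOfLength (V : Type*) [Fintype V] (n : ℕ) : Finset (List V) :=
  (List.finite_length_eq V n).toFinset

section Lists

variable {V : Type*} [Fintype V]

@[simp] lemma mem_listsOfLength {n : ℕ} {l : List V} :
    l ∈ listsOfLength V n ↔ l.length = n := by
  simp [listsOfLength]

lemma sum_listsOfLength_zero (f : List V → ℝ) : ∑ l ∈ listsOfLength V 0, f l = f [] := by
  have : listsOfLength V 0 = {[]} := by ext l; simp
  rw [this, Finset.sum_singleton]

lemma sum_listsOfLength_succ (n : ℕ) (f : List V → ℝ) :
    ∑ l ∈ listsOfLength V (n + 1), f l = ∑ v, ∑ l ∈ listsOfLength V n, f (v :: l) := by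
  rw [← Finset.sum_product']
  symm
  refine Finset.sum_bij (fun x _ => x.1 :: x.2) ?_ ?_ ?_ ?_
  · rintro ⟨v, l⟩ h
    simpa using h
  · rintro ⟨v, l⟩ _ ⟨v', l'⟩ _ h
    simpa using h
  · intro l hl
    cases l with
    | nil => simp at hl
    | cons v l => exact ⟨(v, l), by simpa using hl, rfl⟩
  · simp

lemma sum_listsOfLength_one (f : List V → ℝ) :
    ∑ l ∈ listsOfLength V 1, f l = ∑ v, f [v] := by
  simp [sum_listsOfLength_succ, sum_listsOfLength_zero]

/-- Summing over lists with a distinguished position. -/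
lemma sum_listsOfLength_split (i j : ℕ) (f : List V → ℝ) :
    ∑ l ∈ listsOfLength V (i + 1 + j), f l =
      ∑ v, ∑ A ∈ listsOfLength V i, ∑ B ∈ listsOfLength V j, f (A.reverse ++ v :: B) := by
  induction i generalizing j with
  | zero =>
    rw [show 0 + 1 + j = j + 1 by ring, sum_listsOfLength_succ]
    simp [sum_listsOfLength_zero]
  | succ i ih =>
    rw [show i + 1 + 1 + j = i + 1 + (j + 1) by ring, ih]
    simp only [sum_listsOfLength_succ, List.reverse_cons, List.append_assoc, List.cons_append,
      List.nil_append]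
    calc _ = ∑ v : V, ∑ w : V, ∑ A ∈ listsOfLength V i, ∑ B ∈ listsOfLength V j,
          f (A.reverse ++ v :: w :: B) := by
          refine Finset.sum_congr rfl fun v _ => ?_
          rw [Finset.sum_comm]
      _ = _ := Finset.sum_comm

lemma sum_listsOfLength_reverse (n : ℕ) (f : List V → ℝ) :
    ∑ l ∈ listsOfLength V n, f l.reverse = ∑ l ∈ listsOfLength V n, f l := by
  refine Finset.sum_bij (fun l _ => l.reverse) ?_ ?_ ?_ ?_
  · intro l hl; simpa using hl
  · intro l _ l' _ h; simpa using h
  · intro l hl; exact ⟨l.reverse, by simpa using hl, by simp⟩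
  · simp

/-- Summing over concatenations. -/
lemma sum_listsOfLength_append (i j : ℕ) (f : List V → ℝ) :
    ∑ l ∈ listsOfLength V (i + j), f l =
      ∑ A ∈ listsOfLength V i, ∑ B ∈ listsOfLength V j, f (A ++ B) := by
  induction i generalizing f with
  | zero => simp [sum_listsOfLength_zero]
  | succ i ih =>
    rw [show i + 1 + j = i + j + 1 by ring]
    simp [sum_listsOfLength_succ, ih]

end Lists

/-! ### Non-backtracking vertex sequences -/

namespace SimpleGraph

variable {V : Type*} (G : SimpleGraph V)

/-- Vertex sequences of non-backtracking walks. -/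
def NB : List V → Prop
  | [] => True
  | [_] => True
  | a :: b :: l => G.Adj a b ∧ (∀ c ∈ l.head?, c ≠ a) ∧ NB (b :: l)

variable {G}

@[simp] lemma nb_nil : G.NB [] := trivial

@[simp] lemma nb_singleton (v : V) : G.NB [v] := trivial

lemma nb_cons_cons {a b : V} {l : List V} :
    G.NB (a :: b :: l) ↔ G.Adj a b ∧ (∀ c ∈ l.head?, c ≠ a) ∧ G.NB (b :: l) := Iff.rfl

lemma nb_pair {a b : V} : G.NB [a, b] ↔ G.Adj a b := by simp [nb_cons_cons]

lemma nb_cons_cons_cons {a b c : V} {l : List V} :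
    G.NB (a :: b :: c :: l) ↔ G.Adj a b ∧ c ≠ a ∧ G.NB (b :: c :: l) := by
  rw [nb_cons_cons]; simp

lemma NB.tail {a : V} {l : List V} (h : G.NB (a :: l)) : G.NB l := by
  cases l with
  | nil => trivial
  | cons b l => exact h.2.2

/-- Gluing two non-backtracking walks at their common start. -/
lemma nb_glue {A B : List V} {v : V} :
    G.NB (A.reverse ++ v :: B) ↔
      G.NB (v :: A) ∧ G.NB (v :: B) ∧ ∀ a ∈ A.head?, ∀ b ∈ B.head?, a ≠ b := by
  induction A generalizing v B with
  | nil => simp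
  | cons a A ih =>
    have e : (a :: A).reverse ++ v :: B = A.reverse ++ a :: (v :: B) := by simp
    rw [e, ih, nb_cons_cons, nb_cons_cons]
    have := G.adj_comm a v
    have h1 : (∀ c ∈ B.head?, c ≠ a) ↔ ∀ b ∈ B.head?, a ≠ b := by
      simp only [ne_comm]
    simp only [List.head?_cons, Option.mem_some_iff, forall_eq']
    rw [this, h1]
    tauto

lemma nb_reverse {l : List V} : G.NB l.reverse ↔ G.NB l := by
  cases l with
  | nil => simp
  | cons v A =>
    have := nb_glue (G := G) (A := A) (B := []) (v := v)
    simpa using this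

lemma NB.of_append_left {l l' : List V} (h : G.NB (l ++ l')) : G.NB l := by
  have h1 : ∀ (l' l : List V), G.NB (l' ++ l) → G.NB l := by
    intro l'
    induction l' with
    | nil => intro l h; exact h
    | cons a l' ih => intro l h; exact ih l (NB.tail h)
  rw [← nb_reverse, List.reverse_append] at h
  exact nb_reverse.1 (h1 _ _ h)

lemma NB.of_append_right {l l' : List V} (h : G.NB (l ++ l')) : G.NB l' := by
  induction l with
  | nil => exact h
  | cons a l ih => exact ih (NB.tail h)

/-- A non-backtracking walk shorter than the girth is a path. -/
lemma NB.exists_path {v : V} {A : List V} (h : G.NB (v :: A))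
    (hg : ((A.length + 1 : ℕ) : ℕ∞) ≤ G.egirth) :
    ∃ (u : V) (p : G.Walk v u), p.support = v :: A ∧ p.IsPath := by
  induction A generalizing v with
  | nil => exact ⟨v, Walk.nil, by simp, by simp⟩
  | cons a A ih =>
    obtain ⟨hva, hback, hA⟩ := h
    obtain ⟨u, q, hq, hqp⟩ := ih hA (le_trans (by simp) hg)
    refine ⟨u, Walk.cons hva q, by simp [hq], ?_⟩
    rw [Walk.cons_isPath_iff]
    refine ⟨hqp, fun hv => ?_⟩
    classical
    have hlen : (q.takeUntil v hv).length ≤ A.length := by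
      have h1 := q.length_takeUntil_le_length hv
      have h2 := q.length_support
      rw [hq] at h2
      simp at h2
      omega
    -- If the edge back to `v` already lies on the path from `a` to `v`, it is the first edge of
    -- that path, so the walk backtracks at once. Otherwise the path closes up to a cycle shorter
    -- than the girth.
    by_cases hc : s(v, a) ∈ (q.takeUntil v hv).edges
    · have hp := hqp.takeUntil hv
      have hspec := q.take_spec hv
      generalize q.takeUntil v hv = w at hc hp hspec
      cases w with
      | nil => exact G.loopless.irrefl _ hva
      | cons h' w =>
        rw [Walk.cons_isPath_iff] at hp
        rw [Walk.edges_cons, List.mem_cons] at hc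
        rcases hc with hc | hc
        · rw [Sym2.eq_swap] at hc
          rw [Sym2.congr_right] at hc
          subst hc
          have h3 : (q.support) = a :: (w.append (q.dropUntil v hv)).support := by
            conv_lhs => rw [← hspec]
            simp
          rw [hq] at h3
          have h4 : A = (w.append (q.dropUntil v hv)).support := by simpa using h3
          rw [h4, ← Walk.cons_tail_support] at hback
          exact hback v rfl rfl
        · exact hp.2 (Walk.snd_mem_support_of_mem_edges _ hc)
    · have hcyc : (Walk.cons hva (q.takeUntil v hv)).IsCycle :=
        (Walk.cons_isCycle_iff _ _).2 ⟨hqp.takeUntil hv, hc⟩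
      have h5 := hcyc.egirth_le_length
      rw [Walk.length_cons] at h5
      have h6 := hg.trans h5
      rw [Nat.cast_le] at h6
      simp at h6
      omega

lemma NB.nodup {l : List V} (h : G.NB l) (hg : (l.length : ℕ∞) ≤ G.egirth) : l.Nodup := by
  cases l with
  | nil => simp
  | cons v A =>
    obtain ⟨u, p, hp, hpp⟩ := h.exists_path (by simpa using hg)
    rw [← hp]
    exact hpp.support_nodup

/-- The natural number `girth` is 0 on acyclic graphs, where `egirth` is infinite, so passing to
`egirth` loses nothing. -/
lemma egirth_le_of_lt_girth {n : ℕ} (h : n ≤ G.girth) : (n : ℕ∞) ≤ G.egirth := by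
  by_cases ht : G.egirth = ⊤
  · rw [ht]; exact le_top
  · rw [← ENat.natCast_toNat ht]
    exact_mod_cast h

lemma NB.nodup_of_le_girth {l : List V} (h : G.NB l) (hg : l.length ≤ G.girth) : l.Nodup :=
  h.nodup (egirth_le_of_lt_girth hg)

end SimpleGraph

/-! ### First passage below the starting vertex -/

section Exit

variable {V : Type*} [LinearOrder V]

/-- The last entry is the first one that is at most `t`. -/
def ExitsBelow (t : V) (l : List V) : Prop :=
  ∃ (M : List V) (w : V), l = M ++ [w] ∧ (∀ m ∈ M, t < m) ∧ w ≤ t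

/-- All entries exceed `t`. -/
def StaysAbove (t : V) (l : List V) : Prop := ∀ y ∈ l, t < y

lemma exitsBelow_append_singleton {t w : V} {M : List V} :
    ExitsBelow t (M ++ [w]) ↔ (∀ m ∈ M, t < m) ∧ w ≤ t := by
  constructor
  · rintro ⟨M', w', h, h1, h2⟩
    obtain ⟨rfl, h3⟩ := List.append_inj' h rfl
    simp at h3
    subst h3
    exact ⟨h1, h2⟩
  · rintro ⟨h1, h2⟩
    exact ⟨M, w, rfl, h1, h2⟩

@[simp] lemma exitsBelow_singleton {t a : V} : ExitsBelow t [a] ↔ a ≤ t := by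
  simpa using exitsBelow_append_singleton (t := t) (w := a) (M := [])

lemma exitsBelow_cons_cons {t a b : V} {l : List V} :
    ExitsBelow t (a :: b :: l) ↔ t < a ∧ ExitsBelow t (b :: l) := by
  rcases List.eq_nil_or_concat (b :: l) with h | ⟨M, w, h⟩
  · simp at h
  · rw [List.concat_eq_append] at h
    rw [h, ← List.cons_append, exitsBelow_append_singleton, exitsBelow_append_singleton]
    simp [and_assoc]

lemma staysAbove_cons {t a : V} {l : List V} :
    StaysAbove t (a :: l) ↔ t < a ∧ StaysAbove t l := by
  simp [StaysAbove]

/-- The sequence returns for the first time below its first entry at its last entry. -/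
def IsDescent (l : List V) : Prop := ∃ u A, l = u :: A ∧ ExitsBelow u A

lemma isDescent_cons {u : V} {A : List V} : IsDescent (u :: A) ↔ ExitsBelow u A := by
  constructor
  · rintro ⟨u', A', h, h'⟩
    simp only [List.cons.injEq] at h
    obtain ⟨rfl, rfl⟩ := h
    exact h'
  · intro h
    exact ⟨u, A, rfl, h⟩

/-- The entry at position `i` is the unique minimum of the inner entries, and it exceeds
both ends. -/
def InnerMinAt (i : ℕ) (l : List V) : Prop :=
  ∃ v A B, l = A.reverse ++ v :: B ∧ A.length = i ∧ ExitsBelow v A ∧ ExitsBelow v B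

lemma innerMinAt_iff {i : ℕ} {v : V} {A B : List V} (h : A.length = i) :
    InnerMinAt i (A.reverse ++ v :: B) ↔ ExitsBelow v A ∧ ExitsBelow v B := by
  constructor
  · rintro ⟨v', A', B', h1, h2, h3, h4⟩
    obtain ⟨h5, h6⟩ := List.append_inj h1 (by simp [h, h2])
    simp only [List.reverse_inj, List.cons.injEq] at h5 h6
    obtain ⟨rfl, rfl⟩ := h6
    subst h5
    exact ⟨h3, h4⟩
  · rintro ⟨h1, h2⟩
    exact ⟨v, A, B, rfl, h, h1, h2⟩

/-- Each of two such entries is an inner entry on one side of the other, so each would be strictly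
below the other. -/
lemma InnerMinAt.unique {i j : ℕ} {l : List V} (hi : InnerMinAt i l) (hj : InnerMinAt j l) :
    i = j := by
  wlog h : i < j generalizing i j
  · rcases lt_trichotomy i j with h' | h' | h'
    · exact this hi hj h'
    · exact h'
    · exact (this hj hi h').symm
  exfalso
  obtain ⟨v, _, _, rfl, hA, ⟨A, a, rfl, hA1, hA2⟩, ⟨B, b, rfl, hB1, hB2⟩⟩ := hi
  obtain ⟨w, _, _, hl, hC, ⟨C, c, rfl, hC1, hC2⟩, ⟨D, d, rfl, hD1, hD2⟩⟩ := hj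
  simp only [List.reverse_append, List.reverse_cons, List.reverse_nil, List.nil_append,
    List.cons_append, List.cons.injEq] at hl
  obtain ⟨rfl, hl⟩ := hl
  have hl' : A.reverse ++ v :: B = C.reverse ++ w :: D := by
    have : (A.reverse ++ v :: B) ++ [b] = (C.reverse ++ w :: D) ++ [d] := by simpa using hl
    exact (List.append_inj' this rfl).1
  simp at hA hC
  have hvC : v ∈ C.reverse := by
    have h1 : (A.reverse ++ v :: B)[A.length]? = some v := by simp
    rw [hl', List.getElem?_append_left (by simp; omega)] at h1
    exact List.mem_of_getElem? h1
  have hwB : w ∈ B := by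
    have h1 : (C.reverse ++ w :: D)[C.length]? = some w := by simp
    rw [← hl', List.getElem?_append_right (by simp; omega)] at h1
    have h2 : C.length - A.reverse.length = (C.length - A.length - 1) + 1 := by simp; omega
    rw [h2, List.getElem?_cons_succ] at h1
    exact List.mem_of_getElem? h1
  exact lt_asymm (hC1 v (by simpa using hvC)) (hB1 w hwB)

/-- Both ends lie below all inner entries. Starting from the higher end, the first entry not above
it is therefore the opposite end. -/
lemma InnerMinAt.isDescent {i : ℕ} {l : List V} (hi : InnerMinAt i l) (hl : l.Nodup) :
    IsDescent l ∨ IsDescent l.reverse := by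
  obtain ⟨v, _, _, rfl, hA, ⟨A, a, rfl, hA1, hA2⟩, ⟨B, b, rfl, hB1, hB2⟩⟩ := hi
  simp only [List.reverse_append, List.reverse_cons, List.reverse_nil, List.nil_append,
    List.cons_append, List.append_assoc, List.reverse_reverse,
    isDescent_cons] at hl ⊢
  have ha : a < v := lt_of_le_of_ne hA2 (by
    rintro rfl
    simp at hl)
  have hb : b < v := lt_of_le_of_ne hB2 (by
    rintro rfl
    simp [List.nodup_append] at hl)
  have e1 : A.reverse ++ v :: (B ++ [b]) = (A.reverse ++ v :: B) ++ [b] := by simp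
  have e2 : B.reverse ++ v :: (A ++ [a]) = (B.reverse ++ v :: A) ++ [a] := by simp
  rw [e1, e2, exitsBelow_append_singleton, exitsBelow_append_singleton]
  rcases le_total b a with h | h
  · left
    refine ⟨fun m hm => ?_, h⟩
    simp only [List.mem_append, List.mem_reverse, List.mem_cons] at hm
    rcases hm with hm | rfl | hm
    · exact ha.trans (hA1 m hm)
    · exact ha
    · exact ha.trans (hB1 m hm)
  · right
    refine ⟨fun m hm => ?_, h⟩
    simp only [List.mem_append, List.mem_reverse, List.mem_cons] at hm
    rcases hm with hm | rfl | hm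
    · exact hb.trans (hB1 m hm)
    · exact hb
    · exact hb.trans (hA1 m hm)

/-- Descending in both directions forces the two ends to be equal. -/
lemma IsDescent.not_reverse {l : List V} (h : IsDescent l) (hl : l.Nodup) :
    ¬ IsDescent l.reverse := by
  obtain ⟨u, _, rfl, ⟨M, w, rfl, h1, h2⟩⟩ := h
  simp only [List.reverse_cons, List.reverse_append, List.reverse_nil, List.nil_append,
    List.cons_append, isDescent_cons, exitsBelow_append_singleton]
  rintro ⟨-, h3⟩
  simp [le_antisymm h2 h3] at hl

end Exit

/-! ### Counting non-backtracking walks along darts -/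

namespace SimpleGraph

variable {V : Type*} [Fintype V] (G : SimpleGraph V)

/-- The number of non-backtracking walks `v, a, …` with `n` vertices after `a` whose part after
`v` has property `Q`. -/
noncomputable def dartCount (Q : List V → Prop) (n : ℕ) (v a : V) : ℝ :=
  ∑ A ∈ listsOfLength V n, ind (G.NB (v :: a :: A) ∧ Q (a :: A))

/-- The sum of `f` over pairs of darts with the same start and distinct ends. -/
noncomputable def pairing (f g : V → V → ℝ) : ℝ :=
  ∑ v : V, ∑ a : V, ∑ b : V, ind (a ≠ b) * (f v a * g v b)

variable {G}

lemma dartCount_nonneg (Q : List V → Prop) (n : ℕ) (v a : V) : 0 ≤ G.dartCount Q n v a :=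
  Finset.sum_nonneg fun _ _ => ind_nonneg _

lemma dartCount_mono {Q Q' : List V → Prop} (h : ∀ l, Q l → Q' l) (n : ℕ) (v a : V) :
    G.dartCount Q n v a ≤ G.dartCount Q' n v a :=
  Finset.sum_le_sum fun _ _ => ind_mono fun hx => ⟨hx.1, h _ hx.2⟩

lemma dartCount_zero (Q : List V → Prop) (v a : V) :
    G.dartCount Q 0 v a = ind (G.Adj v a) * ind (Q [a]) := by
  rw [dartCount, sum_listsOfLength_zero, nb_pair, ind_and]

/-- The hypothesis on `Q` is the common shape of `ExitsBelow`, `StaysAbove` and the trivial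
property, so that one recursion along the first step serves all three. -/
lemma dartCount_succ {Q : List V → Prop} {P : V → Prop}
    (h : ∀ a b l, Q (a :: b :: l) ↔ P a ∧ Q (b :: l)) (n : ℕ) (v a : V) :
    G.dartCount Q (n + 1) v a =
      ind (G.Adj v a) * ind (P a) * ∑ b, ind (b ≠ v) * G.dartCount Q n a b := by
  rw [dartCount, sum_listsOfLength_succ, Finset.mul_sum]
  refine Finset.sum_congr rfl fun b _ => ?_
  rw [dartCount, Finset.mul_sum, Finset.mul_sum]
  refine Finset.sum_congr rfl fun A _ => ?_
  rw [nb_cons_cons_cons, h]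
  simp only [ind_and]
  ring

lemma dartCount_mul_adj (Q : List V → Prop) (n : ℕ) (v a : V) :
    ind (G.Adj v a) * G.dartCount Q n v a = G.dartCount Q n v a := by
  rw [dartCount, Finset.mul_sum]
  refine Finset.sum_congr rfl fun A _ => ?_
  rw [← ind_and]
  exact ind_congr ⟨fun h => h.2, fun h => ⟨h.1.1, h⟩⟩

lemma sum_ind_ne {q : ℝ} (hreg : ∀ v, ∑ a, ind (G.Adj v a) = q + 1) {v a : V}
    (h : G.Adj v a) : ∑ b, ind (b ≠ v) * ind (G.Adj a b) = q := by
  have h1 : ∀ b, ind (b ≠ v) * ind (G.Adj a b) = ind (G.Adj a b) - ind (b = v) := by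
    intro b
    by_cases hb : b = v
    · subst hb; simp [ind_of h.symm]
    · simp [ind_of_not hb, ind_of hb]
  simp only [h1, Finset.sum_sub_distrib, hreg]
  classical
  simp [ind]

lemma dartCount_true {q : ℝ} (hreg : ∀ v, ∑ a, ind (G.Adj v a) = q + 1) (n : ℕ) (v a : V) :
    G.dartCount (fun _ => True) n v a = ind (G.Adj v a) * q ^ n := by
  induction n generalizing v a with
  | zero => simp [dartCount_zero]
  | succ n ih =>
    rw [dartCount_succ (P := fun _ => True) (by simp)]
    simp only [ih, ← mul_assoc, ← Finset.sum_mul]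
    by_cases h : G.Adj v a
    · rw [sum_ind_ne hreg h]; simp only [ind_true, mul_one]; ring
    · simp [ind_of_not h]

lemma dartCount_le {q : ℝ} (hreg : ∀ v, ∑ a, ind (G.Adj v a) = q + 1) (Q : List V → Prop) (n : ℕ)
    (v a : V) : G.dartCount Q n v a ≤ ind (G.Adj v a) * q ^ n := by
  rw [← dartCount_true hreg]
  exact dartCount_mono (fun _ _ => trivial) n v a

lemma sum_dartCount (Q : List V → Prop) (n : ℕ) (v : V) :
    ∑ a, G.dartCount Q n v a = ∑ A ∈ listsOfLength V (n + 1), ind (G.NB (v :: A) ∧ Q A) := by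
  rw [sum_listsOfLength_succ]
  rfl

lemma sum_ind_glue (Q₁ Q₂ : List V → Prop) (i j : ℕ) (v : V) :
    ∑ A ∈ listsOfLength V (i + 1), ∑ B ∈ listsOfLength V (j + 1),
        ind (G.NB (A.reverse ++ v :: B) ∧ Q₁ A ∧ Q₂ B) =
      ∑ a, ∑ b, ind (a ≠ b) * (G.dartCount Q₁ i v a * G.dartCount Q₂ j v b) := by
  rw [sum_listsOfLength_succ]
  refine Finset.sum_congr rfl fun a _ => ?_
  simp only [sum_listsOfLength_succ]
  rw [Finset.sum_comm]
  refine Finset.sum_congr rfl fun b _ => ?_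
  rw [dartCount, dartCount, Finset.sum_mul_sum, Finset.mul_sum]
  refine Finset.sum_congr rfl fun A _ => ?_
  rw [Finset.mul_sum]
  refine Finset.sum_congr rfl fun B _ => ?_
  rw [nb_glue]
  simp only [List.head?_cons, Option.mem_some_iff, forall_eq', ind_and]
  ring

/-- By `nb_glue`, a walk with a marked inner vertex is a pair of walks from that vertex with
distinct first steps. The properties `Q₁` and `Q₂` are read outwards from the marked vertex. -/
lemma sum_ind_split (Q : List V → Prop) (Q₁ Q₂ : V → List V → Prop) (i j : ℕ)
    (h : ∀ A v B, A.length = i + 1 → B.length = j + 1 →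
      (Q (A.reverse ++ v :: B) ↔ Q₁ v A ∧ Q₂ v B)) :
    ∑ l ∈ listsOfLength V (i + j + 3), ind (G.NB l ∧ Q l) =
      pairing (fun v => G.dartCount (Q₁ v) i v) (fun v => G.dartCount (Q₂ v) j v) := by
  rw [show i + j + 3 = (i + 1) + 1 + (j + 1) by ring, sum_listsOfLength_split, pairing]
  refine Finset.sum_congr rfl fun v _ => ?_
  rw [← sum_ind_glue]
  refine Finset.sum_congr rfl fun A hA => Finset.sum_congr rfl fun B hB => ?_
  rw [mem_listsOfLength] at hA hB
  rw [h A v B hA hB]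

lemma pairing_nonneg {f g : V → V → ℝ} (hf : ∀ v a, 0 ≤ f v a) (hg : ∀ v a, 0 ≤ g v a) :
    0 ≤ pairing f g :=
  Finset.sum_nonneg fun v _ => Finset.sum_nonneg fun a _ => Finset.sum_nonneg fun b _ =>
    mul_nonneg (ind_nonneg _) (mul_nonneg (hf v a) (hg v b))

lemma pairing_comm (f g : V → V → ℝ) : pairing f g = pairing g f := by
  unfold pairing
  refine Finset.sum_congr rfl fun v _ => ?_
  rw [Finset.sum_comm]
  refine Finset.sum_congr rfl fun a _ => Finset.sum_congr rfl fun b _ => ?_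
  rw [ind_congr (ne_comm (a := a) (b := b)), mul_comm (f v b)]

/-- The condition that the two darts differ is imposed by subtracting the diagonal, which leaves a
sum of products of vertex totals. -/
lemma pairing_eq (f g : V → V → ℝ) :
    pairing f g = ∑ v, (∑ a, f v a) * (∑ b, g v b) - ∑ v, ∑ a, f v a * g v a := by
  unfold pairing
  rw [← Finset.sum_sub_distrib]
  refine Finset.sum_congr rfl fun v _ => ?_
  rw [Finset.sum_mul_sum, ← Finset.sum_sub_distrib]
  refine Finset.sum_congr rfl fun a _ => ?_
  classical
  have : ∀ b, ind (a ≠ b) * (f v a * g v b)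
      = f v a * g v b - if a = b then f v a * g v b else 0 := by
    intro b
    by_cases h : a = b <;> simp [h, ind]
  simp only [this, Finset.sum_sub_distrib, Finset.sum_ite_eq, Finset.mem_univ, if_true]

lemma pairing_sum_left {ι : Type*} (s : Finset ι) (f : ι → V → V → ℝ) (g : V → V → ℝ) :
    pairing (fun v a => ∑ i ∈ s, f i v a) g = ∑ i ∈ s, pairing (f i) g := by
  unfold pairing
  simp only [Finset.sum_mul, Finset.mul_sum]
  rw [Finset.sum_comm (s := s)]
  refine Finset.sum_congr rfl fun v _ => ?_
  rw [Finset.sum_comm (s := s)]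
  refine Finset.sum_congr rfl fun a _ => ?_
  rw [Finset.sum_comm]

lemma pairing_sum_right {ι : Type*} (s : Finset ι) (f : ι → V → V → ℝ) (g : V → V → ℝ) :
    pairing g (fun v a => ∑ i ∈ s, f i v a) = ∑ i ∈ s, pairing g (f i) := by
  rw [pairing_comm, pairing_sum_left]
  exact Finset.sum_congr rfl fun i _ => pairing_comm _ _

lemma pairing_sub_left (f f' g : V → V → ℝ) :
    pairing (fun v a => f v a - f' v a) g = pairing f g - pairing f' g := by
  unfold pairing
  simp only [← Finset.sum_sub_distrib]
  refine Finset.sum_congr rfl fun v _ => Finset.sum_congr rfl fun a _ =>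
    Finset.sum_congr rfl fun b _ => by ring

lemma pairing_sub_right (f f' g : V → V → ℝ) :
    pairing g (fun v a => f v a - f' v a) = pairing g f - pairing g f' := by
  rw [pairing_comm, pairing_sub_left, pairing_comm f, pairing_comm f']

lemma pairing_smul_left (c : ℝ) (f g : V → V → ℝ) :
    pairing (fun v a => f v a / c) g = pairing f g / c := by
  unfold pairing
  simp only [Finset.sum_div]
  refine Finset.sum_congr rfl fun v _ => Finset.sum_congr rfl fun a _ =>
    Finset.sum_congr rfl fun b _ => by ring

lemma pairing_smul_right (c : ℝ) (f g : V → V → ℝ) :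
    pairing g (fun v a => f v a / c) = pairing g f / c := by
  rw [pairing_comm, pairing_smul_left, pairing_comm]

lemma pairing_mono {f f' g g' : V → V → ℝ} (hf : ∀ v a, 0 ≤ f v a) (hg : ∀ v a, 0 ≤ g v a)
    (hff : ∀ v a, f v a ≤ f' v a) (hgg : ∀ v a, g v a ≤ g' v a) :
    pairing f g ≤ pairing f' g' :=
  Finset.sum_le_sum fun v _ => Finset.sum_le_sum fun a _ => Finset.sum_le_sum fun b _ =>
    mul_le_mul_of_nonneg_left
      (mul_le_mul (hff v a) (hgg v b) (hg v b) ((hf v a).trans (hff v a))) (ind_nonneg _)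

lemma pairing_adj_right {q : ℝ} (hreg : ∀ v, ∑ a, ind (G.Adj v a) = q + 1)
    (f : V → V → ℝ) (hf : ∀ v a, ind (G.Adj v a) * f v a = f v a) :
    pairing f (fun v a => ind (G.Adj v a)) = q * ∑ v, ∑ a, f v a := by
  rw [pairing_eq]
  simp only [hreg]
  simp only [mul_comm (f _ _), hf]
  rw [← Finset.sum_mul]
  ring

lemma sum_sum_adj {q : ℝ} (hreg : ∀ v, ∑ a, ind (G.Adj v a) = q + 1) :
    ∑ v : V, ∑ a, ind (G.Adj v a) = Fintype.card V * (q + 1) := by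
  simp only [hreg, Finset.sum_const, Finset.card_univ, nsmul_eq_mul]

end SimpleGraph

/-! ### Exit and survival statistics of non-backtracking walks -/

namespace SimpleGraph

variable {V : Type*} [Fintype V] [LinearOrder V] (G : SimpleGraph V)

/-- The proportion of the non-backtracking walks starting with the dart `va` that are below `t`
for the first time at step `i`. -/
noncomputable def exitProb (q : ℝ) (t : V) : ℕ → V → V → ℝ
  | 0, _, _ => 0
  | i + 1, v, a => G.dartCount (ExitsBelow t) i v a / q ^ i

/-- The proportion of the non-backtracking walks starting with the dart `va` that stay above `t`
for `i` steps. -/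
noncomputable def surviveProb (q : ℝ) (t : V) : ℕ → V → V → ℝ
  | 0, v, a => ind (G.Adj v a)
  | i + 1, v, a => G.dartCount (StaysAbove t) i v a / q ^ i

/-- The mean, over all darts, of the probability of a first exit at step `i`. -/
noncomputable def exitMean (q : ℝ) (i : ℕ) : ℝ :=
  (∑ v, ∑ a, G.exitProb q v i v a) / (Fintype.card V * (q + 1))

/-- The correlation, over pairs of darts with common start, of the exit probabilities at steps
`i` and `j`. -/
noncomputable def exitCorr (q : ℝ) (i j : ℕ) : ℝ :=
  pairing (fun v => G.exitProb q v i v) (fun v => G.exitProb q v j v) /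
    (Fintype.card V * (q + 1) * q)

/-- The correlation of the survival probabilities. -/
noncomputable def surviveCorr (q : ℝ) (i j : ℕ) : ℝ :=
  pairing (fun v => G.surviveProb q v i v) (fun v => G.surviveProb q v j v) /
    (Fintype.card V * (q + 1) * q)

/-- The number of non-backtracking walks of length `i` exiting below their start at the end. -/
noncomputable def descentCount (i : ℕ) : ℝ :=
  ∑ l ∈ listsOfLength V (i + 1), ind (G.NB l ∧ IsDescent l)

variable {G} {q : ℝ}

lemma exitProb_nonneg (hq : 0 < q) (t : V) (i : ℕ) (v a : V) : 0 ≤ G.exitProb q t i v a := by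
  cases i with
  | zero => exact le_rfl
  | succ i => exact div_nonneg (dartCount_nonneg _ _ _ _) (by positivity)

lemma surviveProb_nonneg (hq : 0 < q) (t : V) (i : ℕ) (v a : V) :
    0 ≤ G.surviveProb q t i v a := by
  cases i with
  | zero => exact ind_nonneg _
  | succ i => exact div_nonneg (dartCount_nonneg _ _ _ _) (by positivity)

lemma exitProb_le (hq : 0 < q) (hreg : ∀ v, ∑ a, ind (G.Adj v a) = q + 1)
    (t : V) (i : ℕ) (v a : V) : G.exitProb q t i v a ≤ ind (G.Adj v a) := by
  cases i with
  | zero => exact ind_nonneg _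
  | succ i =>
    rw [exitProb, div_le_iff₀ (by positivity)]
    exact dartCount_le hreg _ _ _ _

lemma exitProb_one (t v a : V) : G.exitProb q t 1 v a = ind (G.Adj v a) * ind (a ≤ t) := by
  simp [exitProb, dartCount_zero]

lemma surviveProb_one (t v a : V) :
    G.surviveProb q t 1 v a = ind (G.Adj v a) * ind (t < a) := by
  simp [surviveProb, dartCount_zero, StaysAbove]

lemma exitProb_succ_succ (t : V) (i : ℕ) (v a : V) :
    G.exitProb q t (i + 2) v a =
      ind (G.Adj v a) * ind (t < a) * ((∑ b, ind (b ≠ v) * G.exitProb q t (i + 1) a b) / q) := by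
  rw [exitProb, dartCount_succ (P := fun a => t < a) (fun a b l => exitsBelow_cons_cons)]
  simp only [exitProb, pow_succ, mul_div_assoc', ← Finset.sum_div]
  rw [div_div]

lemma surviveProb_succ_succ (t : V) (i : ℕ) (v a : V) :
    G.surviveProb q t (i + 2) v a =
      ind (G.Adj v a) * ind (t < a) *
        ((∑ b, ind (b ≠ v) * G.surviveProb q t (i + 1) a b) / q) := by
  rw [surviveProb, dartCount_succ (P := fun a => t < a) (fun a b l => staysAbove_cons)]
  simp only [surviveProb, pow_succ, mul_div_assoc', ← Finset.sum_div]
  rw [div_div]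

/-- Within `s` steps a walk either reaches level `t` for the first time at exactly one step, or
never does. The induction peels off the first step, whose end has q continuations. -/
lemma sum_exitProb_add_surviveProb (hq : 0 < q) (hreg : ∀ v, ∑ a, ind (G.Adj v a) = q + 1)
    (t : V) (s : ℕ) (v a : V) :
    ∑ i ∈ Finset.range (s + 1), G.exitProb q t i v a + G.surviveProb q t s v a =
      ind (G.Adj v a) := by
  induction s generalizing v a with
  | zero => simp [exitProb, surviveProb]
  | succ s ih =>
    have hlt : ind (a ≤ t) + ind (t < a) = 1 := by
      rw [← ind_or_of_exclusive (fun h => not_lt.2 h)]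
      exact ind_of (le_or_gt a t)
    cases s with
    | zero =>
      simp only [Finset.sum_range_succ, Finset.sum_range_zero, exitProb_one, zero_add]
      rw [surviveProb_one]
      simp only [exitProb, zero_add]
      rw [← mul_add, hlt, mul_one]
    | succ s =>
      rw [Finset.sum_range_succ', Finset.sum_range_succ']
      have h0 : G.exitProb q t 0 v a = 0 := rfl
      rw [h0, exitProb_one]
      simp only [exitProb_succ_succ, surviveProb_succ_succ]
      rw [← Finset.mul_sum, ← Finset.sum_div, Finset.sum_comm]
      have h1 : ∑ b, ∑ i ∈ Finset.range (s + 1), ind (b ≠ v) * G.exitProb q t (i + 1) a b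
          + ∑ b, ind (b ≠ v) * G.surviveProb q t (s + 1) a b =
          ∑ b, ind (b ≠ v) * ind (G.Adj a b) := by
        rw [← Finset.sum_add_distrib]
        refine Finset.sum_congr rfl fun b _ => ?_
        rw [← ih a b, Finset.sum_range_succ' _ (s + 1), ← Finset.mul_sum, ← mul_add]
        simp [exitProb]
      by_cases h : G.Adj v a
      · rw [sum_ind_ne hreg h] at h1
        rw [ind_of h]
        calc _ = ind (a ≤ t) + ind (t < a) * ((∑ b, ∑ i ∈ Finset.range (s + 1),
                ind (b ≠ v) * G.exitProb q t (i + 1) a b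
                + ∑ b, ind (b ≠ v) * G.surviveProb q t (s + 1) a b) / q) := by ring
          _ = 1 := by rw [h1, div_self hq.ne', mul_one, hlt]
      · simp [ind_of_not h]

lemma sum_sum_exitProb (i : ℕ) :
    ∑ v, ∑ a, G.exitProb q v (i + 1) v a = G.descentCount (i + 1) / q ^ i := by
  rw [descentCount, sum_listsOfLength_succ, Finset.sum_div]
  refine Finset.sum_congr rfl fun v _ => ?_
  simp only [isDescent_cons]
  rw [← sum_dartCount, Finset.sum_div]
  rfl

lemma exitMean_zero : G.exitMean q 0 = 0 := by simp [exitMean, exitProb]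

lemma exitMean_succ (i : ℕ) :
    G.exitMean q (i + 1) = G.descentCount (i + 1) / (Fintype.card V * (q + 1) * q ^ i) := by
  rw [exitMean, sum_sum_exitProb, div_div]
  ring_nf

lemma exitMean_nonneg (hq : 0 < q) (i : ℕ) : 0 ≤ G.exitMean q i :=
  div_nonneg (Finset.sum_nonneg fun _ _ => Finset.sum_nonneg fun _ _ => exitProb_nonneg hq _ _ _ _)
    (by positivity)

lemma exitCorr_nonneg (hq : 0 < q) (i j : ℕ) : 0 ≤ G.exitCorr q i j :=
  div_nonneg (pairing_nonneg (fun _ _ => exitProb_nonneg hq _ _ _ _)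
    (fun _ _ => exitProb_nonneg hq _ _ _ _)) (by positivity)

lemma exitCorr_comm (i j : ℕ) : G.exitCorr q i j = G.exitCorr q j i := by
  rw [exitCorr, pairing_comm, exitCorr]

lemma exitCorr_zero_left (j : ℕ) : G.exitCorr q 0 j = 0 := by
  simp [exitCorr, pairing, exitProb]

lemma exitCorr_zero_right (i : ℕ) : G.exitCorr q i 0 = 0 := by
  rw [exitCorr_comm, exitCorr_zero_left]

/-- Glued at their start, the two exiting walks form one walk whose inner minimum is that start, at
position `i + 1`. -/
lemma exitCorr_succ_succ (i j : ℕ) :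
    G.exitCorr q (i + 1) (j + 1) =
      (∑ l ∈ listsOfLength V (i + j + 3), ind (G.NB l ∧ InnerMinAt (i + 1) l)) /
        (Fintype.card V * (q + 1) * q * q ^ (i + j)) := by
  rw [sum_ind_split _ (fun v => ExitsBelow v) (fun v => ExitsBelow v) i j
    (fun A v B hA _ => innerMinAt_iff hA), exitCorr]
  change pairing (fun v a => G.dartCount (ExitsBelow v) i v a / q ^ i)
    (fun v a => G.dartCount (ExitsBelow v) j v a / q ^ j) / _ = _
  rw [pairing_smul_left _ (fun v a => G.dartCount (ExitsBelow v) i v a),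
    pairing_smul_right _ (fun v a => G.dartCount (ExitsBelow v) j v a), div_div, div_div, pow_add]
  congr 1
  ring

/-- Walks with a unique inner minimum exceeding both ends are, up to reversal, descents. -/
lemma sum_ind_innerMinAt_le {k : ℕ} (hg : k ≤ G.girth) (s : Finset ℕ) :
    ∑ i ∈ s, ∑ l ∈ listsOfLength V k, ind (G.NB l ∧ InnerMinAt i l) ≤
      ∑ l ∈ listsOfLength V k, (ind (G.NB l ∧ IsDescent l) + ind (G.NB l ∧ IsDescent l.reverse)) := by
  rw [Finset.sum_comm]
  refine Finset.sum_le_sum fun l hl => ?_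
  rw [mem_listsOfLength] at hl
  by_cases h : ∃ i ∈ s, G.NB l ∧ InnerMinAt i l
  · obtain ⟨i, hi, h1, h2⟩ := h
    rw [Finset.sum_eq_single_of_mem i hi]
    · rw [ind_of ⟨h1, h2⟩]
      rcases h2.isDescent (h1.nodup_of_le_girth (hl ▸ hg)) with h3 | h3
      · rw [ind_of ⟨h1, h3⟩]; linarith [ind_nonneg (G.NB l ∧ IsDescent l.reverse)]
      · rw [ind_of (⟨h1, h3⟩ : _ ∧ IsDescent l.reverse)]
        linarith [ind_nonneg (G.NB l ∧ IsDescent l)]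
    · intro j _ hj
      exact ind_of_not fun h => hj (h.2.unique h2)
  · push Not at h
    rw [Finset.sum_eq_zero fun i hi => ind_of_not fun h' => h i hi h'.1 h'.2]
    exact add_nonneg (ind_nonneg _) (ind_nonneg _)

lemma sum_ind_descent_reverse (i : ℕ) :
    ∑ l ∈ listsOfLength V (i + 1), ind (G.NB l ∧ IsDescent l.reverse) = G.descentCount i := by
  rw [descentCount, ← sum_listsOfLength_reverse]
  simp [nb_reverse]

/-- A walk with `l` steps has its inner minimum at one position at most, so the left side counts
each walk at most once. A walk that is counted is a descent in one of its two directions, which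
gives the factor 2. The girth hypothesis makes the `l + 1` vertices distinct. -/
lemma sum_exitCorr_le [Nonempty V] (hq : 0 < q) {l : ℕ} (hl : 2 ≤ l) (hg : l + 1 ≤ G.girth) :
    ∑ x ∈ Finset.HasAntidiagonal.antidiagonal l, G.exitCorr q x.1 x.2 ≤ 2 * G.exitMean q l := by
  obtain ⟨k, rfl⟩ := Nat.exists_eq_add_of_le' hl
  have hn : (0 : ℝ) < Fintype.card V := by exact_mod_cast Fintype.card_pos
  rw [Finset.Nat.sum_antidiagonal_succ, Finset.Nat.sum_antidiagonal_succ']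
  simp only [exitCorr_zero_left, exitCorr_zero_right, zero_add]
  rw [exitMean_succ]
  have h1 : ∀ x ∈ Finset.HasAntidiagonal.antidiagonal k, G.exitCorr q (x.1 + 1) (x.2 + 1) =
      (∑ l ∈ listsOfLength V (k + 3), ind (G.NB l ∧ InnerMinAt (x.1 + 1) l)) /
        (Fintype.card V * (q + 1) * q ^ (k + 1)) := by
    intro x hx
    rw [Finset.HasAntidiagonal.mem_antidiagonal] at hx
    rw [exitCorr_succ_succ, hx, pow_succ]
    ring
  rw [Finset.sum_congr rfl h1, ← Finset.sum_div, mul_div_assoc', div_le_div_iff_of_pos_right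
    (by positivity)]
  have h2 := sum_ind_innerMinAt_le hg ((Finset.range (k + 1)).image (· + 1))
  rw [Finset.sum_image (by simp), Finset.sum_add_distrib, sum_ind_descent_reverse] at h2
  rw [Finset.Nat.sum_antidiagonal_eq_sum_range_succ_mk]
  have h3 : ∑ l ∈ listsOfLength V (k + 2 + 1), ind (G.NB l ∧ IsDescent l)
    = G.descentCount (k + 2) := rfl
  rw [h3] at h2
  simp only at h2 ⊢
  linarith

lemma exitProb_mul_adj (t : V) (i : ℕ) (v a : V) :
    ind (G.Adj v a) * G.exitProb q t i v a = G.exitProb q t i v a := by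
  cases i with
  | zero => simp [exitProb]
  | succ i => rw [exitProb, mul_div_assoc', dartCount_mul_adj]

/-- The survival correlation in terms of the exit correlations. -/
lemma surviveCorr_eq [Nonempty V]
    (hreg : ∀ v, ∑ a, ind (G.Adj v a) = q + 1) (hq : 0 < q) (s : ℕ) :
    G.surviveCorr q s s = 1 - 2 * ∑ i ∈ Finset.range (s + 1), G.exitMean q i +
      ∑ i ∈ Finset.range (s + 1), ∑ j ∈ Finset.range (s + 1), G.exitCorr q i j := by
  have hn : (0 : ℝ) < Fintype.card V := by exact_mod_cast Fintype.card_pos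
  have h1 : ∀ v a, G.surviveProb q v s v a =
      ind (G.Adj v a) - ∑ i ∈ Finset.range (s + 1), G.exitProb q v i v a := by
    intro v a
    rw [← sum_exitProb_add_surviveProb hq hreg v s v a]
    ring
  have h2 : (fun v => G.surviveProb q v s v) = fun v a =>
      ind (G.Adj v a) - ∑ i ∈ Finset.range (s + 1), G.exitProb q v i v a := by
    funext v a; exact h1 v a
  have hA := pairing_adj_right hreg (fun v a => ind (G.Adj v a)) (fun v a => ind_mul_self _)
  have hB : ∀ i, pairing (fun v => G.exitProb q v i v) (fun v a => ind (G.Adj v a)) =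
      q * ∑ v, ∑ a, G.exitProb q v i v a := fun i =>
    pairing_adj_right hreg _ (fun v a => exitProb_mul_adj v i v a)
  rw [sum_sum_adj hreg] at hA
  rw [surviveCorr, h2, pairing_sub_left, pairing_sub_right, pairing_sub_right, hA,
    pairing_comm (fun v a => ind (G.Adj v a)),
    pairing_sum_left _ (fun i v a => G.exitProb q v i v a),
    pairing_sum_left _ (fun i v a => G.exitProb q v i v a)]
  simp only [pairing_sum_right _ (fun i v a => G.exitProb q v i v a), hB, exitMean, exitCorr,
    ← Finset.sum_div, ← Finset.mul_sum]
  field_simp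
  ring

/-- Reversing a dart exchanges exit and survival at the first step, because adjacent vertices are
distinct. -/
lemma exitMean_one [Nonempty V]
    (hreg : ∀ v, ∑ a, ind (G.Adj v a) = q + 1) (hq : 0 < q) : G.exitMean q 1 = 1 / 2 := by
  have hn : (0 : ℝ) < Fintype.card V := by exact_mod_cast Fintype.card_pos
  have h1 : ∑ v, ∑ a, G.exitProb q v 1 v a = ∑ v, ∑ a, G.surviveProb q v 1 v a := by
    rw [Finset.sum_comm]
    refine Finset.sum_congr rfl fun a _ => Finset.sum_congr rfl fun v _ => ?_
    rw [exitProb_one, surviveProb_one, ← ind_and, ← ind_and]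
    refine ind_congr ⟨fun h => ⟨h.1.symm, lt_of_le_of_ne h.2 h.1.symm.ne⟩,
      fun h => ⟨h.1.symm, h.2.le⟩⟩
  have h2 : ∑ v, ∑ a, G.exitProb q v 1 v a + ∑ v, ∑ a, G.surviveProb q v 1 v a =
      Fintype.card V * (q + 1) := by
    rw [← sum_sum_adj hreg]
    simp only [← Finset.sum_add_distrib]
    refine Finset.sum_congr rfl fun v _ => Finset.sum_congr rfl fun a _ => ?_
    rw [← sum_exitProb_add_surviveProb hq hreg v 1 v a]
    simp [Finset.sum_range_succ, exitProb]
  rw [exitMean, div_eq_div_iff (by positivity) (by norm_num)]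
  linarith

/-- The survival correlation is bounded by the exit correlations with large total time. -/
lemma surviveCorr_le [Nonempty V]
    (hreg : ∀ v, ∑ a, ind (G.Adj v a) = q + 1) (hq : 0 < q) {s : ℕ} (hs : 1 ≤ s) (hg : s + 1 ≤ G.girth) :
    G.surviveCorr q s s ≤ ∑ x ∈ (Finset.range (s + 1) ×ˢ Finset.range (s + 1)).filter
      (fun x => s < x.1 + x.2), G.exitCorr q x.1 x.2 := by
  rw [surviveCorr_eq hreg hq, ← Finset.sum_product',
    ← Finset.sum_filter_add_sum_filter_not _ (fun x : ℕ × ℕ => s < x.1 + x.2)]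
  have h1 : ∑ x ∈ (Finset.range (s + 1) ×ˢ Finset.range (s + 1)).filter
      (fun x => ¬ s < x.1 + x.2), G.exitCorr q x.1 x.2 =
      ∑ l ∈ Finset.range (s + 1), ∑ x ∈ Finset.HasAntidiagonal.antidiagonal l, G.exitCorr q x.1 x.2 := by
    rw [← Finset.sum_fiberwise_of_maps_to (t := Finset.range (s + 1)) (g := fun x => x.1 + x.2)]
    · refine Finset.sum_congr rfl fun l hl => Finset.sum_congr ?_ fun _ _ => rfl
      ext ⟨i, j⟩
      simp at hl ⊢
      omega
    · rintro ⟨i, j⟩ h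
      simp at h ⊢
      omega
  -- The term -1 arises from time 1: it contributes 2 · 1/2 to the doubled sum of means, while no
  -- correlation of total time 1 is nonzero. All later times are compared by `sum_exitCorr_le`, and
  -- the resulting sum cancels in `surviveCorr_eq`.
  have h2 : ∑ l ∈ Finset.range (s + 1), ∑ x ∈ Finset.HasAntidiagonal.antidiagonal l, G.exitCorr q x.1 x.2 ≤
      2 * ∑ i ∈ Finset.range (s + 1), G.exitMean q i - 1 := by
    obtain ⟨k, rfl⟩ := Nat.exists_eq_add_of_le' hs
    rw [Finset.sum_range_succ', Finset.sum_range_succ', Finset.sum_range_succ',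
      Finset.sum_range_succ', exitMean_one hreg hq, exitMean_zero]
    have h3 : ∑ l ∈ Finset.range k, ∑ x ∈ Finset.HasAntidiagonal.antidiagonal (l + 1 + 1), G.exitCorr q x.1 x.2 ≤
        ∑ l ∈ Finset.range k, 2 * G.exitMean q (l + 1 + 1) := by
      refine Finset.sum_le_sum fun l hl => sum_exitCorr_le hq (by omega) ?_
      simp at hl
      omega
    rw [← Finset.mul_sum] at h3
    have h4 : ∑ x ∈ Finset.HasAntidiagonal.antidiagonal (0 + 1), G.exitCorr q x.1 x.2 = 0 := by
      rw [Finset.Nat.antidiagonal_succ]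
      simp [exitCorr_zero_left, exitCorr_zero_right]
    have h5 : ∑ x ∈ Finset.HasAntidiagonal.antidiagonal 0, G.exitCorr q x.1 x.2 = 0 := by
      simp [exitCorr_zero_left]
    linarith
  linarith

end SimpleGraph

/-! ### The position of the minimum, and linear decay of the survival correlation -/

section Splits

variable {V : Type*}

/-- The two sides of the entry at position `i`, read from that entry, satisfy `Q` and `Q'`. -/
def SplitsAt (Q Q' : V → List V → Prop) (i : ℕ) (l : List V) : Prop :=
  ∃ v A B, l = A.reverse ++ v :: B ∧ A.length = i ∧ Q v A ∧ Q' v B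

lemma splitsAt_iff {Q Q' : V → List V → Prop} {i : ℕ} {v : V} {A B : List V}
    (h : A.length = i) : SplitsAt Q Q' i (A.reverse ++ v :: B) ↔ Q v A ∧ Q' v B := by
  constructor
  · rintro ⟨v', A', B', h1, h2, h3, h4⟩
    obtain ⟨h5, h6⟩ := List.append_inj h1 (by simp [h, h2])
    simp only [List.reverse_inj, List.cons.injEq] at h5 h6
    obtain ⟨rfl, rfl⟩ := h6
    subst h5
    exact ⟨h3, h4⟩
  · rintro ⟨h1, h2⟩
    exact ⟨v, A, B, rfl, h, h1, h2⟩

variable [LinearOrder V]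

/-- A minimum of the sequence occurs among the first `s` entries. -/
def EarlyMin (s : ℕ) (l : List V) : Prop := ∃ w ∈ l.take s, ∀ y ∈ l, w ≤ y

lemma earlyMin_or_reverse {s : ℕ} (hs : 1 ≤ s) {l : List V} (hl : l.length = 2 * s) :
    EarlyMin s l ∨ EarlyMin s l.reverse := by
  have hne : l.toFinset.Nonempty := by
    rw [List.toFinset_nonempty_iff]
    rintro rfl
    simp at hl
    omega
  obtain ⟨w, hw, hmin⟩ := l.toFinset.exists_min_image id hne
  simp only [List.mem_toFinset, id] at hw hmin
  rw [← List.take_append_drop s l, List.mem_append] at hw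
  rcases hw with hw | hw
  · exact Or.inl ⟨w, hw, hmin⟩
  · refine Or.inr ⟨w, ?_, fun y hy => hmin y (by simpa using hy)⟩
    rw [List.take_reverse, List.mem_reverse, hl, show 2 * s - s = s by omega]
    exact hw

lemma EarlyMin.exists_split {s : ℕ} {l : List V} (h : EarlyMin s l) :
    ∃ P w Q, l = P ++ w :: Q ∧ P.length < s ∧ ∀ y ∈ l, w ≤ y := by
  obtain ⟨w, hw, hmin⟩ := h
  obtain ⟨P, Q, hPQ⟩ := List.append_of_mem hw
  refine ⟨P, w, Q ++ l.drop s, ?_, ?_, hmin⟩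
  · rw [← List.cons_append, ← List.append_assoc, ← hPQ, List.take_append_drop]
  · have := congrArg List.length hPQ
    simp at this
    omega

/-- If both sides have an early minimum, then the smaller one is far from both ends. -/
lemma splitsAt_staysAbove_of_earlyMin {s : ℕ} {l : List V} (hl : l.Nodup)
    (hlen : l.length = 4 * s - 1)
    (h : SplitsAt (fun v A => EarlyMin s (v :: A)) (fun v A => EarlyMin s (v :: A)) (2 * s - 1) l) :
    ∃ i ∈ Finset.Icc s (3 * s - 2), SplitsAt StaysAbove StaysAbove i l := by
  obtain ⟨v, A, B, rfl, hA, hA1, hB1⟩ := h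
  obtain ⟨P, w, Q, hP, hPs, hw⟩ := hA1.exists_split
  obtain ⟨P', w', Q', hP', hPs', hw'⟩ := hB1.exists_split
  have lA := congrArg List.length hP
  simp at hlen lA
  -- The smaller of the two minima is the minimum of the whole sequence. It lies fewer than `s`
  -- places from the centre `2 * s - 1`, so both sides of it contain at least `s` entries.
  rcases le_total w w' with hle | hle
  · have e : A.reverse ++ v :: B = Q.reverse ++ w :: (P.reverse ++ B) := by
      have := congrArg List.reverse hP
      simp at this
      calc A.reverse ++ v :: B = (A.reverse ++ [v]) ++ B := by simp
        _ = _ := by rw [this]; simp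
    rw [e] at hl ⊢
    refine ⟨Q.length, by simp; omega, (splitsAt_iff rfl).2 ?_⟩
    rw [List.nodup_append] at hl
    obtain ⟨-, h2, h3⟩ := hl
    rw [List.nodup_cons] at h2
    refine ⟨fun y hy => lt_of_le_of_ne (hw y (by rw [hP]; simp [hy])) ?_,
      fun y hy => lt_of_le_of_ne ?_ ?_⟩
    · exact (h3 y (by simpa using hy) w (by simp)).symm
    · rw [List.mem_append, List.mem_reverse] at hy
      rcases hy with hy | hy
      · exact hw y (by rw [hP]; simp [hy])
      · exact hle.trans (hw' y (by simp [hy]))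
    · rintro rfl
      exact h2.1 hy
  · have e : A.reverse ++ v :: B = (P'.reverse ++ A).reverse ++ w' :: Q' := by
      rw [hP']; simp
    rw [e] at hl ⊢
    refine ⟨(P'.reverse ++ A).length, by simp; omega, (splitsAt_iff rfl).2 ?_⟩
    rw [List.nodup_append] at hl
    obtain ⟨-, h2, h3⟩ := hl
    rw [List.nodup_cons] at h2
    refine ⟨fun y hy => lt_of_le_of_ne ?_ ?_,
      fun y hy => lt_of_le_of_ne (hw' y (by rw [hP']; simp [hy])) ?_⟩
    · rw [List.mem_append, List.mem_reverse] at hy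
      rcases hy with hy | hy
      · exact hw' y (by rw [hP']; simp [hy])
      · exact hle.trans (hw y (by simp [hy]))
    · exact (h3 y (List.mem_reverse.2 hy) w' (by simp)).symm
    · rintro rfl
      exact h2.1 hy

lemma IsDescent.head_lt {u v c : V} {A : List V} (h : IsDescent (u :: v :: c :: A)) : u < v := by
  rw [isDescent_cons, exitsBelow_cons_cons] at h
  exact h.1

/-- Read backwards, `u` is the first entry not above the initial one, while `v` comes just before it
and is still above. So a walk with at least two steps that descends in either direction starts with
an ascent as listed. -/
lemma IsDescent.head_lt_of_reverse {u v c : V} {A : List V}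
    (h : IsDescent (u :: v :: c :: A).reverse) : u < v := by
  obtain ⟨x, M, hM⟩ := List.exists_cons_of_ne_nil (l := (c :: A).reverse) (by simp)
  have e : (u :: v :: c :: A).reverse = x :: ((M ++ [v]) ++ [u]) := by
    rw [List.reverse_cons, List.reverse_cons, hM]; simp
  rw [e, isDescent_cons, exitsBelow_append_singleton] at h
  exact h.2.trans_lt (h.1 v (by simp))

end Splits

namespace SimpleGraph

variable {V : Type*} [Fintype V] {G : SimpleGraph V} {q : ℝ}

lemma sum_ind_splitsAt (Q Q' : V → List V → Prop) (i j : ℕ) :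
    ∑ l ∈ listsOfLength V (i + j + 3), ind (G.NB l ∧ SplitsAt Q Q' (i + 1) l) =
      pairing (fun v => G.dartCount (Q v) i v) (fun v => G.dartCount (Q' v) j v) :=
  sum_ind_split _ _ _ i j fun _ _ _ hA _ => splitsAt_iff hA

lemma sum_ind_nb (hreg : ∀ v, ∑ a, ind (G.Adj v a) = q + 1) (n : ℕ) :
    ∑ l ∈ listsOfLength V (n + 2), ind (G.NB l) = Fintype.card V * (q + 1) * q ^ n := by
  have h : ∀ v, ∑ A ∈ listsOfLength V (n + 1), ind (G.NB (v :: A)) = (q + 1) * q ^ n := by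
    intro v
    have := sum_dartCount (G := G) (fun _ => True) n v
    simp only [dartCount_true hreg, and_true, ← Finset.sum_mul, hreg] at this
    exact this.symm
  rw [sum_listsOfLength_succ]
  simp only [h, Finset.sum_const, Finset.card_univ, nsmul_eq_mul]
  ring

/-- A large mean forces a large correlation. -/
lemma le_pairing_self (hq : 0 < q) {f : V → V → ℝ}
    (h0 : ∀ v a, 0 ≤ f v a) (h1 : ∀ v a, f v a ≤ ind (G.Adj v a))
    (hf : Fintype.card V * (q + 1) / 2 ≤ ∑ v, ∑ a, f v a) :
    Fintype.card V * (q + 1) * (q - 1) / 4 ≤ pairing f f := by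
  rw [pairing_eq, ← Finset.sum_sub_distrib]
  -- With S the total at `v`, the bound f ≤ 1 gives S² - Σ f² ≥ S² - S, and S² is bounded below by
  -- its tangent at the mean value S = (q + 1) / 2.
  have h2 : ∀ v, q * ∑ a, f v a - (q + 1) ^ 2 / 4 ≤
      (∑ a, f v a) * (∑ a, f v a) - ∑ a, f v a * f v a := by
    intro v
    have h3 : ∑ a, f v a * f v a ≤ ∑ a, f v a := Finset.sum_le_sum fun a _ => by
      nlinarith [h0 v a, h1 v a, ind_le_one (G.Adj v a)]
    nlinarith [sq_nonneg (∑ a, f v a - (q + 1) / 2)]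
  refine le_trans ?_ (Finset.sum_le_sum fun v _ => h2 v)
  rw [Finset.sum_sub_distrib, ← Finset.mul_sum]
  simp only [Finset.sum_const, Finset.card_univ, nsmul_eq_mul]
  nlinarith

variable [LinearOrder V]

lemma surviveProb_antitone (hq : 0 < q) (hreg : ∀ v, ∑ a, ind (G.Adj v a) = q + 1) (t v a : V)
    {i j : ℕ} (hij : i ≤ j) : G.surviveProb q t j v a ≤ G.surviveProb q t i v a := by
  have h1 := sum_exitProb_add_surviveProb hq hreg t i v a
  have h2 := sum_exitProb_add_surviveProb hq hreg t j v a
  have h3 : ∑ k ∈ Finset.range (i + 1), G.exitProb q t k v a ≤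
      ∑ k ∈ Finset.range (j + 1), G.exitProb q t k v a :=
    Finset.sum_le_sum_of_subset_of_nonneg (Finset.range_subset_range.2 (by omega))
      fun k _ _ => exitProb_nonneg hq t k v a
  linarith

/-- The survival correlation decays only linearly. -/
lemma le_surviveCorr [Nonempty V] (hq : 0 < q) (hreg : ∀ v, ∑ a, ind (G.Adj v a) = q + 1)
    {s : ℕ} (hs : 1 ≤ s) (hg : 4 * s - 1 ≤ G.girth) :
    (q - 1) / q / 4 ≤ (2 * s - 1) * G.surviveCorr q s s := by
  obtain ⟨k, rfl⟩ := Nat.exists_eq_add_of_le' hs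
  have hn : (0 : ℝ) < Fintype.card V := by exact_mod_cast Fintype.card_pos
  -- Here `s = k + 1`. A walk `v, a, …` with `2 * k` further vertices has `2 * s` vertices, whose
  -- minimum is asked to lie in the first half.
  set b : V → V → ℝ := fun v a =>
    G.dartCount (fun A => EarlyMin (k + 1) (v :: A)) (2 * k) v a / q ^ (2 * k) with hb
  have hbsum : ∑ v, ∑ a, b v a =
      (∑ l ∈ listsOfLength V (2 * k + 2), ind (G.NB l ∧ EarlyMin (k + 1) l)) / q ^ (2 * k) := by
    rw [sum_listsOfLength_succ, Finset.sum_div]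
    refine Finset.sum_congr rfl fun v _ => ?_
    rw [← sum_dartCount (fun A => EarlyMin (k + 1) (v :: A)), Finset.sum_div]
  -- Every walk or its reverse has an early minimum, and reversal permutes the walks, so at least
  -- half of them have one.
  have hmean : Fintype.card V * (q + 1) / 2 ≤ ∑ v, ∑ a, b v a := by
    rw [hbsum, le_div_iff₀ (by positivity), div_mul_eq_mul_div, ← sum_ind_nb hreg,
      div_le_iff₀ (by norm_num)]
    have h1 : ∑ l ∈ listsOfLength V (2 * k + 2), ind (G.NB l ∧ EarlyMin (k + 1) l.reverse) =
        ∑ l ∈ listsOfLength V (2 * k + 2), ind (G.NB l ∧ EarlyMin (k + 1) l) := by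
      rw [← sum_listsOfLength_reverse]
      simp [nb_reverse]
    rw [mul_two]
    conv_rhs => arg 2; rw [← h1]
    rw [← Finset.sum_add_distrib]
    refine Finset.sum_le_sum fun l hl => ?_
    rw [mem_listsOfLength] at hl
    by_cases h : G.NB l
    · rcases earlyMin_or_reverse (s := k + 1) (by omega) (l := l) (by omega) with h' | h'
      · rw [ind_of (⟨h, h'⟩ : _ ∧ _)]
        linarith [ind_le_one (G.NB l), ind_nonneg (G.NB l ∧ EarlyMin (k + 1) l.reverse)]
      · rw [ind_of (⟨h, h'⟩ : _ ∧ EarlyMin (k + 1) l.reverse)]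
        linarith [ind_le_one (G.NB l), ind_nonneg (G.NB l ∧ EarlyMin (k + 1) l)]
    · rw [ind_of_not h]
      exact add_nonneg (ind_nonneg _) (ind_nonneg _)
  have hlow := le_pairing_self hq (f := b)
    (fun v a => div_nonneg (dartCount_nonneg _ _ _ _) (by positivity))
    (fun v a => by
      rw [hb, div_le_iff₀ (by positivity)]
      exact dartCount_le hreg _ _ _ _) hmean
  have hup : pairing b b ≤
      (2 * k + 1 : ℕ) * pairing (fun v => G.surviveProb q v (k + 1) v)
        (fun v => G.surviveProb q v (k + 1) v) := by
    rw [hb, pairing_smul_left _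
      (fun v a => G.dartCount (fun A => EarlyMin (k + 1) (v :: A)) (2 * k) v a),
      pairing_smul_right _
      (fun v a => G.dartCount (fun A => EarlyMin (k + 1) (v :: A)) (2 * k) v a),
      ← sum_ind_splitsAt (fun v A => EarlyMin (k + 1) (v :: A))
        (fun v A => EarlyMin (k + 1) (v :: A)), div_div, ← pow_add]
    -- There are `2 * k + 1` possible positions of the minimum, the first being `k + 1`. At each of
    -- them both sides have at least `k + 1` steps, so truncating them to `k + 1` steps only
    -- increases the survival probabilities.
    have h1 : ∀ i ∈ Finset.range (2 * k + 1),
        (∑ l ∈ listsOfLength V (2 * k + 2 * k + 3),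
          ind (G.NB l ∧ SplitsAt StaysAbove StaysAbove (i + (k + 1)) l)) / q ^ (2 * k + 2 * k) ≤
        pairing (fun v => G.surviveProb q v (k + 1) v) (fun v => G.surviveProb q v (k + 1) v) := by
      intro i hi
      rw [Finset.mem_range] at hi
      have e : 2 * k + 2 * k = (i + k) + (3 * k - i) := by omega
      rw [e, ← add_assoc i, sum_ind_splitsAt, pow_add, ← div_div, ← pairing_smul_left,
        ← pairing_smul_right]
      refine pairing_mono (fun v a => div_nonneg (dartCount_nonneg _ _ _ _) (by positivity))
        (fun v a => div_nonneg (dartCount_nonneg _ _ _ _) (by positivity)) (fun v a => ?_)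
        (fun v a => ?_)
      · exact surviveProb_antitone hq hreg v v a (i := k + 1) (j := i + k + 1) (by omega)
      · exact surviveProb_antitone hq hreg v v a (i := k + 1) (j := 3 * k - i + 1) (by omega)
    have h2 := Finset.sum_le_sum h1
    rw [Finset.sum_const, Finset.card_range, nsmul_eq_mul, ← Finset.sum_div] at h2
    refine le_trans ?_ h2
    rw [div_le_div_iff_of_pos_right (by positivity), Finset.sum_comm]
    refine Finset.sum_le_sum fun l hl => ?_
    rw [mem_listsOfLength] at hl
    by_cases h : G.NB l ∧ SplitsAt (fun v A => EarlyMin (k + 1) (v :: A))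
        (fun v A => EarlyMin (k + 1) (v :: A)) (2 * k + 1) l
    · obtain ⟨i, hi, h3⟩ := splitsAt_staysAbove_of_earlyMin (s := k + 1)
        (h.1.nodup_of_le_girth (by omega)) (by omega) h.2
      rw [Finset.mem_Icc] at hi
      have h4 : ind (G.NB l ∧ SplitsAt StaysAbove StaysAbove ((i - (k + 1)) + (k + 1)) l) = 1 := by
        rw [Nat.sub_add_cancel hi.1]
        exact ind_of ⟨h.1, h3⟩
      calc _ ≤ (1 : ℝ) := ind_le_one _
        _ = ind (G.NB l ∧ SplitsAt StaysAbove StaysAbove ((i - (k + 1)) + (k + 1)) l) := h4.symm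
        _ ≤ _ := Finset.single_le_sum
            (f := fun j => ind (G.NB l ∧ SplitsAt StaysAbove StaysAbove (j + (k + 1)) l))
            (fun j _ => ind_nonneg _) (Finset.mem_range.2 (by omega))
    · rw [ind_of_not h]
      exact Finset.sum_nonneg fun _ _ => ind_nonneg _
  have h := hlow.trans hup
  rw [surviveCorr, mul_div_assoc', div_div, div_le_div_iff₀ (by positivity) (by positivity)]
  push_cast at h ⊢
  have e : (2 * ((k : ℝ) + 1) - 1) = 2 * k + 1 := by ring
  rw [e]
  nlinarith

/-- A walk descends in at most one direction, and if it does then its first listed step is an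
ascent. Hence descents and reversed descents together make up at most the walks starting with an
ascent, which are half of all walks. -/
lemma exitMean_le_quarter [Nonempty V] (hq : 0 < q)
    (hreg : ∀ v, ∑ a, ind (G.Adj v a) = q + 1) {l : ℕ} (hl : 2 ≤ l) (hg : l + 1 ≤ G.girth) :
    G.exitMean q l ≤ 1 / 4 := by
  obtain ⟨k, rfl⟩ := Nat.exists_eq_add_of_le' hl
  have hn : (0 : ℝ) < Fintype.card V := by exact_mod_cast Fintype.card_pos
  have h1 : 2 * G.descentCount (k + 2) ≤ ∑ v, ∑ a, ind (v < a) * (ind (G.Adj v a) * q ^ (k + 1)) := by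
    rw [two_mul]
    conv_lhs => arg 2; rw [← sum_ind_descent_reverse]
    rw [descentCount, ← Finset.sum_add_distrib, sum_listsOfLength_succ]
    refine Finset.sum_le_sum fun v _ => ?_
    rw [sum_listsOfLength_succ]
    refine Finset.sum_le_sum fun a _ => ?_
    rw [← dartCount_true hreg, dartCount, Finset.mul_sum]
    refine Finset.sum_le_sum fun A hA => ?_
    rw [mem_listsOfLength] at hA
    obtain ⟨c, B, rfl⟩ := List.exists_cons_of_length_eq_add_one hA
    by_cases hNB : G.NB (v :: a :: c :: B)
    · have hnd := hNB.nodup_of_le_girth (by simp at hA ⊢; omega)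
      by_cases hva : v < a
      · rw [ind_of hva, ind_of (⟨hNB, trivial⟩ : _ ∧ True), ind_and, ind_and, ← mul_add,
          ← ind_or_of_exclusive (fun h => h.not_reverse hnd), ← ind_and, one_mul]
        exact ind_le_one _
      · rw [ind_of_not (fun h => hva h.2.head_lt), ind_of_not (fun h => hva h.2.head_lt_of_reverse)]
        exact (add_zero (0 : ℝ)).le.trans (mul_nonneg (ind_nonneg _) (ind_nonneg _))
    · simp [ind_of_not hNB, ind_and]
  have h2 : ∑ v, ∑ a, ind (v < a) * (ind (G.Adj v a) * q ^ (k + 1)) =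
      Fintype.card V * (q + 1) / 2 * q ^ (k + 1) := by
    have h3 : ∑ v, ∑ a, ind (v < a) * ind (G.Adj v a) = ∑ v, ∑ a, G.exitProb q v 1 v a := by
      rw [Finset.sum_comm]
      refine Finset.sum_congr rfl fun a _ => Finset.sum_congr rfl fun v _ => ?_
      rw [exitProb_one, ← ind_and, ← ind_and]
      exact ind_congr ⟨fun h => ⟨h.2.symm, h.1.le⟩,
        fun h => ⟨lt_of_le_of_ne h.2 h.1.symm.ne, h.1.symm⟩⟩
    have h4 := exitMean_one hreg hq
    rw [exitMean, div_eq_iff (by positivity), ← h3] at h4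
    simp only [← mul_assoc, ← Finset.sum_mul]
    rw [h4]
    ring
  rw [exitMean_succ, div_le_iff₀ (by positivity)]
  rw [h2] at h1
  linarith

end SimpleGraph

/-! ### Pairs of descents with a common initial segment -/

section Exit

variable {V : Type*} [LinearOrder V]

lemma exitsBelow_append {t : V} {A B : List V} (hB : B ≠ []) :
    ExitsBelow t (A ++ B) ↔ StaysAbove t A ∧ ExitsBelow t B := by
  obtain ⟨M, w, h⟩ := (List.eq_nil_or_concat B).resolve_left hB
  rw [List.concat_eq_append] at h
  rw [h, ← List.append_assoc, exitsBelow_append_singleton, exitsBelow_append_singleton]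
  simp [StaysAbove, or_imp, forall_and, and_assoc]

/-- Everything strictly between the two ends is above `t`, and both ends are at most `t`. The higher
end therefore starts a descent to the other one. -/
lemma isDescent_of_exitsBelow {t w : V} {X Y : List V} (hw : t < w) (hX : ExitsBelow t X)
    (hY : ExitsBelow t Y) :
    IsDescent (X.reverse ++ w :: Y) ∨ IsDescent (X.reverse ++ w :: Y).reverse := by
  obtain ⟨A, a, rfl, hA, ha⟩ := hX
  obtain ⟨B, b, rfl, hB, hb⟩ := hY
  have e1 : (A ++ [a]).reverse ++ w :: (B ++ [b]) = a :: ((A.reverse ++ w :: B) ++ [b]) := by simp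
  have e2 : ((A ++ [a]).reverse ++ w :: (B ++ [b])).reverse =
      b :: ((B.reverse ++ w :: A) ++ [a]) := by simp
  rw [e2, e1, isDescent_cons, isDescent_cons, exitsBelow_append_singleton,
    exitsBelow_append_singleton]
  have h : ∀ m, m ∈ A ∨ m = w ∨ m ∈ B → t < m := by
    rintro m (hm | rfl | hm)
    · exact hA m hm
    · exact hw
    · exact hB m hm
  rcases le_total b a with hab | hab
  · refine Or.inl ⟨fun m hm => ha.trans_lt (h m ?_), hab⟩
    simpa using hm
  · refine Or.inr ⟨fun m hm => hb.trans_lt (h m ?_), hab⟩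
    simp only [List.mem_append, List.mem_reverse, List.mem_cons] at hm
    tauto

/-- The first entry is smaller than all others. -/
def StartsLowest (l : List V) : Prop := ∃ v M, l = v :: M ∧ StaysAbove v M

lemma startsLowest_cons {v : V} {M : List V} : StartsLowest (v :: M) ↔ StaysAbove v M := by
  constructor
  · rintro ⟨v', M', h, h'⟩
    simp only [List.cons.injEq] at h
    obtain ⟨rfl, rfl⟩ := h
    exact h'
  · intro h
    exact ⟨v, M, rfl, h⟩

end Exit

namespace SimpleGraph

variable {V : Type*} [Fintype V] {G : SimpleGraph V} {q : ℝ}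

lemma sum_ind_ne_ne (hreg : ∀ v, ∑ a, ind (G.Adj v a) = q + 1) {w b c : V}
    (hb : G.Adj w b) (hc : G.Adj w c) (hbc : b ≠ c) :
    ∑ x, ind (x ≠ b) * (ind (x ≠ c) * ind (G.Adj w x)) = q - 1 := by
  have h1 : ∀ x, ind (x ≠ b) * (ind (x ≠ c) * ind (G.Adj w x)) =
      ind (G.Adj w x) - ind (x = b) - ind (x = c) := by
    intro x
    by_cases h : x = b
    · subst h; simp [ind_of hb, ind_of_not hbc]
    · by_cases h' : x = c
      · subst h'; simp [ind_of hc, ind_of_not h]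
      · simp [ind_of_not h, ind_of_not h', ind_of h, ind_of h']
  simp only [h1, Finset.sum_sub_distrib, hreg]
  classical
  simp [ind]

lemma sum_listsOfLength_succ_append {V : Type*} [Fintype V] (n : ℕ) (f : List V → ℝ) :
    ∑ l ∈ listsOfLength V (n + 1), f l = ∑ P ∈ listsOfLength V n, ∑ b, f (P ++ [b]) := by
  rw [sum_listsOfLength_append]
  simp only [sum_listsOfLength_one]

variable [LinearOrder V]

variable (G) in
/-- The number of extensions of `P` by `h` vertices to a descending non-backtracking walk. -/
noncomputable def descentExt (h : ℕ) (P : List V) : ℝ :=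
  ∑ D ∈ listsOfLength V h, ind (G.NB (P ++ D) ∧ IsDescent (P ++ D))

variable (G) in
/-- The second moment of `descentExt` over walks of length `d`. -/
noncomputable def descentSq (d h : ℕ) : ℝ :=
  ∑ P ∈ listsOfLength V (d + 1), G.descentExt h P ^ 2

variable (G) in
/-- The number of pairs of extensions that diverge immediately. -/
noncomputable def descentCross (d h : ℕ) : ℝ :=
  ∑ P ∈ listsOfLength V (d + 1), ∑ b, ∑ b', ind (b ≠ b') *
    (G.descentExt h (P ++ [b]) * G.descentExt h (P ++ [b']))

lemma descentExt_nonneg (h : ℕ) (P : List V) : 0 ≤ G.descentExt h P :=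
  Finset.sum_nonneg fun _ _ => ind_nonneg _

lemma descentExt_zero (P : List V) : G.descentExt 0 P = ind (G.NB P ∧ IsDescent P) := by
  simp [descentExt, sum_listsOfLength_zero]

lemma descentExt_succ (h : ℕ) (P : List V) :
    G.descentExt (h + 1) P = ∑ b, G.descentExt h (P ++ [b]) := by
  simp [descentExt, sum_listsOfLength_succ]

lemma sum_descentExt (d h : ℕ) :
    ∑ P ∈ listsOfLength V (d + 1), G.descentExt h P = G.descentCount (d + h) := by
  rw [descentCount, show d + h + 1 = d + 1 + h by ring, sum_listsOfLength_append _ h]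
  rfl

lemma descentSq_zero (d : ℕ) : G.descentSq d 0 = G.descentCount d := by
  rw [descentSq, descentCount]
  refine Finset.sum_congr rfl fun P _ => ?_
  rw [descentExt_zero, pow_two, ind_mul_self]

/-- Two extensions of the same walk either differ in their next vertex or share it and become
extensions of a longer walk. -/
lemma descentSq_succ (d h : ℕ) :
    G.descentSq d (h + 1) = G.descentCross d h + G.descentSq (d + 1) h := by
  rw [descentSq, descentCross, descentSq, sum_listsOfLength_succ_append (d + 1),
    ← Finset.sum_add_distrib]
  refine Finset.sum_congr rfl fun P _ => ?_
  rw [descentExt_succ, pow_two, Finset.sum_mul_sum, ← Finset.sum_add_distrib]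
  refine Finset.sum_congr rfl fun b _ => ?_
  classical
  have h1 : ∀ b', G.descentExt h (P ++ [b]) * G.descentExt h (P ++ [b']) =
      ind (b ≠ b') * (G.descentExt h (P ++ [b]) * G.descentExt h (P ++ [b'])) +
      if b = b' then G.descentExt h (P ++ [b]) ^ 2 else 0 := by
    intro b'
    by_cases hb : b = b'
    · subst hb; simp [pow_two]
    · simp [hb]
  rw [Finset.sum_congr rfl fun b' _ => h1 b', Finset.sum_add_distrib]
  simp

/-- Bounding the crossing pairs by ignoring the second exit. -/
lemma descentCross_le_descentCount (hreg : ∀ v, ∑ a, ind (G.Adj v a) = q + 1)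
    (d h : ℕ) :
    G.descentCross (d + 1) h ≤ (q - 1) * q ^ h * G.descentCount (d + h + 2) := by
  rw [show d + h + 2 = d + 1 + 1 + h by ring, ← sum_descentExt,
    sum_listsOfLength_succ_append (d + 2), Finset.mul_sum, descentCross]
  refine Finset.sum_le_sum fun P hP => ?_
  rw [Finset.mul_sum]
  refine Finset.sum_le_sum fun b _ => ?_
  rw [mem_listsOfLength] at hP
  obtain ⟨w, c, P, hP'⟩ : ∃ w c P', P = P' ++ [c, w] := by
    obtain ⟨P1, w, h1⟩ := (List.eq_nil_or_concat P).resolve_left (by rintro rfl; simp at hP)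
    obtain ⟨P2, c, h2⟩ := (List.eq_nil_or_concat P1).resolve_left (by rintro rfl; simp [h1] at hP)
    exact ⟨w, c, P2, by simp [h1, h2]⟩
  subst hP'
  by_cases hNB : G.NB ((P ++ [c, w]) ++ [b])
  · have h1 : ∀ b', G.descentExt h ((P ++ [c, w]) ++ [b']) ≤
        ind (b' ≠ c) * ind (G.Adj w b') * q ^ h := by
      intro b'
      rw [mul_assoc, ← dartCount_true hreg, dartCount, Finset.mul_sum]
      refine Finset.sum_le_sum fun D _ => ?_
      rw [← ind_and]
      refine ind_mono fun hD => ?_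
      have h2 : G.NB (c :: w :: b' :: D) :=
        NB.of_append_right (l := P) (by simpa using hD.1)
      rw [nb_cons_cons_cons] at h2
      exact ⟨h2.2.1, h2.2.2, trivial⟩
    have h3 : G.NB (c :: w :: [b]) := NB.of_append_right (l := P) (by simpa using hNB)
    rw [nb_cons_cons_cons, nb_pair] at h3
    have h4 := sum_ind_ne_ne hreg h3.2.2 h3.1.symm h3.2.1
    calc _ ≤ ∑ b', G.descentExt h ((P ++ [c, w]) ++ [b]) *
          ((ind (b' ≠ b) * (ind (b' ≠ c) * ind (G.Adj w b'))) * q ^ h) := by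
          refine Finset.sum_le_sum fun b' _ => ?_
          rw [ind_congr (ne_comm (a := b) (b := b'))]
          have h5 := mul_le_mul_of_nonneg_left (h1 b')
            (mul_nonneg (ind_nonneg (b' ≠ b)) (descentExt_nonneg (G := G) h ((P ++ [c, w]) ++ [b])))
          nlinarith
      _ = _ := by rw [← Finset.mul_sum, ← Finset.sum_mul, h4]; ring
  · have h1 : G.descentExt h ((P ++ [c, w]) ++ [b]) = 0 :=
      Finset.sum_eq_zero fun D _ => ind_of_not fun hD => hNB hD.1.of_append_left
    simp only [h1, zero_mul, mul_zero, Finset.sum_const_zero, le_refl]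

lemma descentCross_eq (d h : ℕ) :
    G.descentCross d h = ∑ w, ∑ X ∈ listsOfLength V (h + 1), ∑ Y ∈ listsOfLength V (h + 1),
      ∑ C ∈ listsOfLength V d, ind (X.head? ≠ Y.head?) *
        (ind (G.NB (C.reverse ++ w :: X) ∧ IsDescent (C.reverse ++ w :: X)) *
          ind (G.NB (C.reverse ++ w :: Y) ∧ IsDescent (C.reverse ++ w :: Y))) := by
  rw [descentCross, ← sum_listsOfLength_reverse, sum_listsOfLength_succ]
  refine Finset.sum_congr rfl fun w _ => ?_
  have h1 : ∀ C : List V, ∑ b, ∑ b', ind (b ≠ b') *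
      (G.descentExt h ((w :: C).reverse ++ [b]) * G.descentExt h ((w :: C).reverse ++ [b'])) =
      ∑ X ∈ listsOfLength V (h + 1), ∑ Y ∈ listsOfLength V (h + 1), ind (X.head? ≠ Y.head?) *
        (ind (G.NB (C.reverse ++ w :: X) ∧ IsDescent (C.reverse ++ w :: X)) *
          ind (G.NB (C.reverse ++ w :: Y) ∧ IsDescent (C.reverse ++ w :: Y))) := by
    intro C
    rw [sum_listsOfLength_succ]
    refine Finset.sum_congr rfl fun b _ => ?_
    simp only [sum_listsOfLength_succ]
    rw [Finset.sum_comm (t := (Finset.univ : Finset V))]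
    refine Finset.sum_congr rfl fun b' _ => ?_
    rw [descentExt, descentExt, Finset.sum_mul_sum, Finset.mul_sum]
    refine Finset.sum_congr rfl fun D _ => ?_
    rw [Finset.mul_sum]
    refine Finset.sum_congr rfl fun D' _ => ?_
    simp
  simp only [h1]
  rw [Finset.sum_comm]
  refine Finset.sum_congr rfl fun X _ => ?_
  rw [Finset.sum_comm]

/-- Bounding the crossing pairs by forgetting the common initial segment. -/
lemma descentCross_le_short (hq : 0 < q) (hq1 : 1 ≤ q)
    (hreg : ∀ v, ∑ a, ind (G.Adj v a) = q + 1) (d h : ℕ) :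
    G.descentCross (d + 1) h ≤ (q - 1) * q ^ d * (2 * G.descentCount (2 * h + 2)) := by
  rw [descentCross_eq]
  have e : 2 * G.descentCount (2 * h + 2) = ∑ l ∈ listsOfLength V ((h + 1) + 1 + (h + 1)),
      (ind (G.NB l ∧ IsDescent l) + ind (G.NB l ∧ IsDescent l.reverse)) := by
    rw [show (h + 1) + 1 + (h + 1) = 2 * h + 2 + 1 by ring, Finset.sum_add_distrib,
      sum_ind_descent_reverse, descentCount, two_mul]
  rw [e, sum_listsOfLength_split, Finset.mul_sum]
  refine Finset.sum_le_sum fun w _ => ?_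
  rw [Finset.mul_sum]
  refine Finset.sum_le_sum fun X hX => ?_
  rw [Finset.mul_sum]
  refine Finset.sum_le_sum fun Y hY => ?_
  rw [mem_listsOfLength] at hX hY
  obtain ⟨b, D, rfl⟩ := List.exists_cons_of_length_eq_add_one hX
  obtain ⟨b', D', rfl⟩ := List.exists_cons_of_length_eq_add_one hY
  set l := (b :: D).reverse ++ w :: b' :: D' with hl
  -- For fixed tails, the joined walk `l` must be a descent in one direction, and the common segment
  -- `C` only has to be non-backtracking and avoid both first tail vertices.
  have hpt : ∀ C ∈ listsOfLength V (d + 1), ind ((b :: D).head? ≠ (b' :: D').head?) *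
        (ind (G.NB (C.reverse ++ w :: b :: D) ∧ IsDescent (C.reverse ++ w :: b :: D)) *
          ind (G.NB (C.reverse ++ w :: b' :: D') ∧ IsDescent (C.reverse ++ w :: b' :: D'))) ≤
      ind ((G.NB l ∧ (IsDescent l ∨ IsDescent l.reverse)) ∧
        (G.NB (w :: C) ∧ ∀ c ∈ C.head?, c ≠ b ∧ c ≠ b')) := by
    intro C hC
    rw [mem_listsOfLength] at hC
    rw [← ind_and, ← ind_and]
    refine ind_mono ?_
    rintro ⟨h1, ⟨h2, h3⟩, h4, h5⟩
    rw [nb_glue] at h2 h4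
    have h1' : b ≠ b' := by simpa using h1
    refine ⟨⟨nb_glue.2 ⟨h2.2.1, h4.2.1, by simpa using h1'⟩, ?_⟩, h2.1, fun c hc =>
      ⟨h2.2.2 c hc b rfl, h4.2.2 c hc b' rfl⟩⟩
    -- As `C` is nonempty, the branching vertex `w` is an inner vertex of the descents and lies
    -- above their start `v`. This start is the level to which both tails fall.
    obtain ⟨v, M, hM⟩ := List.exists_cons_of_ne_nil (l := C.reverse)
      (by rw [Ne, List.reverse_eq_nil_iff]; rintro rfl; simp at hC)
    rw [hM, List.cons_append, isDescent_cons, exitsBelow_append (by simp),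
      exitsBelow_cons_cons] at h3 h5
    exact isDescent_of_exitsBelow h3.2.1 h3.2.2 h5.2.2
  refine (Finset.sum_le_sum hpt).trans ?_
  by_cases h : G.NB l ∧ (IsDescent l ∨ IsDescent l.reverse)
  · have h1 : (1 : ℝ) ≤ ind (G.NB l ∧ IsDescent l) + ind (G.NB l ∧ IsDescent l.reverse) := by
      rcases h with ⟨h1, h2 | h2⟩
      · rw [ind_of (⟨h1, h2⟩ : _ ∧ IsDescent l)]; linarith [ind_nonneg (G.NB l ∧ IsDescent l.reverse)]
      · rw [ind_of (⟨h1, h2⟩ : _ ∧ IsDescent l.reverse)]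
        linarith [ind_nonneg (G.NB l ∧ IsDescent l)]
    -- The segment, read from `w`, has q - 1 choices for its first vertex, since `b` and `b'` are
    -- excluded, and q choices at each later step.
    have h2 : ∑ C ∈ listsOfLength V (d + 1),
        ind ((G.NB l ∧ (IsDescent l ∨ IsDescent l.reverse)) ∧
          (G.NB (w :: C) ∧ ∀ c ∈ C.head?, c ≠ b ∧ c ≠ b')) = (q - 1) * q ^ d := by
      have h3 := nb_glue.1 h.1
      have hb : G.Adj w b := h3.1.1
      have hb' : G.Adj w b' := h3.2.1.1
      have hbb' : b ≠ b' := by simpa using h3.2.2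
      rw [← sum_ind_ne_ne hreg hb hb' hbb', sum_listsOfLength_succ, Finset.sum_mul]
      refine Finset.sum_congr rfl fun c _ => ?_
      rw [mul_assoc, mul_assoc, ← dartCount_true hreg, dartCount, Finset.mul_sum, Finset.mul_sum]
      refine Finset.sum_congr rfl fun C _ => ?_
      rw [ind_and, ind_of h, one_mul, ← ind_and, ← ind_and]
      refine ind_congr ?_
      simp only [List.head?_cons, Option.mem_some_iff, forall_eq', and_true]
      tauto
    rw [h2]
    nlinarith [mul_nonneg (sub_nonneg.2 hq1) (pow_nonneg hq.le d)]
  · rw [Finset.sum_eq_zero fun C _ => ind_of_not fun h' => h h'.1]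
    exact mul_nonneg (mul_nonneg (by linarith) (by positivity))
      (add_nonneg (ind_nonneg _) (ind_nonneg _))

/-! ### Second moments of the exit probabilities -/

variable (G) in
/-- The normalised second moment of the exit probability at step `d + h`, conditioned on the first
`d` steps. -/
noncomputable def exitEnergy (q : ℝ) (d h : ℕ) : ℝ :=
  G.descentSq d h / (Fintype.card V * (q + 1) * q ^ (d - 1 + 2 * h))

variable (G) in
/-- The mean probability to survive `i` steps. -/
noncomputable def surviveMean (q : ℝ) (i : ℕ) : ℝ :=
  (∑ v, ∑ a, G.surviveProb q v i v a) / (Fintype.card V * (q + 1))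

variable (G) in
/-- The normalised second moment of the exit probabilities per vertex. -/
noncomputable def exitVertexSq (q : ℝ) (i : ℕ) : ℝ :=
  (∑ v, (∑ a, G.exitProb q v i v a) ^ 2) / (Fintype.card V * (q + 1) * q)

lemma exitEnergy_zero (d : ℕ) : G.exitEnergy q (d + 1) 0 = G.exitMean q (d + 1) := by
  rw [exitEnergy, exitMean_succ, descentSq_zero]
  simp

/-- Two descents that share `d + 1` steps may separate at once. The minimum comes from the two
estimates for this case: forget the common segment, or forget that the second descent exits. If they
share one step more, a factor 1/q is gained. -/
lemma exitEnergy_succ_le [Nonempty V] (hq : 1 ≤ q) (hreg : ∀ v, ∑ a, ind (G.Adj v a) = q + 1)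
    (d h : ℕ) :
    G.exitEnergy q (d + 1) (h + 1) ≤
      (q - 1) / q * min (2 * G.exitMean q (2 * h + 2)) (G.exitMean q (d + h + 2)) +
        G.exitEnergy q (d + 2) h / q := by
  have hq0 : 0 < q := by linarith
  have hn : (0 : ℝ) < Fintype.card V := by exact_mod_cast Fintype.card_pos
  have h1 : G.descentCross (d + 1) h / (Fintype.card V * (q + 1) * q ^ (d + 2 * (h + 1))) ≤
      (q - 1) / q * min (2 * G.exitMean q (2 * h + 2)) (G.exitMean q (d + h + 2)) := by
    rcases le_total (2 * G.exitMean q (2 * h + 2)) (G.exitMean q (d + h + 2)) with hle | hle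
    · rw [min_eq_left hle, exitMean_succ, div_le_iff₀ (by positivity)]
      refine (descentCross_le_short hq0 hq hreg d h).trans (le_of_eq ?_)
      field_simp
      ring
    · rw [min_eq_right hle, exitMean_succ, div_le_iff₀ (by positivity)]
      refine (descentCross_le_descentCount hreg d h).trans (le_of_eq ?_)
      field_simp
      ring
  have h2 : G.descentSq (d + 2) h / (Fintype.card V * (q + 1) * q ^ (d + 2 * (h + 1))) =
      G.exitEnergy q (d + 2) h / q := by
    rw [exitEnergy, div_div, show d + 2 - 1 + 2 * h = d + 2 * h + 1 by omega]
    ring_nf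
  rw [exitEnergy, descentSq_succ, add_div, show d + 1 - 1 = d by omega, h2]
  linarith

lemma surviveMean_eq [Nonempty V] (hq : 0 < q) (hreg : ∀ v, ∑ a, ind (G.Adj v a) = q + 1)
    (s : ℕ) : G.surviveMean q s = 1 - ∑ i ∈ Finset.range (s + 1), G.exitMean q i := by
  have hn : (0 : ℝ) < Fintype.card V := by exact_mod_cast Fintype.card_pos
  have h1 : ∑ v, ∑ a, (∑ i ∈ Finset.range (s + 1), G.exitProb q v i v a + G.surviveProb q v s v a) =
      Fintype.card V * (q + 1) := by
    rw [← sum_sum_adj hreg]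
    exact Finset.sum_congr rfl fun v _ => Finset.sum_congr rfl fun a _ =>
      sum_exitProb_add_surviveProb hq hreg v s v a
  simp only [Finset.sum_add_distrib] at h1
  have h2 : ∑ v, ∑ a, ∑ i ∈ Finset.range (s + 1), G.exitProb q v i v a =
      ∑ i ∈ Finset.range (s + 1), ∑ v, ∑ a, G.exitProb q v i v a := by
    rw [Finset.sum_comm (s := Finset.range (s + 1))]
    exact Finset.sum_congr rfl fun v _ => Finset.sum_comm
  rw [surviveMean]
  simp only [exitMean, ← Finset.sum_div]
  rw [← h2]
  field_simp
  linarith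

/-- A proper initial segment of a descent never falls to its start, so only such segments have
extensions. Restricting to them is what brings the survival probability into the Cauchy-Schwarz
estimate. -/
lemma descentExt_eq_ind_mul {h : ℕ} (hh : 1 ≤ h) {P : List V} (hP : P ≠ []) :
    ind (G.NB P ∧ StartsLowest P) * G.descentExt h P = G.descentExt h P := by
  rw [descentExt, Finset.mul_sum]
  refine Finset.sum_congr rfl fun D hD => ?_
  rw [mem_listsOfLength] at hD
  rw [← ind_and]
  refine ind_congr ⟨fun h => h.2, fun h => ⟨⟨h.1.of_append_left, ?_⟩, h⟩⟩
  obtain ⟨v, M, rfl⟩ := List.exists_cons_of_ne_nil hP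
  have h2 := h.2
  rw [List.cons_append, isDescent_cons, exitsBelow_append (by rintro rfl; simp at hD; omega)] at h2
  exact startsLowest_cons.2 h2.1

lemma sum_startsLowest (hq : 0 < q) (d : ℕ) :
    ∑ P ∈ listsOfLength V (d + 2), ind (G.NB P ∧ StartsLowest P) =
      (∑ v, ∑ a, G.surviveProb q v (d + 1) v a) * q ^ d := by
  rw [sum_listsOfLength_succ, Finset.sum_mul]
  refine Finset.sum_congr rfl fun v _ => ?_
  simp only [startsLowest_cons]
  rw [← sum_dartCount, Finset.sum_mul]
  refine Finset.sum_congr rfl fun a _ => ?_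
  rw [surviveProb, div_mul_cancel₀]
  positivity

/-- Cauchy-Schwarz over the initial segments with `d + 1` steps that stay above their start. -/
lemma exitMean_sq_le [Nonempty V] (hq : 0 < q) (d h : ℕ) :
    G.exitMean q (d + h + 2) ^ 2 ≤ G.surviveMean q (d + 1) * G.exitEnergy q (d + 1) (h + 1) := by
  have hn : (0 : ℝ) < Fintype.card V := by exact_mod_cast Fintype.card_pos
  have h1 := Finset.sum_mul_sq_le_sq_mul_sq (listsOfLength V (d + 2))
    (fun P => ind (G.NB P ∧ StartsLowest P)) (fun P => G.descentExt (h + 1) P)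
  have h2 : ∑ P ∈ listsOfLength V (d + 2), ind (G.NB P ∧ StartsLowest P) * G.descentExt (h + 1) P
      = G.descentCount (d + h + 2) := by
    rw [show d + h + 2 = (d + 1) + (h + 1) by ring, ← sum_descentExt]
    refine Finset.sum_congr rfl fun P hP => descentExt_eq_ind_mul (by omega) ?_
    rintro rfl
    simp at hP
  simp only [h2, pow_two (ind _), ind_mul_self] at h1
  rw [sum_startsLowest hq] at h1
  rw [exitMean_succ, surviveMean, exitEnergy, div_mul_div_comm, div_pow,
    div_le_div_iff₀ (by positivity) (by positivity)]
  have h3 : G.descentSq (d + 1) (h + 1) =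
    ∑ P ∈ listsOfLength V (d + 2), G.descentExt (h + 1) P ^ 2 := rfl
  rw [h3]
  have e : (↑(Fintype.card V) * (q + 1) * q ^ (d + h + 1)) ^ 2 =
      (↑(Fintype.card V) * (q + 1)) ^ 2 * q ^ (d + 2 * (h + 1)) * q ^ d := by ring
  rw [e, show d + 1 - 1 = d by omega]
  calc _ = G.descentCount (d + h + 2) ^ 2 *
        ((↑(Fintype.card V) * (q + 1)) ^ 2 * q ^ (d + 2 * (h + 1))) := by ring
    _ ≤ _ := mul_le_mul_of_nonneg_right h1 (by positivity)
    _ = _ := by ring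

lemma sum_exitProb_eq (i : ℕ) (v : V) : (∑ a, G.exitProb q v (i + 1) v a) =
    (∑ A ∈ listsOfLength V (i + 1), ind (G.NB (v :: A) ∧ IsDescent (v :: A))) / q ^ i := by
  simp only [isDescent_cons]
  rw [← sum_dartCount, Finset.sum_div]
  rfl

/-- Cauchy-Schwarz at each vertex over its (q + 1) q ^ d initial segments with `d + 1` steps. The
parameter `d` can be chosen freely for a given total number of steps. -/
lemma exitVertexSq_le [Nonempty V] (hq : 0 < q) (hreg : ∀ v, ∑ a, ind (G.Adj v a) = q + 1)
    (d h : ℕ) :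
    G.exitVertexSq q (d + h + 1) ≤ (q + 1) / q * G.exitEnergy q (d + 1) h := by
  have hn : (0 : ℝ) < Fintype.card V := by exact_mod_cast Fintype.card_pos
  have h1 : ∀ v : V, (∑ a, G.exitProb q v (d + h + 1) v a) ^ 2 ≤
      (q + 1) * q ^ d * (∑ P ∈ listsOfLength V (d + 1), G.descentExt h (v :: P) ^ 2)
        / (q ^ (d + h)) ^ 2 := by
    intro v
    rw [sum_exitProb_eq, div_pow, div_le_div_iff_of_pos_right (by positivity),
      show d + h + 1 = d + 1 + h by ring, sum_listsOfLength_append]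
    have h2 := Finset.sum_mul_sq_le_sq_mul_sq (listsOfLength V (d + 1))
      (fun P => ind (G.NB (v :: P))) (fun P => G.descentExt h (v :: P))
    have h3 : ∀ P, ind (G.NB (v :: P)) * G.descentExt h (v :: P) = G.descentExt h (v :: P) := by
      intro P
      rw [descentExt, Finset.mul_sum]
      refine Finset.sum_congr rfl fun D hD => ?_
      rw [← ind_and]
      exact ind_congr ⟨fun h => h.2, fun h => ⟨h.1.of_append_left, h⟩⟩
    have h4 : ∑ P ∈ listsOfLength V (d + 1), ind (G.NB (v :: P)) = (q + 1) * q ^ d := by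
      have := sum_dartCount (G := G) (fun _ => True) d v
      simp only [dartCount_true hreg, and_true, ← Finset.sum_mul, hreg] at this
      exact this.symm
    simp only [h3, pow_two (ind _), ind_mul_self, h4] at h2
    exact h2
  have h5 := Finset.sum_le_sum fun v (_ : v ∈ Finset.univ) => h1 v
  rw [← Finset.sum_div, ← Finset.mul_sum] at h5
  have h6 : ∑ v : V, ∑ P ∈ listsOfLength V (d + 1), G.descentExt h (v :: P) ^ 2 =
      G.descentSq (d + 1) h := by rw [descentSq, sum_listsOfLength_succ]
  rw [h6] at h5
  rw [exitVertexSq, exitEnergy, div_le_iff₀ (by positivity)]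
  refine h5.trans (le_of_eq ?_)
  rw [show d + 1 - 1 = d by omega]
  field_simp
  ring

/-- In `pairing_eq` the subtracted diagonal consists of pairs of descents sharing their first step,
which is what `exitEnergy` with `d = 1` counts. -/
lemma exitCorr_self_eq [Nonempty V] (hq : 0 < q) (h : ℕ) :
    G.exitVertexSq q (h + 1) = G.exitCorr q (h + 1) (h + 1) + G.exitEnergy q 1 h / q := by
  have hn : (0 : ℝ) < Fintype.card V := by exact_mod_cast Fintype.card_pos
  have h1 : ∑ v, ∑ a, G.exitProb q v (h + 1) v a * G.exitProb q v (h + 1) v a =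
      G.descentSq 1 h / q ^ (2 * h) := by
    rw [descentSq, sum_listsOfLength_succ, Finset.sum_div]
    refine Finset.sum_congr rfl fun v _ => ?_
    rw [sum_listsOfLength_one, Finset.sum_div]
    refine Finset.sum_congr rfl fun a _ => ?_
    have : G.exitProb q v (h + 1) v a = G.descentExt h [v, a] / q ^ h := by
      rw [exitProb, dartCount, descentExt]
      simp [isDescent_cons]
    rw [this]
    field_simp
    ring
  rw [exitVertexSq, exitCorr, pairing_eq, h1, exitEnergy]
  simp only [← pow_two]
  field_simp
  simp
  ring

/-- The nonnegative diagonal is dropped, and the products of vertex totals are split by the weighted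
inequality between arithmetic and geometric means. -/
lemma exitCorr_le_vertexSq [Nonempty V] (hq : 0 < q) {c : ℝ} (hc : 0 < c) (i j : ℕ) :
    2 * G.exitCorr q i j ≤ c * G.exitVertexSq q i + G.exitVertexSq q j / c := by
  have hn : (0 : ℝ) < Fintype.card V := by exact_mod_cast Fintype.card_pos
  have h0 : 0 ≤ ∑ v, ∑ a, G.exitProb q v i v a * G.exitProb q v j v a :=
    Finset.sum_nonneg fun v _ => Finset.sum_nonneg fun a _ =>
      mul_nonneg (exitProb_nonneg hq _ _ _ _) (exitProb_nonneg hq _ _ _ _)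
  have h1 : 2 * ∑ v, (∑ a, G.exitProb q v i v a) * (∑ b, G.exitProb q v j v b) ≤
      c * ∑ v, (∑ a, G.exitProb q v i v a) ^ 2 + (∑ v, (∑ a, G.exitProb q v j v a) ^ 2) / c := by
    rw [Finset.mul_sum, Finset.mul_sum, Finset.sum_div, ← Finset.sum_add_distrib]
    refine Finset.sum_le_sum fun v _ => ?_
    set x := ∑ a, G.exitProb q v i v a
    set y := ∑ a, G.exitProb q v j v a
    have h2 : 0 ≤ (c * x - y) ^ 2 / c := by positivity
    have h3 : (c * x - y) ^ 2 / c = c * x ^ 2 + y ^ 2 / c - 2 * (x * y) := by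
      field_simp
      ring
    linarith
  rw [exitCorr, exitVertexSq, exitVertexSq, pairing_eq, mul_div_assoc', mul_div_assoc',
    div_right_comm, ← add_div, div_le_div_iff_of_pos_right (by positivity)]
  linarith

end SimpleGraph

/-! ### Numerical estimates -/

/-- Control of a root of `p ^ 2 ≤ M * (c + p * u)`. -/
lemma le_of_sq_le_mul_add {p M c u M' c' u' e : ℝ} (hp : 0 ≤ p) (hM : M ≤ M')
    (hc0 : 0 ≤ c) (hc : c ≤ c') (hu0 : 0 ≤ u) (hu : u ≤ u') (hM' : 0 ≤ M') (he : M' * u' < e)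
    (he' : M' * (c' + e * u') ≤ e ^ 2) (h : p ^ 2 ≤ M * (c + p * u)) : p ≤ e := by
  by_contra hlt
  push Not at hlt
  have h1 : M * (c + p * u) ≤ M' * (c' + p * u') := by
    have h2 : p * u ≤ p * u' := mul_le_mul_of_nonneg_left hu hp
    have h3 : 0 ≤ c + p * u := by positivity
    exact mul_le_mul hM (by linarith) h3 hM'
  have h5 : 0 ≤ M' * u' := mul_nonneg hM' (hu0.trans hu)
  nlinarith [mul_pos (sub_pos.2 hlt) (sub_pos.2 he), mul_pos (sub_pos.2 hlt) (h5.trans_lt he)]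

section Eight

/-- The inequalities among the exit statistics used in the case of eight steps. -/
structure EightStepData (n : ℕ) (t p4 p5 p6 p7 p8 X3 X4 X5 X6 : ℝ) : Prop where
  t_eq : t = ((1 - 1 / (n : ℝ)) / 4) ^ 7
  p4_nonneg : 0 ≤ p4
  p5_nonneg : 0 ≤ p5
  p6_nonneg : 0 ≤ p6
  p7_nonneg : 0 ≤ p7
  p4_le : p4 ≤ 1 / 4
  p5_le : p5 ≤ 1 / 4
  p4_le' : 2 * p4 ≤ t * n ^ 4
  p5_le' : 2 * p5 ≤ t * n ^ 3
  p6_le' : 2 * p6 ≤ t * n ^ 2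
  p7_le' : 2 * p7 ≤ t * n
  p8_le' : 2 * p8 ≤ t
  p5_sq : p5 ^ 2 ≤ 1 / 2 * ((1 - 1 / (n : ℝ)) * t + p5 * (1 / n))
  p6_sq : p6 ^ 2 ≤ (1 / 2 - (1 - 1 / (n : ℝ)) / 8) * ((1 - 1 / (n : ℝ)) * t + p6 * (1 / n))
  p7_sq : p7 ^ 2 ≤ (1 / 2 - (1 - 1 / (n : ℝ)) / 8) * ((1 - 1 / (n : ℝ)) * t + p7 * (1 / n))
  X3_le : X3 ≤ 2 * p6 + 1 / n / 4
  X4_le : X4 ≤ t + p4 * (1 / n)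
  X4_le' : X4 ≤ t + (1 - 1 / (n : ℝ)) * t * n + p4 * (1 / n) ^ 2
  X5_le : X5 ≤ (1 + 1 / (n : ℝ)) * ((1 - 1 / (n : ℝ)) * t + p5 * (1 / n))
  X5_le' : X5 ≤ (1 + 1 / (n : ℝ)) * ((1 - 1 / (n : ℝ)) * t * (1 + n) + p5 * (1 / n) ^ 2)
  X6_le : X6 ≤ (1 + 1 / (n : ℝ)) * ((1 - 1 / (n : ℝ)) * t + p6 * (1 / n))
  total : (1 - 1 / (n : ℝ)) / 4 ≤
    11 * (2 * p7 + 2 * p8 + X3 / 8 + 2 * X4 + 3 * X5 + 11 * X6)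

variable {n : ℕ} {t p4 p5 p6 p7 p8 X3 X4 X5 X6 : ℝ}

/-- Once the degree is a fixed number, so is `t`, and the linear inequalities of the system
contradict each other without the quadratic ones. -/
lemma EightStepData.false_of_le (h : EightStepData n t p4 p5 p6 p7 p8 X3 X4 X5 X6)
    (h6 : 6 ≤ n) (h25 : n ≤ 25) : False := by
  obtain ⟨h0, h1, h2, h3, h4, h5, h6, h7, h8, h9, h10, h11, -, -, -, h15, -, h17, -, h19, h20,
    h21⟩ := h
  subst h0
  interval_cases n <;> norm_num at * <;> linarith

/-- Large degrees, handled on a range `a ≤ n` with numerical bounds. -/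
lemma EightStepData.false_of_bounds (h : EightStepData n t p4 p5 p6 p7 p8 X3 X4 X5 X6)
    {a τ e5 e6 x7 x4 : ℝ} (ha : 4 ≤ a) (han : a ≤ n) (hτ : t ≤ τ)
    (he5 : 1 / 2 * (1 / a) < e5) (he5' : 1 / 2 * (τ + e5 * (1 / a)) ≤ e5 ^ 2)
    (he6 : (1 / 2 - (1 - 1 / a) / 8) * (1 / a) < e6)
    (he6' : (1 / 2 - (1 - 1 / a) / 8) * (τ + e6 * (1 / a)) ≤ e6 ^ 2)
    (h7 : p7 ≤ e6 → p7 ≤ x7)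
    (h4 : X4 ≤ x4)
    (htot : 11 * (2 * x7 + τ + (2 * e6 + 1 / a / 4) / 8 + 2 * x4 +
      3 * ((1 + 1 / a) * (τ + e5 * (1 / a))) + 11 * ((1 + 1 / a) * (τ + e6 * (1 / a)))) <
      (1 - 1 / a) / 4) : False := by
  have hn : (0 : ℝ) < n := by linarith
  have hu : 1 / (n : ℝ) ≤ 1 / a := one_div_le_one_div_of_le (by linarith) han
  have hu0 : 0 < 1 / (n : ℝ) := by positivity
  have ha0 : 0 < 1 / a := by positivity
  have ha1 : 1 / a ≤ 1 / 4 := one_div_le_one_div_of_le (by norm_num) ha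
  have ht0 : 0 ≤ t := by
    rw [h.t_eq]
    exact pow_nonneg (by linarith) 7
  obtain ⟨-, -, p50, p60, p70, -, -, -, -, -, -, p8t, p5s, p6s, p7s, X3l, -, -, X5l, -, X6l,
    tot⟩ := h
  generalize 1 / (n : ℝ) = u at *
  generalize 1 / a = w at *
  have hβ0 : 0 ≤ (1 - u) * t := mul_nonneg (by linarith) ht0
  have hβ1 : (1 - u) * t ≤ τ := by nlinarith
  have h5 : p5 ≤ e5 := le_of_sq_le_mul_add p50 le_rfl hβ0 hβ1 hu0.le hu (by norm_num) he5 he5' p5s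
  have h6 : p6 ≤ e6 := le_of_sq_le_mul_add p60 (by linarith) hβ0 hβ1 hu0.le hu (by linarith)
    he6 he6' p6s
  have h7' := h7 (le_of_sq_le_mul_add p70 (by linarith) hβ0 hβ1 hu0.le hu (by linarith)
    he6 he6' p7s)
  have m5 : p5 * u ≤ e5 * w := mul_le_mul h5 hu hu0.le (p50.trans h5)
  have m6 : p6 * u ≤ e6 * w := mul_le_mul h6 hu hu0.le (p60.trans h6)
  have k5 : (1 + u) * ((1 - u) * t + p5 * u) ≤ (1 + w) * (τ + e5 * w) :=
    mul_le_mul (by linarith) (by linarith) (add_nonneg hβ0 (mul_nonneg p50 hu0.le)) (by linarith)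
  have k6 : (1 + u) * ((1 - u) * t + p6 * u) ≤ (1 + w) * (τ + e6 * w) :=
    mul_le_mul (by linarith) (by linarith) (add_nonneg hβ0 (mul_nonneg p60 hu0.le)) (by linarith)
  linarith

lemma EightStepData.t_le (h : EightStepData n t p4 p5 p6 p7 p8 X3 X4 X5 X6) (hn : 1 ≤ n) {b : ℝ}
    (hb : n ≤ b) : t ≤ ((1 - 1 / b) / 4) ^ 7 := by
  have hn' : (1 : ℝ) ≤ n := by exact_mod_cast hn
  have h1 : 1 / b ≤ 1 / (n : ℝ) := one_div_le_one_div_of_le (by linarith) hb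
  have h2 : 1 / (n : ℝ) ≤ 1 := by rw [div_le_one (by linarith)]; exact hn'
  rw [h.t_eq]
  gcongr

lemma EightStepData.t_le_quarter (h : EightStepData n t p4 p5 p6 p7 p8 X3 X4 X5 X6)
    (hn : 1 ≤ n) : t ≤ (1 / 4) ^ 7 := by
  have hn' : (1 : ℝ) ≤ n := by exact_mod_cast hn
  have h2 : 1 / (n : ℝ) ≤ 1 := by rw [div_le_one (by linarith)]; exact hn'
  have h3 : 0 < 1 / (n : ℝ) := by positivity
  rw [h.t_eq]
  gcongr
  linarith

/-- Intermediate degrees. -/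
lemma EightStepData.false_of_range (h : EightStepData n t p4 p5 p6 p7 p8 X3 X4 X5 X6)
    {a b τ e5 e6 : ℝ} (ha : 4 ≤ a) (han : a ≤ n) (hnb : n ≤ b) (hτ : t ≤ τ)
    (he5 : 1 / 2 * (1 / a) < e5) (he5' : 1 / 2 * (τ + e5 * (1 / a)) ≤ e5 ^ 2)
    (he6 : (1 / 2 - (1 - 1 / a) / 8) * (1 / a) < e6)
    (he6' : (1 / 2 - (1 - 1 / a) / 8) * (τ + e6 * (1 / a)) ≤ e6 ^ 2)
    (htot : 11 * (τ * b + τ + (2 * e6 + 1 / a / 4) / 8 + 2 * (τ + τ * b + 1 / 4 * (1 / a) ^ 2) +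
      3 * ((1 + 1 / a) * (τ + e5 * (1 / a))) + 11 * ((1 + 1 / a) * (τ + e6 * (1 / a)))) <
      (1 - 1 / a) / 4) : False := by
  have hn : (0 : ℝ) < n := by linarith
  have hu : 1 / (n : ℝ) ≤ 1 / a := one_div_le_one_div_of_le (by linarith) han
  have hu0 : 0 < 1 / (n : ℝ) := by positivity
  have ha1 : 1 / a ≤ 1 / 4 := one_div_le_one_div_of_le (by norm_num) ha
  have ht0 : 0 ≤ t := by
    rw [h.t_eq]
    exact pow_nonneg (by linarith) 7
  have htn : t * n ≤ τ * b := mul_le_mul hτ hnb hn.le (ht0.trans hτ)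
  refine h.false_of_bounds (x7 := τ * b / 2) (x4 := τ + τ * b + 1 / 4 * (1 / a) ^ 2) ha han hτ he5
    he5' he6 he6' (fun _ => ?_) ?_ (by linarith)
  · linarith [h.p7_le']
  · refine h.X4_le'.trans ?_
    have h1 : (1 - 1 / (n : ℝ)) * t * n ≤ τ * b := by
      rw [mul_assoc]
      refine le_trans ?_ htn
      have : 0 ≤ t * n := by positivity
      nlinarith
    have h2 : p4 * (1 / (n : ℝ)) ^ 2 ≤ 1 / 4 * (1 / a) ^ 2 :=
      mul_le_mul h.p4_le (pow_le_pow_left₀ hu0.le hu 2) (by positivity) (by norm_num)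
    linarith

/-- On each range the quadratic inequalities give numerical majorants `e5` and `e6` of the exit
means, and `τ` majorises `t`; 0.0000611 is slightly more than 4 ^ (-7). Above 60 the estimate of
`X4` through `p4 ≤ 1 / 4` takes over, and above 120 the quadratic bound on `p7` replaces the one
that grows with `n`. -/
lemma EightStepData.false (h : EightStepData n t p4 p5 p6 p7 p8 X3 X4 X5 X6) (h6 : 6 ≤ n) :
    False := by
  rcases le_or_gt n 25 with h1 | h1
  · exact h.false_of_le h6 h1
  have c1 : (26 : ℝ) ≤ n := by exact_mod_cast h1
  have hq := h.t_le_quarter (by omega)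
  rcases le_or_gt (n : ℝ) 32 with h2 | h2
  · have ht := h.t_le (by omega) h2
    refine h.false_of_range (a := 26) (b := 32) (τ := 0.0000489) (e5 := 0.0205) (e6 := 0.0158)
      (by norm_num) c1 h2 (ht.trans (by norm_num)) ?_ ?_ ?_ ?_ ?_ <;> norm_num
  rcases le_or_gt (n : ℝ) 40 with h3 | h3
  · have ht := h.t_le (by omega) h3
    refine h.false_of_range (a := 32) (b := 40) (τ := 0.0000513) (e5 := 0.0173) (e6 := 0.0135)
      (by norm_num) h2.le h3 (ht.trans (by norm_num)) ?_ ?_ ?_ ?_ ?_ <;> norm_num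
  rcases le_or_gt (n : ℝ) 60 with h4 | h4
  · refine h.false_of_range (a := 40) (b := 60) (τ := 0.0000611) (e5 := 0.0148) (e6 := 0.0118)
      (by norm_num) h3.le h4 (hq.trans (by norm_num)) ?_ ?_ ?_ ?_ ?_ <;> norm_num
  have hX : ∀ a : ℝ, 1 ≤ a → a ≤ n → X4 ≤ 0.0000611 + 1 / 4 * (1 / a) := by
    intro a ha han
    have hu : 1 / (n : ℝ) ≤ 1 / a := one_div_le_one_div_of_le (by linarith) han
    refine h.X4_le.trans (add_le_add (hq.trans (by norm_num)) ?_)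
    exact mul_le_mul h.p4_le hu (by positivity) (by norm_num)
  have ht0 : 0 ≤ t := by
    have : 1 / (n : ℝ) ≤ 1 := by rw [div_le_one (by linarith)]; linarith
    rw [h.t_eq]
    exact pow_nonneg (by linarith) 7
  rcases le_or_gt (n : ℝ) 120 with h5 | h5
  · refine h.false_of_bounds (a := 60) (τ := 0.0000611) (e5 := 0.0113) (e6 := 0.0091)
      (x7 := 0.0000611 * 120 / 2) (x4 := 0.0000611 + 1 / 4 * (1 / 60))
      (by norm_num) h4.le (hq.trans (by norm_num)) ?_ ?_ ?_ ?_ (fun _ => ?_)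
      (hX 60 (by norm_num) h4.le) ?_
    · norm_num
    · norm_num
    · norm_num
    · norm_num
    · have := mul_le_mul (hq.trans (by norm_num : _ ≤ (0.0000611 : ℝ))) h5 (by linarith) (by norm_num)
      linarith [h.p7_le']
    · norm_num
  · refine h.false_of_bounds (a := 120) (τ := 0.0000611) (e5 := 0.0081) (e6 := 0.0067)
      (x7 := 0.0067) (x4 := 0.0000611 + 1 / 4 * (1 / 120))
      (by norm_num) h5.le (hq.trans (by norm_num)) ?_ ?_ ?_ ?_ (fun h => h)
      (hX 120 (by norm_num) h5.le) ?_ <;> norm_num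

end Eight

/-- The constant is chosen to exceed 256 · 49 / 144, about 87.1, which is what `exitTotal_large`
requires. -/
lemma eighty_eight_mul_pow_six_le {n : ℕ} (hn : 16 ≤ n) : 88 * (n : ℝ) ^ 6 ≤ 4 ^ n := by
  induction n, hn using Nat.le_induction with
  | base => norm_num
  | succ n hn ih =>
    have h1 : (16 : ℝ) ≤ n := by exact_mod_cast hn
    have h2 : ((n : ℝ) + 1) ≤ n * (17 / 16) := by linarith
    have h3 : ((n : ℝ) + 1) ^ 6 ≤ (n * (17 / 16)) ^ 6 := by gcongr
    rw [mul_pow] at h3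
    push_cast
    rw [pow_succ (4 : ℝ)]
    have h4 : (0 : ℝ) ≤ n ^ 6 := by positivity
    nlinarith

/-- Optimising a two-term bound over the powers of `q`. -/
lemma cube_le_of_geometric_bound {q t p : ℝ} (hq : 6 ≤ q) (ht : 0 ≤ t) {H : ℕ}
    (hpt : p ≤ t * q ^ (2 * H))
    (h : ∀ M ≤ H, p ^ 2 ≤ 1 / 2 * (t * ((q ^ M - 1) / q) + p / q ^ M)) :
    p ^ 3 ≤ 49 / 144 * t := by
  have hq0 : 0 < q := by linarith
  classical
  -- The least such M makes the two terms of the hypothesis comparable: their ratio is then at most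
  -- about q in either direction.
  have hex : ∃ M, p ≤ t * q ^ (2 * M) := ⟨H, hpt⟩
  have hM := Nat.find_spec hex
  have hMH : Nat.find hex ≤ H := Nat.find_min' hex hpt
  have hmin := fun m => Nat.find_min hex (m := m)
  have hb := h _ hMH
  generalize Nat.find hex = M at *
  cases M with
  | zero =>
    simp at hM hb
    have h1 : p ≤ 1 / 2 := by nlinarith
    nlinarith [sq_nonneg p]
  | succ M =>
    have h1 := hmin M (by omega)
    push Not at h1
    have hx : 0 < q ^ M := by positivity
    have e1 : q ^ (2 * (M + 1)) = q ^ 2 * (q ^ M) ^ 2 := by ring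
    have e2 : q ^ (2 * M) = (q ^ M) ^ 2 := by ring
    have e3 : q ^ (M + 1) = q * q ^ M := by ring
    rw [e1] at hM
    rw [e2] at h1
    rw [e3] at hb
    generalize q ^ M = a at *
    have hp0 : 0 < p := lt_of_le_of_lt (by positivity) h1
    set y := p / (q * a) with hy
    have hya : y * (q * a) = p := by rw [hy]; field_simp
    have hy0 : 0 < y := by positivity
    have h2 : t * ((q * a - 1) / q) ≤ t * a := by
      refine mul_le_mul_of_nonneg_left ?_ ht
      rw [div_le_iff₀ hq0]
      linarith
    have h3 : p ^ 2 ≤ 1 / 2 * (t * a + y) := by linarith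
    have h4 : (t * a + y) ^ 2 ≤ 49 / 36 * (t * p) := by
      -- with `x = t a ≤ y q` and `y ≤ x q` the two terms are comparable
      have h5 : t * a ≤ y * q := by
        have : t * a ^ 2 ≤ y * q * a := by nlinarith
        nlinarith
      have h6 : y ≤ t * a * q := by
        have : y * (q * a) ≤ t * a * q * (q * a) := by rw [hya]; nlinarith
        exact le_of_mul_le_mul_right this (by positivity)
      have h7 : t * p = t * a * (y * q) := by rw [← hya]; ring
      rw [h7]
      set x := t * a with hx'
      -- When x ≤ q y and y ≤ q x, the quotient (x + y)² / (x y) is largest at the ends of the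
      -- range, where it equals (q + 1)² / q. The factor 49 / 36 is (7 / 6)², an upper bound for ((q
      -- + 1) / q)² when q ≥ 6.
      have h8 : 0 ≤ (y * q - x) * (x * q - y) := mul_nonneg (by linarith) (by linarith)
      have hx0 : 0 ≤ x := by positivity
      have h9 : q * (x + y) ^ 2 ≤ (q + 1) ^ 2 * (x * y) := by nlinarith
      have h10 : (q + 1) ^ 2 ≤ 49 / 36 * q ^ 2 := by nlinarith
      have h11 : q * (x + y) ^ 2 ≤ q * (49 / 36 * (x * (y * q))) := by
        nlinarith [mul_nonneg hx0 hy0.le]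
      exact le_of_mul_le_mul_left h11 hq0
    have h5 : (p ^ 2) ^ 2 ≤ (1 / 2 * (t * a + y)) ^ 2 := by gcongr
    have h6 : p * p ^ 3 ≤ p * (49 / 144 * t) := by nlinarith
    exact le_of_mul_le_mul_left h6 hp0

/-! ### Lower bounds for the weighted total of exit probabilities -/

namespace SimpleGraph

variable {V : Type*} [Fintype V] [LinearOrder V] {G : SimpleGraph V} {q : ℝ}

lemma surviveMean_one [Nonempty V] (hq : 0 < q) (hreg : ∀ v, ∑ a, ind (G.Adj v a) = q + 1) :
    G.surviveMean q 1 = 1 / 2 := by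
  rw [surviveMean_eq hq hreg, Finset.sum_range_succ, Finset.sum_range_one, exitMean_zero,
    exitMean_one hreg hq]
  norm_num

lemma surviveMean_le [Nonempty V] (hq : 0 < q) (hreg : ∀ v, ∑ a, ind (G.Adj v a) = q + 1)
    {d : ℕ} (hd : 2 ≤ d) : G.surviveMean q d ≤ 1 / 2 - G.exitMean q 2 := by
  have h1 : ∑ i ∈ Finset.range 3, G.exitMean q i ≤ ∑ i ∈ Finset.range (d + 1), G.exitMean q i :=
    Finset.sum_le_sum_of_subset_of_nonneg (Finset.range_subset_range.2 (by omega))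
      fun i _ _ => exitMean_nonneg hq i
  rw [Finset.sum_range_succ, Finset.sum_range_succ, Finset.sum_range_one, exitMean_zero,
    exitMean_one hreg hq] at h1
  rw [surviveMean_eq hq hreg]
  linarith

lemma surviveMean_le_half [Nonempty V] (hq : 0 < q)
    (hreg : ∀ v, ∑ a, ind (G.Adj v a) = q + 1) {d : ℕ} (hd : 1 ≤ d) :
    G.surviveMean q d ≤ 1 / 2 := by
  rcases hd.eq_or_lt with rfl | h
  · exact (surviveMean_one hq hreg).le
  · have := surviveMean_le hq hreg (d := d) (by omega)
    linarith [exitMean_nonneg (G := G) hq 2]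

/-- Use the second term of the minimum in `exitEnergy_succ_le` throughout: the weights (q - 1) / q
and 1 / q add up to 1. -/
lemma exitEnergy_le_exitMean [Nonempty V] (hq : 1 ≤ q)
    (hreg : ∀ v, ∑ a, ind (G.Adj v a) = q + 1) (d h : ℕ) :
    G.exitEnergy q (d + 1) h ≤ G.exitMean q (d + h + 1) := by
  have hq0 : 0 < q := by linarith
  induction h generalizing d with
  | zero => exact (exitEnergy_zero d).le
  | succ h ih =>
    refine (exitEnergy_succ_le hq hreg d h).trans ?_
    have h1 := ih (d + 1)
    rw [show d + 1 + h + 1 = d + h + 2 by ring] at h1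
    rw [show d + (h + 1) + 1 = d + h + 2 by ring]
    have h2 : (q - 1) / q * min (2 * G.exitMean q (2 * h + 2)) (G.exitMean q (d + h + 2)) ≤
        (q - 1) / q * G.exitMean q (d + h + 2) :=
      mul_le_mul_of_nonneg_left (min_le_right _ _) (div_nonneg (by linarith) hq0.le)
    have h3 : G.exitEnergy q (d + 2) h / q ≤ G.exitMean q (d + h + 2) / q :=
      div_le_div_of_nonneg_right h1 hq0.le
    refine (add_le_add h2 h3).trans (le_of_eq ?_)
    field_simp
    ring

/-- Using the bounds on the even exit probabilities for the first `M` levels. -/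
lemma exitEnergy_le_geometric [Nonempty V] (hq : 1 ≤ q)
    (hreg : ∀ v, ∑ a, ind (G.Adj v a) = q + 1) {t : ℝ} {H : ℕ}
    (hev : ∀ h c, h + 1 + c = H → 2 * G.exitMean q (2 * h + 2) ≤ t * q ^ (2 * c))
    (M d h c : ℕ) (hM : M ≤ h) (hc : h + c = H) :
    G.exitEnergy q (d + 1) h ≤
      t * q ^ (2 * c) * ((q ^ M - 1) / q) + G.exitMean q (d + h + 1) / q ^ M := by
  have hq0 : 0 < q := by linarith
  induction M generalizing d h c with
  | zero => simpa using exitEnergy_le_exitMean hq hreg d h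
  | succ M ih =>
    obtain ⟨h, rfl⟩ := Nat.exists_eq_add_of_le' (show 1 ≤ h by omega)
    refine (exitEnergy_succ_le hq hreg d h).trans ?_
    have h1 := ih (d + 1) h (c + 1) (by omega) (by omega)
    rw [show d + 1 + h + 1 = d + h + 2 by ring] at h1
    rw [show d + (h + 1) + 1 = d + h + 2 by ring]
    have h2 : (q - 1) / q * min (2 * G.exitMean q (2 * h + 2)) (G.exitMean q (d + h + 2)) ≤
        (q - 1) / q * (t * q ^ (2 * c)) :=
      mul_le_mul_of_nonneg_left ((min_le_left _ _).trans (hev h c hc))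
        (div_nonneg (by linarith) hq0.le)
    have h3 := div_le_div_of_nonneg_right h1 hq0.le
    refine (add_le_add h2 h3).trans (le_of_eq ?_)
    have e : q ^ (2 * (c + 1)) = q ^ (2 * c) * q ^ 2 := by ring
    have e' : q ^ (M + 1) = q ^ M * q := by ring
    rw [e, e']
    field_simp
    ring

/-- The weighted sum of the mean exit probabilities. -/
noncomputable def exitTotal (G : SimpleGraph V) (q : ℝ) (R : ℕ) : ℝ :=
  ∑ l ∈ Finset.range (R + 1), G.exitMean q l / q ^ (R - l)

lemma exitMean_le_exitTotal (hq : 0 < q) {R l : ℕ} (hl : l ≤ R) :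
    G.exitMean q l ≤ G.exitTotal q R * q ^ (R - l) := by
  rw [← div_le_iff₀ (by positivity)]
  exact Finset.single_le_sum (f := fun l => G.exitMean q l / q ^ (R - l))
    (fun i _ => div_nonneg (exitMean_nonneg hq i) (by positivity)) (Finset.mem_range.2 (by omega))

/-- The only nonzero correlation of total time 2 is that of two exits at step 1. Their mean is 1/2,
and `le_pairing_self` turns it into a correlation. -/
lemma exitMean_two_ge [Nonempty V] (hq : 0 < q) (hreg : ∀ v, ∑ a, ind (G.Adj v a) = q + 1)
    (hg : 3 ≤ G.girth) : (q - 1) / q / 8 ≤ G.exitMean q 2 := by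
  have h1 := sum_exitCorr_le (G := G) hq (l := 2) le_rfl hg
  have h2 : ∑ x ∈ Finset.HasAntidiagonal.antidiagonal 2, G.exitCorr q x.1 x.2 =
      G.exitCorr q 1 1 := by
    rw [Finset.Nat.antidiagonal_succ]
    simp [Finset.Nat.antidiagonal_succ, exitCorr_zero_left, exitCorr_zero_right]
  have hn : (0 : ℝ) < Fintype.card V := by exact_mod_cast Fintype.card_pos
  have h3 := le_pairing_self hq (f := fun v => G.exitProb q v 1 v)
    (fun v a => exitProb_nonneg hq _ _ _ _) (fun v a => exitProb_le hq hreg _ _ _ _) (by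
      have := exitMean_one hreg hq
      rw [exitMean, div_eq_iff (by positivity)] at this
      linarith)
  have h4 : (q - 1) / q / 4 ≤ G.exitCorr q 1 1 := by
    rw [exitCorr, div_div, div_le_div_iff₀ (by positivity) (by positivity)]
    nlinarith
  linarith

lemma exitTotal_one [Nonempty V] (hq : 0 < q) (hreg : ∀ v, ∑ a, ind (G.Adj v a) = q + 1) :
    1 / 2 ≤ G.exitTotal q 1 := by
  have := exitMean_le_exitTotal (G := G) hq (R := 1) (l := 1) le_rfl
  rw [exitMean_one hreg hq] at this
  simpa using this

lemma exitTotal_two [Nonempty V] (hq : 0 < q) (hreg : ∀ v, ∑ a, ind (G.Adj v a) = q + 1)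
    (hg : 3 ≤ G.girth) : (q - 1) / q / 8 ≤ G.exitTotal q 2 := by
  have h1 := exitMean_le_exitTotal (G := G) hq (R := 2) (l := 2) le_rfl
  have h2 := exitMean_two_ge hq hreg hg
  simp at h1
  linarith

/-- The exits at steps 1 and 2 are combined with relative weight 1/q, so that the self-correlation
of the combination reproduces the weights of `exitTotal` at times 2, 3 and 4. Convexity bounds it
below by the square of the mean exit probability at step 2. -/
lemma exitTotal_four [Nonempty V] (hq : 2 ≤ q) (hreg : ∀ v, ∑ a, ind (G.Adj v a) = q + 1)
    (hg : 5 ≤ G.girth) : ((q - 1) / q / 4) ^ 3 / 2 ≤ G.exitTotal q 4 := by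
  have hq0 : 0 < q := by linarith
  have hn : (0 : ℝ) < Fintype.card V := by exact_mod_cast Fintype.card_pos
  set f : V → V → ℝ := fun v a => G.exitProb q v 2 v a + G.exitProb q v 1 v a / q with hf
  have k2 := sum_exitCorr_le (G := G) hq0 (l := 2) (by norm_num) (by omega)
  have k3 := sum_exitCorr_le (G := G) hq0 (l := 3) (by norm_num) (by omega)
  have k4 := sum_exitCorr_le (G := G) hq0 (l := 4) (by norm_num) (by omega)
  simp only [Finset.Nat.sum_antidiagonal_eq_sum_range_succ_mk, Finset.sum_range_succ,
    Finset.sum_range_zero] at k2 k3 k4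
  norm_num at k2 k3 k4
  have c := fun i j => exitCorr_nonneg (G := G) hq0 i j
  have hpair : pairing f f / (Fintype.card V * (q + 1) * q) =
      G.exitCorr q 2 2 + 2 * G.exitCorr q 1 2 / q + G.exitCorr q 1 1 / q ^ 2 := by
    have e : pairing f f = pairing (fun v => G.exitProb q v 2 v) (fun v => G.exitProb q v 2 v) +
        pairing (fun v => G.exitProb q v 1 v) (fun v => G.exitProb q v 2 v) / q +
        pairing (fun v => G.exitProb q v 2 v) (fun v => G.exitProb q v 1 v) / q +
        pairing (fun v => G.exitProb q v 1 v) (fun v => G.exitProb q v 1 v) / q ^ 2 := by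
      simp only [pairing, hf, Finset.sum_div, ← Finset.sum_add_distrib]
      refine Finset.sum_congr rfl fun v _ => Finset.sum_congr rfl fun a _ =>
        Finset.sum_congr rfl fun b _ => ?_
      field_simp
      ring
    rw [e, pairing_comm (fun v => G.exitProb q v 2 v) (fun v => G.exitProb q v 1 v)]
    simp only [exitCorr]
    field_simp
    ring
  have hlow : G.exitMean q 2 ^ 2 ≤ pairing f f / (Fintype.card V * (q + 1) * q) := by
    set m := G.exitMean q 2 + 1 / (2 * q) with hm
    have s1 : ∑ v, ∑ a, f v a = Fintype.card V * (q + 1) * m := by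
      have h1 := exitMean_one hreg hq0
      have h2 : G.exitMean q 2 = G.exitMean q 2 := rfl
      rw [exitMean, div_eq_iff (by positivity)] at h1
      conv_rhs at h2 => rw [exitMean]
      rw [eq_div_iff (by positivity)] at h2
      simp only [hf, Finset.sum_add_distrib, ← Finset.sum_div, h1, ← h2, hm]
      field_simp
    have s2 : ∑ v, ∑ a, f v a * f v a ≤
        Fintype.card V * (q + 1) * (G.exitMean q 2 + 1 / (2 * q ^ 2)) := by
      have h1 := exitMean_one hreg hq0
      have h2 : G.exitMean q 2 = G.exitMean q 2 := rfl
      rw [exitMean, div_eq_iff (by positivity)] at h1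
      conv_rhs at h2 => rw [exitMean]
      rw [eq_div_iff (by positivity)] at h2
      -- A dart either exits at step 1 or can still exit at step 2, never both, so the square has no
      -- mixed term.
      have h3 : ∀ v a, f v a * f v a ≤ G.exitProb q v 2 v a + G.exitProb q v 1 v a / q ^ 2 := by
        intro v a
        have h4 := exitProb_nonneg (G := G) hq0 v 2 v a
        have h5 := exitProb_le (G := G) hq0 hreg v 2 v a
        have h6 := ind_le_one (G.Adj v a)
        simp only [hf]
        by_cases h : v < a
        · have : G.exitProb q v 1 v a = 0 := by rw [exitProb_one, ind_of_not (not_le.2 h), mul_zero]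
          rw [this]
          simp only [zero_div, add_zero]
          nlinarith
        · have : G.exitProb q v 2 v a = 0 := by
            rw [exitProb_succ_succ, ind_of_not h, mul_zero, zero_mul]
          rw [this, exitProb_one, ← ind_and, zero_add, zero_add, div_mul_div_comm, ind_mul_self,
            pow_two]
      refine (Finset.sum_le_sum fun v _ => Finset.sum_le_sum fun a _ => h3 v a).trans
        (le_of_eq ?_)
      simp only [Finset.sum_add_distrib, ← Finset.sum_div, h1]
      rw [← h2]
      field_simp
    rw [pairing_eq, le_div_iff₀ (by positivity)]
    have s3 : Fintype.card V * ((q + 1) * m) ^ 2 ≤ ∑ v, (∑ a, f v a) * (∑ a, f v a) := by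
      have h1 := sq_sum_le_card_mul_sum_sq (s := Finset.univ) (f := fun v => ∑ a, f v a)
      rw [s1, Finset.card_univ] at h1
      simp only [← pow_two]
      have : (↑(Fintype.card V) * (q + 1) * m) ^ 2 =
        Fintype.card V * (Fintype.card V * ((q + 1) * m) ^ 2) := by ring
      rw [this] at h1
      exact le_of_mul_le_mul_left h1 hn
    have hp0 := exitMean_nonneg (G := G) hq0 2
    have key : G.exitMean q 2 ^ 2 * q ≤ (q + 1) * m ^ 2 - (G.exitMean q 2 + 1 / (2 * q ^ 2)) := by
      have e1 : (q + 1) * m ^ 2 - (G.exitMean q 2 + 1 / (2 * q ^ 2)) - G.exitMean q 2 ^ 2 * q =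
          m ^ 2 + (q - 2) / (4 * q ^ 2) := by
        rw [hm]; field_simp; ring
      have : 0 ≤ (q - 2) / (4 * q ^ 2) := div_nonneg (by linarith) (by positivity)
      nlinarith [sq_nonneg m]
    have hpos : 0 < Fintype.card V * (q + 1) := by positivity
    have := mul_le_mul_of_nonneg_left key hpos.le
    nlinarith
  have h2 := exitMean_two_ge hq0 hreg (by omega)
  set β := (q - 1) / q with hβ
  have hβ0 : 0 ≤ β := div_nonneg (by linarith) hq0.le
  have hβ1 : β ≤ 1 := by rw [hβ, div_le_one hq0]; linarith
  have hA : (2 * G.exitTotal q 4) ≥ pairing f f / (Fintype.card V * (q + 1) * q) := by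
    rw [hpair, exitTotal]
    simp only [Finset.sum_range_succ, Finset.sum_range_zero]
    norm_num
    have a3 : 2 * G.exitCorr q 1 2 / q ≤ 2 * G.exitMean q 3 / q := by
      refine div_le_div_of_nonneg_right ?_ hq0.le
      have := exitCorr_comm (G := G) (q := q) 2 1
      linarith [c 0 3, c 3 0]
    have a2 : G.exitCorr q 1 1 / q ^ 2 ≤ 2 * G.exitMean q 2 / q ^ 2 := by
      refine div_le_div_of_nonneg_right ?_ (by positivity)
      linarith [c 0 2, c 2 0]
    have a4 : G.exitCorr q 2 2 ≤ 2 * G.exitMean q 4 := by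
      linarith [c 0 4, c 1 3, c 3 1, c 4 0]
    have a1 : 0 ≤ G.exitMean q 1 / q ^ 3 := div_nonneg (exitMean_nonneg hq0 _) (by positivity)
    have a0 : 0 ≤ G.exitMean q 0 / q ^ 4 := div_nonneg (exitMean_nonneg hq0 _) (by positivity)
    have e1 : 2 * G.exitMean q 3 / q = 2 * (G.exitMean q 3 / q) := by ring
    have e2 : 2 * G.exitMean q 2 / q ^ 2 = 2 * (G.exitMean q 2 / q ^ 2) := by ring
    linarith
  have h3 : (β / 8) ^ 2 ≤ G.exitMean q 2 ^ 2 := by gcongr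
  have h4 : β ^ 3 ≤ β ^ 2 := pow_le_pow_of_le_one hβ0 hβ1 (by norm_num)
  nlinarith

end SimpleGraph

namespace SimpleGraph

variable {V : Type*} [Fintype V] [LinearOrder V] {G : SimpleGraph V} {q : ℝ}

/-- If the bound failed, every mean up to time 8 would be small, and together with the second-moment
estimates this would satisfy the contradictory system `EightStepData`. The survival correlation is
taken at six steps. -/
lemma exitTotal_eight [Nonempty V] {n : ℕ} (hn : 6 ≤ n)
    (hreg : ∀ v, ∑ a, ind (G.Adj v a) = n + 1) (hg : 32 ≤ G.girth) :
    (((n : ℝ) - 1) / n / 4) ^ 7 / 2 ≤ G.exitTotal n 8 := by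
  have hn6 : (6 : ℝ) ≤ n := by exact_mod_cast hn
  have hq0 : (0 : ℝ) < n := by linarith
  have hq1 : (1 : ℝ) ≤ n := by linarith
  by_contra hlt
  push Not at hlt
  set t : ℝ := (((n : ℝ) - 1) / n / 4) ^ 7 with ht
  set p := fun l => G.exitMean n l with hp
  have hp0 : ∀ l, 0 ≤ p l := fun l => exitMean_nonneg hq0 l
  have hpt : ∀ l c, l + c = 8 → 2 * p l ≤ t * n ^ c := by
    intro l c hlc
    have h1 := exitMean_le_exitTotal (G := G) hq0 (R := 8) (l := l) (by omega)
    rw [show 8 - l = c by omega] at h1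
    have : (0 : ℝ) < n ^ c := by positivity
    simp only [hp]
    nlinarith
  have hβ : ((n : ℝ) - 1) / n = 1 - 1 / n := by field_simp
  have hev : ∀ h c, h + 1 + c = 4 → 2 * G.exitMean n (2 * h + 2) ≤ t * (n : ℝ) ^ (2 * c) :=
    fun h c hc => hpt _ _ (by omega)
  have E := fun M d h c hM hc =>
    exitEnergy_le_geometric (G := G) hq1 hreg hev M d h c hM hc
  have hp2 := exitMean_two_ge hq0 hreg (by omega)
  have hM : ∀ d, 2 ≤ d → G.surviveMean n d ≤ 1 / 2 - (1 - 1 / (n : ℝ)) / 8 := by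
    intro d hd
    have := surviveMean_le hq0 hreg hd
    rw [hβ] at hp2
    linarith
  have hMpos : 0 ≤ 1 / 2 - (1 - 1 / (n : ℝ)) / 8 := by
    have : 0 < 1 / (n : ℝ) := by positivity
    linarith
  have E1 : ∀ d, G.exitEnergy n (d + 1) 4 ≤ (1 - 1 / (n : ℝ)) * t + p (d + 5) * (1 / n) := by
    intro d
    refine (E 1 d 4 0 (by norm_num) rfl).trans (le_of_eq ?_)
    rw [← hβ]
    simp only [hp]
    rw [show d + 4 + 1 = d + 5 by ring]
    field_simp
    ring
  have hE0 : ∀ d, 0 ≤ (1 - 1 / (n : ℝ)) * t + p (d + 5) * (1 / n) := by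
    intro d
    rw [← hβ]
    have : 0 ≤ ((n : ℝ) - 1) / n := div_nonneg (by linarith) hq0.le
    have := hp0 (d + 5)
    positivity
  have E2 : ∀ d, p (d + 5) ^ 2 ≤
      G.surviveMean n (d + 1) * ((1 - 1 / (n : ℝ)) * t + p (d + 5) * (1 / n)) := by
    intro d
    have h1 := exitMean_sq_le (G := G) hq0 d 3
    refine h1.trans (mul_le_mul_of_nonneg_left (E1 d) ?_)
    refine div_nonneg (Finset.sum_nonneg fun v _ => Finset.sum_nonneg fun a _ =>
      surviveProb_nonneg hq0 _ _ _ _) (by positivity)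
  have c := fun i j => exitCorr_nonneg (G := G) hq0 i j
  have K := fun l (h2 : 2 ≤ l) (hl : l ≤ 31) =>
    sum_exitCorr_le (G := G) hq0 (l := l) h2 (by omega)
  have k6 := K 6 (by norm_num) (by norm_num)
  have k7 := K 7 (by norm_num) (by norm_num)
  have k8 := K 8 (by norm_num) (by norm_num)
  simp only [Finset.Nat.sum_antidiagonal_eq_sum_range_succ_mk, Finset.sum_range_succ,
    Finset.sum_range_zero] at k6 k7 k8
  norm_num at k6 k7 k8
  have hX3 := exitCorr_self_eq (G := G) hq0 2
  have hX4 := exitCorr_self_eq (G := G) hq0 3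
  have hX3' := exitEnergy_le_exitMean (G := G) hq1 hreg 0 2
  have hX4' := exitEnergy_le_exitMean (G := G) hq1 hreg 0 3
  have hX4'' := E 1 0 3 1 (by norm_num) rfl
  norm_num at hX3 hX4 hX3' hX4' hX4''
  have hp3 := exitMean_le_quarter (G := G) hq0 hreg (l := 3) (by norm_num) (by omega)
  have hX5 := exitVertexSq_le (G := G) hq0 hreg 0 4
  have hX6 := exitVertexSq_le (G := G) hq0 hreg 1 4
  have hX5' := E 2 0 4 0 (by norm_num) rfl
  norm_num at hX5 hX6 hX5'
  have hfac : ((n : ℝ) + 1) / n = 1 + 1 / n := by field_simp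
  have hfac0 : 0 ≤ 1 + 1 / (n : ℝ) := by positivity
  rw [hfac] at hX5 hX6
  have hK4 := le_surviveCorr (G := G) hq0 hreg (s := 6) (by norm_num) (by omega)
  have hφ := surviveCorr_le (G := G) hreg hq0 (s := 6) (by norm_num) (by omega)
  -- Total times 7 and 8 are controlled by `exitMean`. Larger totals lie beyond the range of
  -- `exitTotal n 8`, so those correlations are split into the vertex second moments at steps 3 to
  -- 6.
  have hset : (Finset.range (6 + 1) ×ˢ Finset.range (6 + 1)).filter (fun x => 6 < x.1 + x.2) =
      {(1, 6), (2, 5), (3, 4), (4, 3), (5, 2), (6, 1), (2, 6), (3, 5), (4, 4), (5, 3), (6, 2),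
        (3, 6), (4, 5), (5, 4), (6, 3), (4, 6), (5, 5), (6, 4), (5, 6), (6, 5), (6, 6)} := by
    decide
  rw [hset] at hφ
  simp at hφ
  -- The estimate available at step 3 is much weaker than the one at step 6, hence the unbalanced
  -- weight.
  have m36 := exitCorr_le_vertexSq (G := G) hq0 (c := 1 / 8) (by norm_num) 3 6
  have m := fun i j => exitCorr_le_vertexSq (G := G) hq0 (c := 1) (by norm_num) i j
  have m45 := m 4 5
  have m46 := m 4 6
  have m55 := m 5 5
  have m56 := m 5 6
  have m66 := m 6 6
  norm_num at m36 m45 m46 m55 m56 m66 hK4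
  have s63 := exitCorr_comm (G := G) (q := n) 6 3
  have s54 := exitCorr_comm (G := G) (q := n) 5 4
  have s64 := exitCorr_comm (G := G) (q := n) 6 4
  have s65 := exitCorr_comm (G := G) (q := n) 6 5
  refine EightStepData.false (n := n) (t := t) (p4 := p 4) (p5 := p 5) (p6 := p 6) (p7 := p 7)
    (p8 := p 8) (X3 := G.exitVertexSq n 3) (X4 := G.exitVertexSq n 4)
    (X5 := G.exitVertexSq n 5) (X6 := G.exitVertexSq n 6) ?_ hn
  refine ⟨by rw [ht, hβ], hp0 4, hp0 5, hp0 6, hp0 7,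
    exitMean_le_quarter hq0 hreg (by norm_num) (by omega),
    exitMean_le_quarter hq0 hreg (by norm_num) (by omega),
    hpt 4 4 rfl, hpt 5 3 rfl, hpt 6 2 rfl, by simpa using hpt 7 1 rfl, by simpa using hpt 8 0 rfl,
    ?_, ?_, ?_, ?_, ?_, ?_, ?_, ?_, ?_, ?_⟩
  · refine (E2 0).trans (mul_le_mul_of_nonneg_right ?_ (hE0 0))
    exact (surviveMean_one hq0 hreg).le
  · exact (E2 1).trans (mul_le_mul_of_nonneg_right (hM 2 le_rfl) (hE0 1))
  · exact (E2 2).trans (mul_le_mul_of_nonneg_right (hM 3 (by norm_num)) (hE0 2))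
  · have h1 : G.exitEnergy n 1 2 / n ≤ 1 / 4 / n :=
      div_le_div_of_nonneg_right (hX3'.trans hp3) hq0.le
    have h2 : (1 : ℝ) / n / 4 = 1 / 4 / n := by ring
    rw [hX3, h2]
    linarith [c 0 6, c 1 5, c 2 4, c 4 2, c 5 1, c 6 0]
  · have h1 : G.exitEnergy n 1 3 / n ≤ G.exitMean n 4 / n :=
      div_le_div_of_nonneg_right hX4' hq0.le
    have h2 : p 4 * (1 / n) = G.exitMean n 4 / n := by rw [mul_one_div]
    have h3 : 2 * p 8 ≤ t := by simpa using hpt 8 0 rfl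
    rw [hX4, h2]
    linarith [c 0 8, c 1 7, c 2 6, c 3 5, c 5 3, c 6 2, c 7 1, c 8 0]
  · have h1 := div_le_div_of_nonneg_right hX4'' hq0.le
    have h2 : (t * n ^ 2 * ((n - 1) / n) + G.exitMean n 4 / n) / n =
        (1 - 1 / (n : ℝ)) * t * n + p 4 * (1 / n) ^ 2 := by
      rw [← hβ]
      simp only [hp]
      field_simp
    have h3 : 2 * p 8 ≤ t := by simpa using hpt 8 0 rfl
    rw [h2] at h1
    rw [hX4]
    linarith [c 0 8, c 1 7, c 2 6, c 3 5, c 5 3, c 6 2, c 7 1, c 8 0]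
  · exact hX5.trans (mul_le_mul_of_nonneg_left (E1 0) hfac0)
  · refine hX5.trans (mul_le_mul_of_nonneg_left (hX5'.trans (le_of_eq ?_)) hfac0)
    rw [← hβ]
    simp only [hp]
    field_simp
    ring
  · exact hX6.trans (mul_le_mul_of_nonneg_left (E1 1) hfac0)
  · rw [hβ] at hK4
    linarith [c 0 7, c 7 0, c 0 8, c 8 0, c 1 7, c 7 1]

/-- The general case. -/
lemma exitTotal_large [Nonempty V] (hq : 6 ≤ q) (hreg : ∀ v, ∑ a, ind (G.Adj v a) = q + 1)
    {H : ℕ} (hH : 8 ≤ H) (hg : 4 * H ≤ G.girth) :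
    ((q - 1) / q / 4) ^ (2 * H - 1) / 2 ≤ G.exitTotal q (2 * H) := by
  have hq0 : 0 < q := by linarith
  have hq1 : 1 ≤ q := by linarith
  by_contra hlt
  push Not at hlt
  set y := (q - 1) / q / 4 with hy
  have hy0 : 0 < y := div_pos (div_pos (by linarith) hq0) (by norm_num)
  have hy1 : y ≤ 1 / 4 := by
    rw [hy]
    gcongr
    rw [div_le_one hq0]
    linarith
  set t := y ^ (2 * H - 1) with ht
  have ht0 : 0 < t := by positivity
  have hpt : ∀ l c, l + c = 2 * H → 2 * G.exitMean q l ≤ t * q ^ c := by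
    intro l c hlc
    have h1 := exitMean_le_exitTotal (G := G) hq0 (R := 2 * H) (l := l) (by omega)
    rw [show 2 * H - l = c by omega] at h1
    have : (0 : ℝ) < q ^ c := by positivity
    nlinarith
  have hev : ∀ h c, h + 1 + c = H → 2 * G.exitMean q (2 * h + 2) ≤ t * q ^ (2 * c) :=
    fun h c hc => hpt _ _ (by omega)
  -- A mean `p` at a late time obeys p² ≤ (1/2) · `exitEnergy`. The energy is bounded by a geometric
  -- sum whose cut-off `M` is free, and optimising the cut-off gives the cube.
  have hcube : ∀ l, H < l → l ≤ 2 * H → G.exitMean q l ^ 3 ≤ 49 / 144 * t := by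
    intro l hl hl2
    obtain ⟨d, rfl⟩ : ∃ d, l = d + H + 1 := ⟨l - H - 1, by omega⟩
    have hp0 := exitMean_nonneg (G := G) hq0 (d + H + 1)
    refine cube_le_of_geometric_bound hq ht0.le (H := H) ?_ fun M hM => ?_
    · have h1 := hpt (d + H + 1) (2 * H - (d + H + 1)) (by omega)
      have h2 : t * q ^ (2 * H - (d + H + 1)) ≤ t * q ^ (2 * H) :=
        mul_le_mul_of_nonneg_left (pow_le_pow_right₀ hq1 (by omega)) ht0.le
      linarith
    · have h1 := exitEnergy_le_geometric (G := G) hq1 hreg hev M d H 0 hM rfl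
      have h2 := exitMean_sq_le (G := G) hq0 d (H - 1)
      rw [show d + (H - 1) + 2 = d + H + 1 by omega, show H - 1 + 1 = H by omega] at h2
      have h3 := surviveMean_le_half (G := G) hq0 hreg (d := d + 1) (by omega)
      rw [mul_zero, pow_zero, mul_one] at h1
      have h4 : 0 ≤ t * ((q ^ M - 1) / q) + G.exitMean q (d + H + 1) / q ^ M := by
        have : 1 ≤ q ^ M := one_le_pow₀ hq1
        have : 0 ≤ (q ^ M - 1) / q := div_nonneg (by linarith) hq0.le
        positivity
      have h5 : 0 ≤ G.surviveMean q (d + 1) :=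
        div_nonneg (Finset.sum_nonneg fun v _ => Finset.sum_nonneg fun a _ =>
          surviveProb_nonneg hq0 _ _ _ _) (by positivity)
      exact h2.trans ((mul_le_mul_of_nonneg_left h1 h5).trans (mul_le_mul_of_nonneg_right h3 h4))
  have hφ := surviveCorr_le (G := G) hreg hq0 (s := H) (by omega) (by omega)
  have h1 : ∑ x ∈ (Finset.range (H + 1) ×ˢ Finset.range (H + 1)).filter
      (fun x => H < x.1 + x.2), G.exitCorr q x.1 x.2 ≤
      ∑ l ∈ Finset.Ioc H (2 * H), 2 * G.exitMean q l := by
    rw [← Finset.sum_fiberwise_of_maps_to (t := Finset.Ioc H (2 * H)) (g := fun x => x.1 + x.2)]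
    · refine Finset.sum_le_sum fun l hl => ?_
      rw [Finset.mem_Ioc] at hl
      refine le_trans ?_ (sum_exitCorr_le hq0 (by omega) (by omega))
      refine Finset.sum_le_sum_of_subset_of_nonneg ?_ fun _ _ _ => exitCorr_nonneg hq0 _ _
      rintro ⟨i, j⟩ h
      simp at h ⊢
      omega
    · rintro ⟨i, j⟩ h
      simp at h ⊢
      omega
  -- The largest of the H late means serves for all of them.
  obtain ⟨l, hl, hmax⟩ := Finset.exists_max_image (Finset.Ioc H (2 * H))
    (fun l => G.exitMean q l) ⟨H + 1, by simp; omega⟩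
  have h2 : ∑ l ∈ Finset.Ioc H (2 * H), 2 * G.exitMean q l ≤ 2 * H * G.exitMean q l := by
    refine (Finset.sum_le_card_nsmul _ _ (2 * G.exitMean q l) fun k hk => ?_).trans (le_of_eq ?_)
    · linarith [hmax k hk]
    · rw [Nat.card_Ioc, nsmul_eq_mul, show 2 * H - H = H by omega]
      ring
  rw [Finset.mem_Ioc] at hl
  have h3 := hcube l hl.1 hl.2
  have hK := le_surviveCorr (G := G) hq0 hreg (s := H) (by omega) (by omega)
  have hH' : (8 : ℝ) ≤ H := by exact_mod_cast hH
  set P := G.exitMean q l with hP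
  have hP0 : 0 ≤ P := exitMean_nonneg hq0 l
  -- One factor `2 * H` comes from the positions in `le_surviveCorr`, the other from the H doubled
  -- means.
  have h4 : y ≤ (2 * H) ^ 2 * P := by
    have h5 : G.surviveCorr q H H ≤ 2 * H * P := hφ.trans (h1.trans h2)
    have h6 : (2 * (H : ℝ) - 1) * G.surviveCorr q H H ≤ (2 * H - 1) * (2 * H * P) :=
      mul_le_mul_of_nonneg_left h5 (by linarith)
    have h7 : 0 ≤ 2 * H * P := by positivity
    nlinarith
  have h5 : y ^ 3 ≤ (2 * (H : ℝ)) ^ 6 * (49 / 144 * t) := by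
    calc y ^ 3 ≤ ((2 * H) ^ 2 * P) ^ 3 := by gcongr
      _ = (2 * (H : ℝ)) ^ 6 * P ^ 3 := by ring
      _ ≤ _ := by gcongr
  have h6 : t = y ^ 3 * y ^ (2 * H - 4) := by
    rw [ht, ← pow_add]
    congr 1
    omega
  have h7 : y ^ (2 * H - 4) ≤ (1 / 4) ^ (2 * H - 4) := by gcongr
  have h8 : (1 / 4 : ℝ) ^ (2 * H - 4) * 4 ^ (2 * H) = 256 := by
    have e : 4 ^ (2 * H) = (4 : ℝ) ^ (2 * H - 4) * 4 ^ 4 := by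
      rw [← pow_add]
      congr 1
      omega
    rw [e, ← mul_assoc, ← mul_pow]
    norm_num
  have h9 := eighty_eight_mul_pow_six_le (n := 2 * H) (by omega)
  push_cast at h9
  have hy3 : 0 < y ^ 3 := by positivity
  have hz : 0 < (1 / 4 : ℝ) ^ (2 * H - 4) := by positivity
  -- Cubing `h4` costs the sixth power of `2 * H`, while `t` contains `2 * H - 4` factors `y ≤ 1 /
  -- 4` beyond `y ^ 3`. For H ≥ 8 the exponential wins.
  have h10 : (2 * (H : ℝ)) ^ 6 * (49 / 144 * y ^ (2 * H - 4)) < 1 := by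
    have h11 : (2 * (H : ℝ)) ^ 6 * (1 / 4 : ℝ) ^ (2 * H - 4) ≤ 256 / 88 := by
      rw [le_div_iff₀ (by norm_num), ← h8]
      nlinarith
    have h12 : (2 * (H : ℝ)) ^ 6 * y ^ (2 * H - 4) ≤ 256 / 88 :=
      (mul_le_mul_of_nonneg_left h7 (by positivity)).trans h11
    linarith
  rw [h6] at h5
  nlinarith

theorem exitTotal_two_pow [Nonempty V] {n : ℕ} (hn : 6 ≤ n)
    (hreg : ∀ v, ∑ a, ind (G.Adj v a) = n + 1) (k : ℕ) (hg : 4 * 2 ^ k ≤ G.girth) :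
    (((n : ℝ) - 1) / n / 4) ^ (2 ^ k - 1) / 2 ≤ G.exitTotal n (2 ^ k) := by
  have hn6 : (6 : ℝ) ≤ n := by exact_mod_cast hn
  have hq0 : (0 : ℝ) < n := by linarith
  match k with
  | 0 => simpa using exitTotal_one (G := G) hq0 hreg
  | 1 =>
    have := exitTotal_two (G := G) hq0 hreg (by omega)
    norm_num at this ⊢
    linarith
  | 2 => exact exitTotal_four (by linarith) hreg (by omega)
  | 3 => exact exitTotal_eight hn hreg (by omega)
  | k + 4 =>
    have h1 : 1 ≤ 2 ^ k := Nat.one_le_two_pow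
    have e : 2 ^ (k + 4) = 2 * (8 * 2 ^ k) := by ring
    rw [e] at hg ⊢
    exact exitTotal_large hn6 hreg (by omega) (by omega)

end SimpleGraph

/-! ### From descents to the strong colouring number -/

namespace SimpleGraph

variable {V : Type*} {G : SimpleGraph V}

/-- Short non-backtracking walks are determined by their ends. -/
lemma NB.eq_of_getLast_eq {v u : V} {A B : List V} (hA : G.NB (v :: A)) (hB : G.NB (v :: B))
    (hg : A.length + B.length + 1 ≤ G.girth) (hAu : (v :: A).getLast? = some u)
    (hBu : (v :: B).getLast? = some u) : A = B := by
  induction A generalizing v B with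
  | nil =>
    cases B with
    | nil => rfl
    | cons b B =>
      have hnd := hB.nodup_of_le_girth (by simpa using hg)
      rw [List.getLast?_cons_cons] at hBu
      simp at hAu
      subst hAu
      exact absurd (List.mem_of_getLast? hBu) (List.nodup_cons.1 hnd).1
  | cons a A ih =>
    cases B with
    | nil =>
      have hnd := hA.nodup_of_le_girth (by simpa using hg)
      rw [List.getLast?_cons_cons] at hAu
      simp at hBu
      subst hBu
      exact absurd (List.mem_of_getLast? hAu) (List.nodup_cons.1 hnd).1
    | cons b B =>
      rw [List.getLast?_cons_cons] at hAu hBu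
      by_cases hab : a = b
      · subst hab
        rw [ih hA.tail hB.tail (by simp at hg; omega) hAu hBu]
      · have hglue : G.NB ((a :: A).reverse ++ v :: b :: B) :=
          nb_glue.2 ⟨hA, hB, by simpa using hab⟩
        have hnd := hglue.nodup_of_le_girth (by simp at hg ⊢; omega)
        rw [List.nodup_append] at hnd
        exact absurd rfl (hnd.2.2 u (List.mem_reverse.2 (List.mem_of_getLast? hAu)) u
          (List.mem_cons_of_mem _ (List.mem_of_getLast? hBu)))

/-- The end of a first descent is strongly reachable. -/
lemma mem_strongReach_of_exitsBelow [L : LinearOrder V] {v u : V} {A : List V} {R : ℕ}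
    (h : G.NB (v :: A)) (hA : ExitsBelow v A) (hR : A.length ≤ R) (hg : R + 1 ≤ G.girth)
    (hu : A.getLast? = some u) : u ∈ G.strongReach L R v := by
  obtain ⟨u', p, hp, hpp⟩ := h.exists_path (egirth_le_of_lt_girth (by omega))
  obtain ⟨M, w, rfl, hM, hw⟩ := hA
  simp at hu
  subst hu
  have hu' : u' = w := by
    have h1 := p.getLast_support
    simp only [hp] at h1
    simpa using h1.symm
  subst hu'
  refine ⟨hw, p, hpp, ?_, fun x hx hxv hxu => ?_⟩
  · have := p.length_support
    rw [hp] at this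
    simp at this hR
    omega
  · rw [hp] at hx
    simp only [List.mem_cons, List.mem_append, List.not_mem_nil, or_false] at hx
    exact hM x (by tauto)

lemma strongReach_mono (L : LinearOrder V) {r r' : ℕ} (h : r ≤ r') (v : V) :
    G.strongReach L r v ⊆ G.strongReach L r' v := by
  rintro u ⟨h1, p, hp, hl, h2⟩
  exact ⟨h1, p, hp, hl.trans h, h2⟩

variable [Fintype V]

lemma sum_ind_eq_card {α : Type*} (s : Finset α) (P : α → Prop) [DecidablePred P] :
    ∑ a ∈ s, ind (P a) = (s.filter P).card := by
  rw [Finset.card_filter]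
  push_cast
  refine Finset.sum_congr rfl fun a _ => ?_
  by_cases h : P a <;> simp [ind, h]

/-- Two different descents with the same start and end would, after their common beginning, glue to
a non-backtracking walk on at most 2 R + 1 vertices that repeats a vertex. -/
lemma sum_descents_le_ncard_strongReach [L : LinearOrder V] (v : V) {R : ℕ}
    (hg : 2 * R + 1 ≤ G.girth) :
    ∑ l ∈ Finset.range R, ∑ A ∈ listsOfLength V (l + 1), ind (G.NB (v :: A) ∧ IsDescent (v :: A)) ≤
      (G.strongReach L R v).ncard := by
  classical
  simp only [sum_ind_eq_card]
  rw [← Nat.cast_sum, Nat.cast_le, ← Finset.card_biUnion]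
  · rw [← Set.ncard_coe_finset]
    refine Set.ncard_le_ncard_of_injOn (fun A => A.getLastD v) ?_ ?_ (Set.toFinite _)
    · intro A hA
      simp only [Finset.coe_biUnion, Finset.coe_range, Set.mem_iUnion, Finset.coe_filter,
        Set.mem_Iio, mem_listsOfLength, Set.mem_ofPred_eq] at hA
      obtain ⟨l, hl, hAl, h1, h2⟩ := hA
      rw [isDescent_cons] at h2
      refine mem_strongReach_of_exitsBelow h1 h2 (by omega) (by omega) ?_
      obtain ⟨M, w, rfl, -⟩ := h2
      simp
    · intro A hA B hB hAB
      simp only [Finset.coe_biUnion, Finset.coe_range, Set.mem_iUnion, Finset.coe_filter,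
        Set.mem_Iio, mem_listsOfLength, Set.mem_ofPred_eq] at hA hB
      obtain ⟨l, hl, hAl, h1, h2⟩ := hA
      obtain ⟨l', hl', hAl', h1', h2'⟩ := hB
      refine h1.eq_of_getLast_eq h1' (u := A.getLastD v) (by omega) ?_ ?_
      · rw [List.getLast?_cons]
        simp [List.getLastD_eq_getLast?]
      · rw [List.getLast?_cons]
        simp only at hAB
        rw [hAB]
        simp [List.getLastD_eq_getLast?]
  · intro l _ l' _ hll
    rw [Function.onFun, Finset.disjoint_left]
    intro A hA hA'
    simp only [Finset.mem_filter, mem_listsOfLength] at hA hA'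
    omega

/-- Multiplied by (n + 1) n ^ (2 ^ k - 1), the quantity `exitTotal` is the average number of
descents per vertex, and some vertex attains at least the average. -/
lemma exists_large_strongReach [Nonempty V] {n : ℕ} (hn : 6 ≤ n)
    (hreg : ∀ v, ∑ a, ind (G.Adj v a) = n + 1) (k : ℕ) (hg : 4 * 2 ^ k ≤ G.girth)
    (L : LinearOrder V) :
    ∃ v, ((n : ℝ) + 1) / 2 * (((n : ℝ) - 1) / 4) ^ (2 ^ k - 1) ≤
      (G.strongReach L (2 ^ k) v).ncard := by
  have h1 := exitTotal_two_pow (G := G) hn hreg k hg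
  have hk : 1 ≤ 2 ^ k := Nat.one_le_two_pow
  obtain ⟨m, hm⟩ := Nat.exists_eq_add_of_le' hk
  rw [hm] at h1 ⊢
  simp only [Nat.add_sub_cancel] at h1 ⊢
  have hn6 : (6 : ℝ) ≤ n := by exact_mod_cast hn
  have hq0 : (0 : ℝ) < n := by linarith
  have hV : (0 : ℝ) < Fintype.card V := by exact_mod_cast Fintype.card_pos
  have h2 : G.exitTotal n (m + 1) = (∑ v, ∑ l ∈ Finset.range (m + 1),
      ∑ A ∈ listsOfLength V (l + 1), ind (G.NB (v :: A) ∧ IsDescent (v :: A))) /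
        (Fintype.card V * (n + 1) * n ^ m) := by
    rw [exitTotal, Finset.sum_range_succ', exitMean_zero, zero_div, add_zero, Finset.sum_comm,
      Finset.sum_div]
    refine Finset.sum_congr rfl fun l hl => ?_
    rw [Finset.mem_range] at hl
    rw [exitMean_succ, descentCount, sum_listsOfLength_succ, div_div, mul_assoc _ _ ((n : ℝ) ^ _),
      ← pow_add]
    congr 4
    omega
  rw [h2, le_div_iff₀ (by positivity)] at h1
  by_contra! hlt
  have h3 : ∑ v, ∑ l ∈ Finset.range (m + 1),
      ∑ A ∈ listsOfLength V (l + 1), ind (G.NB (v :: A) ∧ IsDescent (v :: A)) <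
      ∑ _v : V, ((n : ℝ) + 1) / 2 * (((n : ℝ) - 1) / 4) ^ m :=
    Finset.sum_lt_sum_of_nonempty Finset.univ_nonempty fun v _ =>
      (sum_descents_le_ncard_strongReach v (by omega)).trans_lt (hlt v)
  rw [Finset.sum_const, Finset.card_univ, nsmul_eq_mul] at h3
  have h4 : (((n : ℝ) - 1) / n / 4) ^ m / 2 * (Fintype.card V * (n + 1) * n ^ m) =
      Fintype.card V * (((n : ℝ) + 1) / 2 * (((n : ℝ) - 1) / 4) ^ m) := by
    have : ((n : ℝ) - 1) / n / 4 = ((n : ℝ) - 1) / 4 / n := by ring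
    rw [this, div_pow _ (n : ℝ)]
    field_simp
  rw [h4] at h1
  linarith

/-- A lower bound valid for every order is a lower bound for the strong colouring number. -/
lemma le_strongColoringNumber {c : ℝ} {r : ℕ}
    (h : ∀ L : LinearOrder V, ∃ v, c ≤ (G.strongReach L r v).ncard) :
    c ≤ G.strongColoringNumber r := by
  have : Nonempty (LinearOrder V) :=
    ⟨LinearOrder.lift' (Fintype.equivFin V) (Fintype.equivFin V).injective⟩
  -- An infimum of a nonempty set of natural numbers is attained, so some order realises the strong
  -- colouring number.
  obtain ⟨L, hL⟩ := Set.mem_range.1 (Nat.sInf_mem (Set.range_nonempty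
    fun L : LinearOrder V => Finset.univ.sup fun v => (G.strongReach L r v).ncard))
  obtain ⟨v, hv⟩ := h L
  refine hv.trans ?_
  rw [strongColoringNumber, iInf, ← hL, Nat.cast_le]
  exact Finset.le_sup (f := fun v => (G.strongReach L r v).ncard) (Finset.mem_univ v)

theorem strongColoringNumber_ge [Nonempty V] [DecidableRel G.Adj] {Δ r : ℕ} (hΔ : 7 ≤ Δ)
    (hr : 1 ≤ r) (hreg : G.IsRegularOfDegree Δ) (hg : 4 * r ≤ G.girth) :
    (Δ : ℝ) / 2 * (((Δ : ℝ) - 2) / 4) ^ (2 ^ Nat.log 2 r - 1) ≤ G.strongColoringNumber r := by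
  have h2 : 2 ^ Nat.log 2 r ≤ r := Nat.pow_log_le_self 2 (by omega)
  obtain ⟨n, rfl⟩ := Nat.exists_eq_add_of_le' (show 1 ≤ Δ by omega)
  have hreg' : ∀ v, ∑ a, ind (G.Adj v a) = n + 1 := by
    intro v
    rw [sum_ind_eq_card, ← neighborFinset_eq_filter, card_neighborFinset_eq_degree, hreg v]
    push_cast
    rfl
  refine le_strongColoringNumber fun L => ?_
  obtain ⟨v, hv⟩ := exists_large_strongReach (by omega) hreg' (Nat.log 2 r) (by omega) L
  refine ⟨v, ?_⟩
  have h3 : (G.strongReach L (2 ^ Nat.log 2 r) v).ncard ≤ (G.strongReach L r v).ncard :=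
    Set.ncard_le_ncard (strongReach_mono L h2 v) (Set.toFinite _)
  have h4 : ((G.strongReach L (2 ^ Nat.log 2 r) v).ncard : ℝ) ≤ (G.strongReach L r v).ncard := by
    exact_mod_cast h3
  refine le_trans (le_of_eq ?_) (hv.trans h4)
  push_cast
  ring_nf

end SimpleGraph

/-! ### Iterated 2-lifts and the doubling of the girth -/

namespace SimpleGraph

section Closed

variable {V W : Type*} {H : SimpleGraph V} {H' : SimpleGraph W}

lemma Walk.IsPath.nb_support {x y : W} {p : H'.Walk x y} (hp : p.IsPath) : H'.NB p.support := by
  induction p with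
  | nil => simp
  | cons h p ih =>
    rw [Walk.cons_isPath_iff] at hp
    have h1 := ih hp.1
    rw [Walk.support_cons]
    rw [← Walk.cons_tail_support] at h1 ⊢
    refine ⟨h, fun c hc => ?_, h1⟩
    rintro rfl
    refine hp.2 ?_
    rw [← Walk.cons_tail_support]
    exact List.mem_cons_of_mem _ (List.mem_of_mem_head? hc)

lemma Walk.IsCycle.nb_support {x : W} {p : H'.Walk x x} (hp : p.IsCycle) : H'.NB p.support := by
  cases p with
  | nil => simp
  | cons h p =>
    rw [Walk.cons_isCycle_iff] at hp
    obtain ⟨hp1, hp2⟩ := hp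
    have h1 := hp1.nb_support
    cases p with
    | nil => exact absurd h (H'.loopless.irrefl _)
    | cons h' p =>
      rw [Walk.support_cons, Walk.support_cons] at *
      rw [← Walk.cons_tail_support p] at *
      refine ⟨h, fun c hc => ?_, h1⟩
      simp only [List.head?_cons, Option.mem_some_iff] at hc
      subst hc
      rintro rfl
      apply hp2
      rw [Walk.edges_cons, Sym2.eq_swap]
      simp

/-- A locally injective map sends non-backtracking walks to non-backtracking walks. -/
lemma nb_map_support {F : SimpleGraph V} (π : W → V)
    (hπ : ∀ y x z, H'.Adj y x → H'.Adj y z → π x = π z → x = z) {x y : W} (p : H'.Walk x y)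
    (hF : ∀ e ∈ p.edges, e.map π ∈ F.edgeSet) (hp : H'.NB p.support) :
    F.NB (p.support.map π) := by
  induction p with
  | nil => simp
  | @cons u v w h p ih =>
    have h1 := ih (fun e he => hF e (by simp [he])) hp.tail
    have h2 : F.Adj (π u) (π v) := by
      have := hF s(u, v) (by rw [Walk.edges_cons]; exact List.mem_cons_self)
      rwa [Sym2.map_mk, mem_edgeSet] at this
    cases p with
    | nil => exact ⟨h2, by simp, trivial⟩
    | cons h' p =>
      rw [Walk.support_cons, Walk.support_cons, ← Walk.cons_tail_support p] at *
      refine ⟨h2, ?_, h1⟩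
      intro c hc
      simp only [List.map_cons, List.head?_cons, Option.mem_some_iff] at hc
      subst hc
      intro h3
      exact (nb_cons_cons_cons.1 hp).2.1 (hπ _ _ _ h' h.symm h3)

/-- If closed walks traverse every edge an even number of times after projection, then the girth
doubles. -/
lemma two_mul_girth_le_length [DecidableEq V] (π : H' →g H)
    (hπ : ∀ y x z, H'.Adj y x → H'.Adj y z → π x = π z → x = z) {x : W} {p : H'.Walk x x}
    (hp : p.IsCycle) (heven : ∀ e, Even ((p.edges.map (Sym2.map π)).count e)) :
    2 * H.girth ≤ p.length := by
  set E := p.edges.map (Sym2.map π) with hE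
  have hEH : ∀ e ∈ E, e ∈ H.edgeSet := by
    intro e he
    obtain ⟨f, hf, rfl⟩ := List.mem_map.1 he
    have := p.edges_subset_edgeSet hf
    induction f with | _ a b => exact π.map_adj this
  -- The subgraph formed by the edges that the projected cycle traverses.
  set F : SimpleGraph V := fromEdgeSet {e | e ∈ E} with hF
  have hFE : ∀ e, e ∈ F.edgeSet ↔ e ∈ E := by
    intro e
    rw [hF, edgeSet_fromEdgeSet]
    constructor
    · exact fun h => h.1
    · exact fun h => ⟨h, fun h' => H.not_isDiag_of_mem_edgeSet (hEH e h) h'⟩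
  have hFH : F ≤ H := by
    rw [← edgeSet_subset_edgeSet]
    exact fun e he => hEH e ((hFE e).1 he)
  have hnb := nb_map_support (F := F) π hπ p (fun e he => by
    rw [hFE]
    exact List.mem_map_of_mem he) hp.nb_support
  have hnd : ¬ (p.support.map π).Nodup := by
    intro h
    have h1 : p.support.Nodup := List.Nodup.of_map _ h
    have h2 : p.IsPath := (Walk.isPath_def p).2 h1
    exact hp.not_nil (Walk.isPath_iff_nil.1 h2)
  -- In an acyclic graph every non-backtracking walk visits distinct vertices, whereas the projected
  -- walk is closed.
  have hcyc : ¬ F.IsAcyclic := by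
    intro h
    exact hnd (hnb.nodup (by rw [egirth_eq_top.2 h]; exact le_top))
  unfold IsAcyclic at hcyc
  push Not at hcyc
  obtain ⟨v, C, hC⟩ := hcyc
  have h1 : H.girth ≤ C.length := by
    have := (hC.mapLe hFH).girth_le_length
    simpa using this
  have h2 : 2 * C.length ≤ p.length := by
    have h3 : ∑ e ∈ C.edges.toFinset, 2 ≤ ∑ e ∈ C.edges.toFinset, E.count e := by
      refine Finset.sum_le_sum fun e he => ?_
      have h4 : e ∈ E := (hFE e).1 (C.edges_subset_edgeSet (List.mem_toFinset.1 he))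
      have h5 := List.count_pos_iff.2 h4
      obtain ⟨k, hk⟩ := heven e
      omega
    rw [Finset.sum_const, List.toFinset_card_of_nodup hC.edges_nodup, Walk.length_edges] at h3
    have h4 : ∑ e ∈ C.edges.toFinset, E.count e ≤ ∑ e ∈ E.toFinset, E.count e := by
      refine Finset.sum_le_sum_of_subset ?_
      intro e he
      rw [List.mem_toFinset] at he ⊢
      exact (hFE e).1 (C.edges_subset_edgeSet he)
    have h5 : E.length = p.length := by rw [hE, List.length_map, Walk.length_edges]
    rw [List.sum_toFinset_count_eq_length, h5] at h4
    rw [smul_eq_mul] at h3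
    omega
  omega

end Closed

section TwoLift

variable {V : Type} {G : SimpleGraph V}

lemma twoLift_adj {σ : Sym2 V → Bool} {x y : V × Bool} :
    (G.twoLift σ).Adj x y ↔ G.Adj x.1 y.1 ∧ y.2 = (x.2 ^^ σ s(x.1, y.1)) := Iff.rfl

/-- The projection of a `2`-lift. -/
def twoLiftHom (G : SimpleGraph V) (σ : Sym2 V → Bool) : G.twoLift σ →g G where
  toFun := Prod.fst
  map_rel' h := h.1

@[simp] lemma twoLiftHom_apply (σ : Sym2 V → Bool) (x : V × Bool) :
    G.twoLiftHom σ x = x.1 := rfl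

/-- The second coordinate flips at each crossing edge, so along a walk it records their number
modulo 2. In particular a closed walk uses an even number of them. -/
lemma twoLift_snd_eq {σ : Sym2 V → Bool} {x y : V × Bool} (p : (G.twoLift σ).Walk x y) :
    y.2 = (x.2 ^^ decide (Odd ((p.edges.map (Sym2.map Prod.fst)).countP (fun e => σ e)))) := by
  induction p with
  | nil => simp
  | @cons x z y h p ih =>
    rw [ih, h.2, Walk.edges_cons, List.map_cons, List.countP_cons]
    have e : Sym2.map Prod.fst s(x, z) = s(x.1, z.1) := rfl
    rw [e]
    generalize List.countP _ _ = n
    by_cases hn : Odd n <;> cases σ s(x.1, z.1) <;> cases x.2 <;> simp [hn, Nat.odd_add_one]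

lemma even_countP_of_closed {σ : Sym2 V → Bool} {x : V × Bool} (p : (G.twoLift σ).Walk x x) :
    Even ((p.edges.map (Sym2.map Prod.fst)).countP (fun e => σ e)) := by
  have h := twoLift_snd_eq p
  rw [← Nat.not_odd_iff_even]
  intro hodd
  rw [decide_eq_true hodd] at h
  revert h
  cases x.2 <;> simp

lemma neighborSet_twoLift (σ : Sym2 V → Bool) (x : V × Bool) :
    (G.twoLift σ).neighborSet x = (fun v => (v, x.2 ^^ σ s(x.1, v))) '' G.neighborSet x.1 := by
  ext ⟨v, b⟩
  simp only [mem_neighborSet, twoLift_adj, Set.mem_image, Prod.mk.injEq]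
  constructor
  · rintro ⟨h1, h2⟩
    exact ⟨v, h1, rfl, h2.symm⟩
  · rintro ⟨v', h1, rfl, h2⟩
    exact ⟨h1, h2.symm⟩

lemma ncard_neighborSet_twoLift (σ : Sym2 V → Bool) (x : V × Bool) :
    ((G.twoLift σ).neighborSet x).ncard = (G.neighborSet x.1).ncard := by
  rw [neighborSet_twoLift, Set.ncard_image_of_injective]
  intro v v' h
  exact congrArg Prod.fst h

lemma Iso.ncard_neighborSet {W W' : Type*} {H : SimpleGraph W} {H' : SimpleGraph W'}
    (e : H' ≃g H) (x : W') : (H'.neighborSet x).ncard = (H.neighborSet (e x)).ncard := by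
  rw [← Set.ncard_image_of_injective _ e.injective]
  congr 1
  ext y
  simp only [Set.mem_image, mem_neighborSet]
  constructor
  · rintro ⟨z, h, rfl⟩
    exact e.map_adj_iff.2 h
  · intro h
    exact ⟨e.symm y, by rw [← e.map_adj_iff]; simpa using h, by simp⟩

lemma IsIteratedTwoLift.finite [Finite V] {W : Type} {H : SimpleGraph W}
    (h : G.IsIteratedTwoLift H) : Finite W := by
  induction h with
  | refl => infer_instance
  | lift σ _ e ih =>
    obtain ⟨e⟩ := e
    exact Finite.of_equiv _ e.toEquiv.symm

lemma IsIteratedTwoLift.nonempty [Nonempty V] {W : Type} {H : SimpleGraph W}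
    (h : G.IsIteratedTwoLift H) : Nonempty W := by
  induction h with
  | refl => infer_instance
  | lift σ _ e ih =>
    obtain ⟨e⟩ := e
    exact ⟨e.symm (Classical.arbitrary _, true)⟩

lemma IsIteratedTwoLift.ncard_neighborSet {d : ℕ} (hG : ∀ v, (G.neighborSet v).ncard = d)
    {W : Type} {H : SimpleGraph W} (h : G.IsIteratedTwoLift H) (w : W) :
    (H.neighborSet w).ncard = d := by
  induction h with
  | refl => exact hG w
  | lift σ _ e ih =>
    obtain ⟨e⟩ := e
    rw [e.ncard_neighborSet, ncard_neighborSet_twoLift, ih]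

lemma IsIteratedTwoLift.trans {W W' : Type} {H : SimpleGraph W} {H' : SimpleGraph W'}
    (h : G.IsIteratedTwoLift H) (h' : H.IsIteratedTwoLift H') : G.IsIteratedTwoLift H' := by
  induction h' with
  | refl => exact h
  | lift σ _ e ih => exact .lift σ ih e

lemma IsGirthDoublingTower.isIteratedTwoLift {W : Type} {H : SimpleGraph W}
    (h : G.IsGirthDoublingTower H) : G.IsIteratedTwoLift H := by
  induction h with
  | refl => exact .refl
  | step _ h' _ ih => exact ih.trans h'

/-- There is an iterated `2`-lift in which every closed walk traverses every edge of `S` an even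
number of times. -/
lemma exists_isIteratedTwoLift_even [DecidableEq V] (G : SimpleGraph V) (S : Finset (Sym2 V)) :
    ∃ (W : Type) (H : SimpleGraph W) (π : H →g G), G.IsIteratedTwoLift H ∧
      (∀ y x z, H.Adj y x → H.Adj y z → π x = π z → x = z) ∧
      ∀ (x : W) (p : H.Walk x x), ∀ e ∈ S, Even ((p.edges.map (Sym2.map π)).count e) := by
  induction S using Finset.induction_on with
  | empty => exact ⟨V, G, Hom.id, .refl, fun _ _ _ _ _ h => h, by simp⟩
  | insert e S _ ih =>
    obtain ⟨W, H, π, hH, hπ, heven⟩ := ih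
    -- Exactly the edges lying over `e` are crossed, so their number on a closed walk becomes even.
    -- Edges treated earlier stay even because a closed walk of the lift projects to a closed walk
    -- of `H`.
    set σ : Sym2 W → Bool := fun f => decide (f.map π = e) with hσ
    refine ⟨W × Bool, H.twoLift σ, π.comp (H.twoLiftHom σ), .lift σ hH ⟨Iso.refl⟩, ?_, ?_⟩
    · intro y x z h1 h2 h3
      have h4 : x.1 = z.1 := hπ _ _ _ h1.1 h2.1 h3
      refine Prod.ext h4 ?_
      rw [h1.2, h2.2, h4]
    · intro x p f hf
      have e1 : p.edges.map (Sym2.map (π.comp (H.twoLiftHom σ))) =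
          (p.edges.map (Sym2.map Prod.fst)).map (Sym2.map π) := by
        rw [List.map_map]
        refine List.map_congr_left fun g _ => ?_
        rw [Function.comp_apply, Sym2.map_map]
        rfl
      rw [e1]
      rcases Finset.mem_insert.1 hf with rfl | hf
      · have := even_countP_of_closed p
        rw [List.count, List.countP_map]
        convert this using 2
        funext g
        simp [hσ, beq_eq_decide]
      · have := heven _ (p.map (H.twoLiftHom σ)) f hf
        rw [Walk.edges_map] at this
        exact this

/-- A graph with all degrees at least two is not acyclic. -/
lemma girth_ne_zero_of_regular [Finite V] [Nonempty V] {d : ℕ} (hd : 2 ≤ d)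
    (hG : ∀ v, (G.neighborSet v).ncard = d) : G.girth ≠ 0 := by
  classical
  have := Fintype.ofFinite V
  intro h0
  rw [girth_eq_zero] at h0
  have hreg : ∀ v, ∑ a, ind (G.Adj v a) = ((d : ℝ) - 1) + 1 := by
    intro v
    rw [sum_ind_eq_card, sub_add_cancel, ← hG v, ← Set.ncard_coe_finset]
    congr 2
    ext
    simp
  obtain ⟨v⟩ := ‹Nonempty V›
  have hv : (G.neighborSet v).Nonempty := by
    rw [Set.nonempty_iff_ne_empty]
    intro h
    have := hG v
    rw [h, Set.ncard_empty] at this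
    omega
  obtain ⟨a, ha⟩ := hv
  -- Minimum degree two lets non-backtracking walks be continued beyond `Fintype.card V` vertices,
  -- which is impossible for walks without repetition.
  have h1 := dartCount_true hreg (Fintype.card V) v a
  rw [ind_of (show G.Adj v a from ha), one_mul] at h1
  have hd' : (2 : ℝ) ≤ d := by exact_mod_cast hd
  have h2 : (0 : ℝ) < (d - 1) ^ Fintype.card V := by
    have : (0 : ℝ) < d - 1 := by linarith
    positivity
  rw [← h1, dartCount] at h2
  obtain ⟨A, hA, hpos⟩ := Finset.exists_ne_zero_of_sum_ne_zero h2.ne'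
  rw [mem_listsOfLength] at hA
  have hNB : G.NB (v :: a :: A) := by
    by_contra h
    exact hpos (ind_of_not fun h' => h h'.1)
  have hnd := hNB.nodup (by rw [egirth_eq_top.2 h0]; exact le_top)
  have := hnd.length_le_card
  simp at this
  omega

/-- All edges are made even at once. Regularity passes to the lift, so it contains a cycle and its
girth is the length of one. -/
lemma exists_girth_doubling [Finite V] [Nonempty V] {d : ℕ} (hd : 2 ≤ d)
    (hG : ∀ v, (G.neighborSet v).ncard = d) :
    ∃ (W : Type) (H : SimpleGraph W), G.IsIteratedTwoLift H ∧ 2 * G.girth ≤ H.girth := by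
  classical
  have := Fintype.ofFinite V
  obtain ⟨W, H, π, hH, hπ, heven⟩ := exists_isIteratedTwoLift_even G Finset.univ
  refine ⟨W, H, hH, ?_⟩
  have := hH.finite
  have := hH.nonempty
  have h1 := girth_ne_zero_of_regular hd (hH.ncard_neighborSet hG)
  rw [Ne, girth_eq_zero] at h1
  obtain ⟨x, p, hp, hlen⟩ := exists_girth_eq_length.2 h1
  rw [hlen]
  exact two_mul_girth_le_length π hπ hp fun e => heven x p e (Finset.mem_univ e)

lemma exists_tower (d : ℕ) (hd : 2 ≤ d) (N : ℕ) :
    ∃ (W : Type) (H : SimpleGraph W), (⊤ : SimpleGraph (Fin (d + 1))).IsGirthDoublingTower H ∧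
      N ≤ H.girth := by
  have hK : ∀ v, ((⊤ : SimpleGraph (Fin (d + 1))).neighborSet v).ncard = d := by
    intro v
    rw [neighborSet_top, Set.ncard_compl, Set.ncard_singleton, Nat.card_eq_fintype_card,
      Fintype.card_fin]
    omega
  have key : ∀ k, ∃ (W : Type) (H : SimpleGraph W),
      (⊤ : SimpleGraph (Fin (d + 1))).IsGirthDoublingTower H ∧ k + 1 ≤ H.girth := by
    intro k
    induction k with
    | zero =>
      refine ⟨_, _, .refl, ?_⟩
      have := girth_ne_zero_of_regular hd hK
      omega
    | succ k ih =>
      obtain ⟨W, H, hH, hk⟩ := ih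
      have hlift := hH.isIteratedTwoLift
      have := hlift.finite
      have := hlift.nonempty
      obtain ⟨W', H', hH', hg⟩ := exists_girth_doubling hd (hlift.ncard_neighborSet hK)
      exact ⟨W', H', .step hH hH' hg, by omega⟩
  obtain ⟨W, H, h1, h2⟩ := key N
  exact ⟨W, H, h1, by omega⟩

end TwoLift

end SimpleGraph

/-! ### Trigraphs defined by partitions of the vertex set -/

namespace Trigraph

variable {V : Type*} [Fintype V] [DecidableEq V]

/-- The trigraph of a graph and a partition: two parts are joined by a black edge if all pairs are
adjacent, and by a red edge if some but not all pairs are adjacent. -/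
def ofPartition (G : SimpleGraph V) (P : Finpartition (Finset.univ : Finset V)) : Trigraph V where
  nodes := P
  black :=
    { Adj := fun X Y => X ∈ P.parts ∧ Y ∈ P.parts ∧ X ≠ Y ∧ ∀ x ∈ X, ∀ y ∈ Y, G.Adj x y
      symm := ⟨fun _ _ h => ⟨h.2.1, h.1, h.2.2.1.symm, fun y hy x hx => (h.2.2.2 x hx y hy).symm⟩⟩
      loopless := ⟨fun _ h => h.2.2.1 rfl⟩ }
  red :=
    { Adj := fun X Y => X ∈ P.parts ∧ Y ∈ P.parts ∧ X ≠ Y ∧ (∃ x ∈ X, ∃ y ∈ Y, G.Adj x y) ∧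
        ¬ ∀ x ∈ X, ∀ y ∈ Y, G.Adj x y
      symm := ⟨fun _ _ h => ⟨h.2.1, h.1, h.2.2.1.symm, by
        obtain ⟨x, hx, y, hy, hxy⟩ := h.2.2.2.1
        exact ⟨y, hy, x, hx, hxy.symm⟩,
        fun h' => h.2.2.2.2 fun x hx y hy => (h' y hy x hx).symm⟩⟩
      loopless := ⟨fun _ h => h.2.2.1 rfl⟩ }
  black_mem := fun _ _ h => h.1
  red_mem := fun _ _ h => h.1
  exclusive := fun _ _ h h' => h'.2.2.2.2 h.2.2.2

variable {G : SimpleGraph V} {P : Finpartition (Finset.univ : Finset V)}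

lemma ofPartition_black_adj {X Y : Finset V} : (ofPartition G P).black.Adj X Y ↔
    X ∈ P.parts ∧ Y ∈ P.parts ∧ X ≠ Y ∧ ∀ x ∈ X, ∀ y ∈ Y, G.Adj x y := Iff.rfl

lemma ofPartition_red_adj {X Y : Finset V} : (ofPartition G P).red.Adj X Y ↔
    X ∈ P.parts ∧ Y ∈ P.parts ∧ X ≠ Y ∧ (∃ x ∈ X, ∃ y ∈ Y, G.Adj x y) ∧
      ¬ ∀ x ∈ X, ∀ y ∈ Y, G.Adj x y := Iff.rfl

lemma mem_neighbors_ofPartition {X Y : Finset V} : Y ∈ (ofPartition G P).neighbors X ↔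
    X ∈ P.parts ∧ Y ∈ P.parts ∧ X ≠ Y ∧ ∃ x ∈ X, ∃ y ∈ Y, G.Adj x y := by
  constructor
  · rintro (h | h)
    · obtain ⟨x, hx⟩ := P.nonempty_of_mem_parts h.1
      obtain ⟨y, hy⟩ := P.nonempty_of_mem_parts h.2.1
      exact ⟨h.1, h.2.1, h.2.2.1, x, hx, y, hy, h.2.2.2 x hx y hy⟩
    · exact ⟨h.1, h.2.1, h.2.2.1, h.2.2.2.1⟩
  · rintro ⟨h1, h2, h3, h4⟩
    by_cases h : ∀ x ∈ X, ∀ y ∈ Y, G.Adj x y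
    · exact Or.inl ⟨h1, h2, h3, h⟩
    · exact Or.inr ⟨h1, h2, h3, h4, h⟩

lemma ofPartition_bot : ofPartition G ⊥ = ofGraph G := by
  have hb : (ofPartition G ⊥).black = (ofGraph G).black := by
    ext X Y
    simp only [ofPartition_black_adj, ofGraph, Finpartition.mem_bot_iff, Finset.mem_univ,
      true_and]
    constructor
    · rintro ⟨⟨x, rfl⟩, ⟨y, rfl⟩, hne, h⟩
      exact ⟨hne, x, y, h x (by simp) y (by simp), rfl, rfl⟩
    · rintro ⟨-, x, y, h, rfl, rfl⟩
      refine ⟨⟨x, rfl⟩, ⟨y, rfl⟩, by simpa using h.ne, by simpa using h⟩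
  have hr : (ofPartition G ⊥).red = (ofGraph G).red := by
    ext X Y
    simp only [ofPartition_red_adj, ofGraph, SimpleGraph.bot_adj, Finpartition.mem_bot_iff,
      Finset.mem_univ, true_and, iff_false]
    rintro ⟨⟨x, rfl⟩, ⟨y, rfl⟩, -, h, h'⟩
    simp at h h'
    exact h' h
  have hn : (ofPartition G ⊥).nodes = (ofGraph G).nodes := rfl
  generalize ofPartition G ⊥ = T at *
  generalize ofGraph G = T' at *
  cases T
  cases T'
  simp only at hb hr hn
  subst hb hr hn
  rfl

lemma union_notMem_parts {X Y : Finset V} (hX : X ∈ P.parts) (hY : Y ∈ P.parts) (hXY : X ≠ Y) :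
    X ∪ Y ∉ P.parts := by
  intro h
  by_cases h1 : X = X ∪ Y
  · have h2 : Disjoint X Y := P.disjoint hX hY hXY
    obtain ⟨y, hy⟩ := P.nonempty_of_mem_parts hY
    exact Finset.disjoint_left.1 h2 (h1 ▸ Finset.mem_union_right X hy) hy
  · have h2 : Disjoint X (X ∪ Y) := P.disjoint hX h h1
    obtain ⟨x, hx⟩ := P.nonempty_of_mem_parts hX
    exact Finset.disjoint_left.1 h2 hx (Finset.mem_union_left Y hx)

/-- A union touches a class if one of its parts does, and is fully joined to it if both parts are.
These are precisely the contraction rules, so the trigraph of a partition never has to be tracked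
separately. -/
lemma isContraction_ofPartition {P' : Finpartition (Finset.univ : Finset V)} {X Y : Finset V}
    (hX : X ∈ P.parts) (hY : Y ∈ P.parts) (hXY : X ≠ Y)
    (hP' : P'.parts = insert (X ∪ Y) (P.parts \ {X, Y})) :
    (ofPartition G P).IsContraction (ofPartition G P') X Y := by
  have hU : X ∪ Y ∈ P'.parts := by rw [hP']; exact Finset.mem_insert_self _ _
  have hnot := union_notMem_parts hX hY hXY
  have hmem : ∀ Z, Z ∈ P.parts → Z ≠ X → Z ≠ Y → Z ∈ P'.parts ∧ X ∪ Y ≠ Z := by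
    intro Z hZ h1 h2
    refine ⟨by rw [hP']; simp [hZ, h1, h2], ?_⟩
    rintro rfl
    exact hnot hZ
  have hmem' : ∀ Z, Z ∈ P'.parts → X ∪ Y ≠ Z → Z ∈ P.parts ∧ Z ≠ X ∧ Z ≠ Y := by
    intro Z hZ h
    rw [hP'] at hZ
    simp only [Finset.mem_insert, Finset.mem_sdiff, Finset.mem_singleton, not_or] at hZ
    rcases hZ with rfl | hZ
    · exact absurd rfl h
    · exact hZ
  refine ⟨hX, hY, hXY, hP', ?_, ?_, ?_, ?_⟩
  · ext Z
    simp only [Set.mem_sdiff, Set.mem_union, mem_neighbors_ofPartition, Set.mem_insert_iff,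
      Set.mem_singleton_iff, not_or]
    constructor
    · rintro ⟨-, hZ, hne, x, hx, y, hy, hxy⟩
      obtain ⟨hZ', h1, h2⟩ := hmem' Z hZ hne
      refine ⟨?_, h1, h2⟩
      rcases Finset.mem_union.1 hx with hx | hx
      · exact Or.inl ⟨hX, hZ', h1.symm, x, hx, y, hy, hxy⟩
      · exact Or.inr ⟨hY, hZ', h2.symm, x, hx, y, hy, hxy⟩
    · rintro ⟨h, h1, h2⟩
      have hZ : Z ∈ P.parts := by
        rcases h with h | h
        · exact h.2.1
        · exact h.2.1
      refine ⟨hU, (hmem Z hZ h1 h2).1, (hmem Z hZ h1 h2).2, ?_⟩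
      rcases h with ⟨-, -, -, x, hx, h⟩ | ⟨-, -, -, x, hx, h⟩
      · exact ⟨x, Finset.mem_union_left _ hx, h⟩
      · exact ⟨x, Finset.mem_union_right _ hx, h⟩
  · ext Z
    simp only [SimpleGraph.mem_neighborSet, ofPartition_black_adj, Set.mem_inter_iff]
    constructor
    · rintro ⟨-, hZ, hne, h⟩
      obtain ⟨hZ', h1, h2⟩ := hmem' Z hZ hne
      exact ⟨⟨hX, hZ', h1.symm, fun x hx => h x (Finset.mem_union_left _ hx)⟩,
        ⟨hY, hZ', h2.symm, fun x hx => h x (Finset.mem_union_right _ hx)⟩⟩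
    · rintro ⟨⟨-, hZ, h1, h⟩, ⟨-, -, h2, h'⟩⟩
      obtain ⟨hZ', h3⟩ := hmem Z hZ h1.symm h2.symm
      refine ⟨hU, hZ', h3, fun x hx => ?_⟩
      rcases Finset.mem_union.1 hx with hx | hx
      · exact h x hx
      · exact h' x hx
  · intro Z hZ W hW
    simp only [Finset.mem_sdiff, Finset.mem_insert, Finset.mem_singleton, not_or] at hZ hW
    have hZP : Z ∈ P.parts := hZ.1
    have hWP : W ∈ P.parts := hW.1
    rw [ofPartition_black_adj, ofPartition_black_adj]
    simp [hZP, hWP, (hmem Z hZ.1 hZ.2.1 hZ.2.2).1, (hmem W hW.1 hW.2.1 hW.2.2).1]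
  · intro Z hZ W hW
    simp only [Finset.mem_sdiff, Finset.mem_insert, Finset.mem_singleton, not_or] at hZ hW
    have hZP : Z ∈ P.parts := hZ.1
    have hWP : W ∈ P.parts := hW.1
    rw [ofPartition_red_adj, ofPartition_red_adj]
    simp [hZP, hWP, (hmem Z hZ.1 hZ.2.1 hZ.2.2).1, (hmem W hW.1 hW.2.1 hW.2.2).1]

end Trigraph

/-! ### The upper bound for twin-width: merging fibres of the lifts -/

namespace SimpleGraph

/-- The colours, other than that of `x`, of the neighbours of the colour class of `x`. -/
def colorNeighbors {V : Type*} (G : SimpleGraph V) (f : V → V) (x : V) : Set V :=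
  {c | ∃ x' y, f x' = f x ∧ G.Adj x' y ∧ f y ≠ f x ∧ f y = c}

/-- The colouring `f` can be made constant by merging two colours at a time, where every class
always sees at most `d` other classes. -/
inductive Collapsible {V : Type*} (G : SimpleGraph V) (d : ℕ) : (V → V) → Prop
  | const (f : V → V) (h : ∀ x y, f x = f y) : Collapsible G d f
  | merge (f f' : V → V) (a b : V) (hab : f a ≠ f b)
      (hb : ∀ v, f v = f b → f' v = f a) (hf : ∀ v, f v ≠ f b → f' v = f v)
      (hd : ∀ x, (G.colorNeighbors f x).ncard ≤ d) (h' : Collapsible G d f') : Collapsible G d f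

section Sequence

variable {V : Type*} [Fintype V] [DecidableEq V] {G : SimpleGraph V}

/-- The partition into colour classes. -/
def colorPartition (f : V → V) : Finpartition (Finset.univ : Finset V) where
  parts := Finset.univ.image fun v => Finset.univ.filter fun w => f w = f v
  supIndep := by
    rw [Finset.supIndep_iff_pairwiseDisjoint]
    intro X hX Y hY hXY
    simp only [Finset.coe_image, Set.mem_image, Finset.coe_univ, Set.mem_univ, true_and] at hX hY
    obtain ⟨x, rfl⟩ := hX
    obtain ⟨y, rfl⟩ := hY
    rw [Function.onFun, id, id, Finset.disjoint_left]
    intro z hz hz'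
    simp only [Finset.mem_filter, Finset.mem_univ, true_and] at hz hz'
    exact hXY (by rw [← hz, ← hz'])
  sup_parts := by
    rw [Finset.eq_univ_iff_forall]
    intro x
    rw [Finset.mem_sup]
    exact ⟨_, Finset.mem_image_of_mem _ (Finset.mem_univ x), by simp⟩
  bot_notMem := by
    simp only [Finset.bot_eq_empty, Finset.mem_image, Finset.mem_univ, true_and, not_exists]
    intro x h
    have : x ∈ Finset.univ.filter fun w => f w = f x := by simp
    rw [h] at this
    simp at this

lemma mem_colorPartition {f : V → V} {X : Finset V} :
    X ∈ (colorPartition f).parts ↔ ∃ v, (Finset.univ.filter fun w => f w = f v) = X := by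
  simp [colorPartition]

lemma colorPartition_id : colorPartition (id : V → V) = ⊥ := by
  ext X
  rw [mem_colorPartition, Finpartition.mem_bot_iff]
  simp only [id, Finset.mem_univ, true_and]
  refine exists_congr fun v => ?_
  rw [Finset.filter_eq']
  simp

lemma redDegreeLE_colorPartition {f : V → V} {d : ℕ}
    (hd : ∀ x, (G.colorNeighbors f x).ncard ≤ d) :
    (Trigraph.ofPartition G (colorPartition f)).RedDegreeLE d := by
  intro X hX
  obtain ⟨x, rfl⟩ := mem_colorPartition.1 hX
  refine le_trans ?_ (hd x)
  refine (Set.ncard_le_ncard ?_ (Set.toFinite _)).trans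
    (Set.ncard_image_le (f := fun c => Finset.univ.filter fun w => f w = c) (Set.toFinite _))
  intro Y hY
  rw [mem_neighborSet, Trigraph.ofPartition_red_adj] at hY
  obtain ⟨-, hY, hne, ⟨u, hu, w, hw, huw⟩, -⟩ := hY
  obtain ⟨y, rfl⟩ := mem_colorPartition.1 hY
  simp only [Finset.mem_filter, Finset.mem_univ, true_and] at hu hw
  refine ⟨f y, ⟨u, w, hu, huw, ?_, hw⟩, rfl⟩
  intro h
  exact hne (by rw [← hw, h])

lemma card_colorPartition (f : V → V) :
    (colorPartition f).parts.card = (Finset.univ.image f).card := by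
  have : (colorPartition f).parts =
      (Finset.univ.image f).image fun c => Finset.univ.filter fun w => f w = c := by
    rw [Finset.image_image]
    rfl
  rw [this, Finset.card_image_of_injOn]
  intro c hc c' hc' h
  simp only [Finset.coe_image, Finset.coe_univ, Set.image_univ, Set.mem_range] at hc
  obtain ⟨x, rfl⟩ := hc
  have : x ∈ Finset.univ.filter fun w => f w = f x := by simp
  simp only at h
  rw [h] at this
  simpa using this

lemma colorPartition_merge {f f' : V → V} {a b : V} (hab : f a ≠ f b)
    (hb : ∀ v, f v = f b → f' v = f a) (hf : ∀ v, f v ≠ f b → f' v = f v) :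
    (colorPartition f').parts =
      insert ((Finset.univ.filter fun w => f w = f a) ∪ (Finset.univ.filter fun w => f w = f b))
        ((colorPartition f).parts \
          {Finset.univ.filter fun w => f w = f a, Finset.univ.filter fun w => f w = f b}) := by
  have hclass : ∀ v, (f v = f a ∨ f v = f b) →
      (Finset.univ.filter fun w => f' w = f' v) =
        (Finset.univ.filter fun w => f w = f a) ∪ (Finset.univ.filter fun w => f w = f b) := by
    intro v hv
    have hv' : f' v = f a := by
      rcases hv with hv | hv
      · rw [hf v (by rw [hv]; exact hab), hv]
      · exact hb v hv
    ext w
    simp only [Finset.mem_filter, Finset.mem_univ, true_and, Finset.mem_union, hv']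
    by_cases hw : f w = f b
    · simp [hw, hb w hw]
    · simp [hw, hf w hw]
  have hother : ∀ v, f v ≠ f a → f v ≠ f b →
      (Finset.univ.filter fun w => f' w = f' v) = Finset.univ.filter fun w => f w = f v := by
    intro v h1 h2
    ext w
    simp only [Finset.mem_filter, Finset.mem_univ, true_and, hf v h2]
    by_cases hw : f w = f b
    · rw [hb w hw, hw]
      exact ⟨fun h => absurd h.symm h1, fun h => absurd h.symm h2⟩
    · rw [hf w hw]
  have hinj : ∀ v w, (Finset.univ.filter fun z => f z = f v) = (Finset.univ.filter fun z => f z = f w)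
      → f v = f w := by
    intro v w h
    have : v ∈ Finset.univ.filter fun z => f z = f v := by simp
    rw [h] at this
    simpa using this
  ext X
  rw [mem_colorPartition, Finset.mem_insert, Finset.mem_sdiff, mem_colorPartition]
  simp only [Finset.mem_insert, Finset.mem_singleton, not_or]
  constructor
  · rintro ⟨v, rfl⟩
    by_cases h1 : f v = f a
    · exact Or.inl (hclass v (Or.inl h1))
    by_cases h2 : f v = f b
    · exact Or.inl (hclass v (Or.inr h2))
    rw [hother v h1 h2]
    exact Or.inr ⟨⟨v, rfl⟩, fun h => h1 (hinj _ _ h), fun h => h2 (hinj _ _ h)⟩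
  · rintro (rfl | ⟨⟨v, rfl⟩, h1, h2⟩)
    · exact ⟨a, hclass a (Or.inl rfl)⟩
    · refine ⟨v, hother v (fun h => h1 ?_) (fun h => h2 ?_)⟩
      · rw [h]
      · rw [h]

/-- Every merge removes exactly one colour, so the trigraphs can be indexed by the number of colours
in use. -/
lemma Collapsible.exists_sequence [Nonempty V] {d : ℕ} {f : V → V} (hf : G.Collapsible d f) :
    ∃ T : ℕ → Trigraph V,
      T (Finset.univ.image f).card = Trigraph.ofPartition G (colorPartition f) ∧
      (T 1).nodes.parts = {Finset.univ} ∧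
      (∀ i, 1 ≤ i → i < (Finset.univ.image f).card →
        ∃ X Y, (T (i + 1)).IsContraction (T i) X Y) ∧
      ∀ i, 1 ≤ i → i ≤ (Finset.univ.image f).card → (T i).RedDegreeLE d := by
  induction hf with
  | const f h =>
    have himg : Finset.univ.image f = {f (Classical.arbitrary V)} := by
      ext c
      simp only [Finset.mem_image, Finset.mem_univ, true_and, Finset.mem_singleton]
      constructor
      · rintro ⟨x, rfl⟩; exact h _ _
      · rintro rfl; exact ⟨_, rfl⟩
    rw [himg, Finset.card_singleton]
    refine ⟨fun _ => Trigraph.ofPartition G (colorPartition f), rfl, ?_, fun i h1 h2 => by omega,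
      fun i _ _ => redDegreeLE_colorPartition fun x => ?_⟩
    · ext X
      change X ∈ (colorPartition f).parts ↔ _
      rw [mem_colorPartition, Finset.mem_singleton]
      have : ∀ v, (Finset.univ.filter fun w => f w = f v) = Finset.univ := by
        intro v
        rw [Finset.filter_true_of_mem fun w _ => h w v]
      simp only [this, exists_const]
      exact eq_comm
    · have : G.colorNeighbors f x = ∅ := by
        ext c
        simp only [colorNeighbors, Set.mem_ofPred_eq, Set.mem_empty_iff_false, iff_false]
        rintro ⟨x', y, -, -, h1, -⟩
        exact h1 (h _ _)
      rw [this]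
      simp
  | merge f f' a b hab hb hf hd h' ih =>
    obtain ⟨T, hT1, hT2, hT3, hT4⟩ := ih
    have hparts := colorPartition_merge hab hb hf
    have hA : (Finset.univ.filter fun w => f w = f a) ∈ (colorPartition f).parts :=
      mem_colorPartition.2 ⟨a, rfl⟩
    have hB : (Finset.univ.filter fun w => f w = f b) ∈ (colorPartition f).parts :=
      mem_colorPartition.2 ⟨b, rfl⟩
    have hAB : (Finset.univ.filter fun w => f w = f a) ≠ Finset.univ.filter fun w => f w = f b := by
      intro h
      have : a ∈ Finset.univ.filter fun z => f z = f a := by simp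
      rw [h] at this
      exact hab (by simpa using this)
    have hcard : (Finset.univ.image f).card = (Finset.univ.image f').card + 1 := by
      rw [← card_colorPartition, ← card_colorPartition, hparts, Finset.card_insert_of_notMem,
        Finset.card_sdiff_of_subset, Finset.card_pair hAB]
      · have := Finset.card_le_card (s := {Finset.univ.filter fun w => f w = f a,
          Finset.univ.filter fun w => f w = f b}) (t := (colorPartition f).parts) (by
            intro X hX
            simp only [Finset.mem_insert, Finset.mem_singleton] at hX
            rcases hX with rfl | rfl
            · exact hA
            · exact hB)
        rw [Finset.card_pair hAB] at this
        omega
      · intro X hX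
        simp only [Finset.mem_insert, Finset.mem_singleton] at hX
        rcases hX with rfl | rfl
        · exact hA
        · exact hB
      · intro h
        exact Trigraph.union_notMem_parts hA hB hAB (Finset.mem_sdiff.1 h).1
    have hpos : 1 ≤ (Finset.univ.image f').card :=
      Finset.card_pos.2 (Finset.univ_nonempty.image f')
    rw [hcard]
    set k := (Finset.univ.image f').card with hk
    refine ⟨fun i => if i = k + 1 then Trigraph.ofPartition G (colorPartition f) else T i,
      by simp, ?_, ?_, ?_⟩
    · simp only
      rw [if_neg (by omega)]
      exact hT2
    · intro i h1 h2
      simp only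
      rw [if_neg (by omega : ¬ i = k + 1)]
      by_cases hik : i = k
      · subst hik
        rw [if_pos rfl, hT1]
        exact ⟨_, _, Trigraph.isContraction_ofPartition hA hB hAB hparts⟩
      · rw [if_neg (by omega)]
        exact hT3 i h1 (by omega)
    · intro i h1 h2
      simp only
      split_ifs with h
      · exact redDegreeLE_colorPartition hd
      · exact hT4 i h1 (by omega)

theorem Collapsible.hasContractionSequence [Nonempty V] {d : ℕ} (h : G.Collapsible d id) :
    G.HasContractionSequence d := by
  obtain ⟨T, h1, h2, h3, h4⟩ := h.exists_sequence
  rw [Finset.image_id, Finset.card_univ, colorPartition_id, Trigraph.ofPartition_bot] at *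
  exact ⟨T, h1, h2, h3, h4⟩

end Sequence

/-- Colour merging sequences can be pulled back along a homomorphism with a section. -/
lemma Collapsible.pullback {V W : Type*} [Finite V] {G : SimpleGraph V} {H : SimpleGraph W}
    {d : ℕ} (π : H →g G) (s : V → W) (hs : ∀ v, π (s v) = v) {f : V → V}
    (hf : G.Collapsible d f) : H.Collapsible d (fun w => s (f (π w))) := by
  have hinj : Function.Injective s := Function.LeftInverse.injective (g := π) hs
  induction hf with
  | const f h => exact .const _ fun x y => by rw [h (π x) (π y)]
  | merge f f' a b hab hb hf hd h' ih =>
    refine .merge _ (fun w => s (f' (π w))) (s a) (s b) ?_ ?_ ?_ ?_ ih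
    · rw [hs, hs]; exact fun h => hab (hinj h)
    · intro w hw
      simp only [hs] at hw ⊢
      rw [hb _ (hinj hw)]
    · intro w hw
      simp only [hs] at hw ⊢
      rw [hf _ (fun h => hw (by rw [h]))]
    · intro x
      refine le_trans ?_ (hd (π x))
      refine (Set.ncard_le_ncard ?_ ((Set.toFinite _).image s)).trans
        (Set.ncard_image_le (f := s) (Set.toFinite _))
      rintro c ⟨x', y, h1, h2, h3, rfl⟩
      exact ⟨f (π y), ⟨π x', π y, hinj h1, π.map_adj h2, fun h => h3 (congrArg s h), rfl⟩, rfl⟩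

lemma collapsible_of_card_le {V : Type*} [Fintype V] {G : SimpleGraph V} {d : ℕ}
    (hd : Fintype.card V ≤ d) (f : V → V) : G.Collapsible d f := by
  classical
  induction hn : (Finset.univ.image f).card using Nat.strong_induction_on generalizing f with
  | _ n ih =>
    by_cases h : ∀ x y, f x = f y
    · exact .const f h
    · push Not at h
      obtain ⟨a, b, hab⟩ := h
      refine .merge f (fun v => if f v = f b then f a else f v) a b hab (fun v hv => by simp [hv])
        (fun v hv => by simp [hv]) (fun x => ?_) (ih _ ?_ _ rfl)
      · refine (Set.ncard_le_ncard (Set.subset_univ _) (Set.toFinite _)).trans ?_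
        rw [Set.ncard_univ, Nat.card_eq_fintype_card]
        exact hd
      · rw [← hn]
        refine Finset.card_lt_card ?_
        rw [Finset.ssubset_iff_of_subset]
        · refine ⟨f b, by simp, ?_⟩
          simp only [Finset.mem_image, Finset.mem_univ, true_and, not_exists]
          intro x hx
          split_ifs at hx with h'
          · exact hab hx
          · exact h' hx
        · intro c hc
          simp only [Finset.mem_image, Finset.mem_univ, true_and] at hc ⊢
          obtain ⟨x, rfl⟩ := hc
          split_ifs
          · exact ⟨a, rfl⟩
          · exact ⟨x, rfl⟩

/-- The two vertices over each vertex of `G` are merged, one fibre after the other. When all fibres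
are merged, the colouring is pulled back from the identity of `G`, and the merges known for `G`
finish. -/
lemma collapsible_twoLift {V : Type} [Finite V] {G : SimpleGraph V} {d : ℕ}
    (hG : ∀ v, (G.neighborSet v).ncard = d) (σ : Sym2 V → Bool) (h : G.Collapsible (2 * d) id) :
    (G.twoLift σ).Collapsible (2 * d) id := by
  classical
  have := Fintype.ofFinite V
  -- `S` is the set of fibres still separate: the empty set is the pulled-back colouring, the full
  -- set is the identity.
  have key : ∀ S : Finset V, (G.twoLift σ).Collapsible (2 * d)
      (fun x => if x.1 ∈ S then x else (x.1, true)) := by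
    intro S
    induction S using Finset.induction_on with
    | empty =>
      simpa using h.pullback (G.twoLiftHom σ) (fun v => (v, true)) (fun v => rfl)
    | insert w S hw ih =>
      refine .merge _ _ (w, true) (w, false) (by simp) ?_ ?_ ?_ ih
      · rintro ⟨v, b⟩ hv
        simp only [Finset.mem_insert, true_or, if_true] at hv ⊢
        split_ifs at hv with h1
        · simp only [Prod.mk.injEq] at hv
          rw [if_neg (by rw [hv.1]; exact hw), hv.1]
        · simp at hv
      · rintro ⟨v, b⟩ hv
        simp only [Finset.mem_insert, true_or, if_true] at hv ⊢
        by_cases h1 : v = w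
        · subst h1
          simp only [true_or, if_true] at hv ⊢
          rw [if_neg hw]
          cases b
          · exact absurd rfl hv
          · rfl
        · simp [h1]
      · rintro ⟨v, b⟩
        have h1 : (G.twoLift σ).colorNeighbors
            (fun x => if x.1 ∈ insert w S then x else (x.1, true)) (v, b) ⊆
            G.neighborSet v ×ˢ (Set.univ : Set Bool) := by
          rintro c ⟨x', y, hx, hxy, -, rfl⟩
          have e : ∀ z : V × Bool, (if z.1 ∈ insert w S then z else (z.1, true)).1 = z.1 := by
            intro z
            split_ifs <;> rfl
          have h2 : x'.1 = v := (e x').symm.trans ((congrArg Prod.fst hx).trans (e (v, b)))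
          refine ⟨?_, Set.mem_univ _⟩
          rw [e, ← h2]
          exact hxy.1
        refine (Set.ncard_le_ncard h1 (Set.toFinite _)).trans ?_
        rw [Set.ncard_prod, hG v, Set.ncard_univ, Nat.card_eq_fintype_card, Fintype.card_bool]
        omega
  simpa only [Finset.mem_univ, if_true] using! key Finset.univ

lemma IsIteratedTwoLift.collapsible {V : Type} [Finite V] {G : SimpleGraph V} {d : ℕ}
    (hG : ∀ v, (G.neighborSet v).ncard = d) (hc : G.Collapsible (2 * d) id) {W : Type}
    {H : SimpleGraph W} (h : G.IsIteratedTwoLift H) : H.Collapsible (2 * d) id := by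
  induction h with
  | refl => exact hc
  | lift σ h e ih =>
    obtain ⟨e⟩ := e
    have := h.finite
    have h1 := (collapsible_twoLift (h.ncard_neighborSet hG) σ ih).pullback
      e.toHom e.symm (fun v => e.apply_symm_apply v)
    have h2 : (fun w => e.symm (id (e.toHom w))) = id := by
      funext w
      exact e.symm_apply_apply w
    rwa [h2] at h1

end SimpleGraph

/-! ### The lower bound for twin-width: classes of small red degree remain pairs -/

namespace SimpleGraph

variable {V : Type*} (G : SimpleGraph V)

/-- Some vertex of `X` is adjacent to some vertex of `Y`. -/
def Touches (X Y : Finset V) : Prop := ∃ x ∈ X, ∃ y ∈ Y, G.Adj x y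

/-- Every vertex of `X` is adjacent to every vertex of `Y`. -/
def FullyAdjacent (X Y : Finset V) : Prop := ∀ x ∈ X, ∀ y ∈ Y, G.Adj x y

/-- Any two vertices of `Z` have distance at most two. -/
def IsClose (Z : Finset V) : Prop :=
  ∀ z ∈ Z, ∀ z' ∈ Z, z = z' ∨ G.Adj z z' ∨ ∃ x, G.Adj z x ∧ G.Adj x z'

open Classical in
/-- The classes joined to `X` by some, but not by all possible edges. -/
noncomputable def redParts (Ps : Finset (Finset V)) (X : Finset V) : Finset (Finset V) :=
  Ps.filter fun Z => Z ≠ X ∧ G.Touches X Z ∧ ¬ G.FullyAdjacent X Z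

variable {G}

lemma mem_redParts {Ps : Finset (Finset V)} {X Z : Finset V} : Z ∈ G.redParts Ps X ↔
    Z ∈ Ps ∧ Z ≠ X ∧ G.Touches X Z ∧ ¬ G.FullyAdjacent X Z := by
  classical
  rw [redParts, Finset.mem_filter]

lemma Touches.symm {X Y : Finset V} (h : G.Touches X Y) : G.Touches Y X := by
  obtain ⟨x, hx, y, hy, hxy⟩ := h
  exact ⟨y, hy, x, hx, hxy.symm⟩

lemma FullyAdjacent.symm {X Y : Finset V} (h : G.FullyAdjacent X Y) : G.FullyAdjacent Y X :=
  fun y hy x hx => (h x hx y hy).symm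

/-- A close set adjacent to both `a` and `b` contains the second vertex of a short path. -/
lemma IsClose.exists_short_path {Z : Finset V} (hZ : G.IsClose Z) {a b z z' : V} (hab : a ≠ b)
    (ha : a ∉ Z) (hb : b ∉ Z) (hz : z ∈ Z) (hz' : z' ∈ Z) (haz : G.Adj a z) (hbz : G.Adj b z') :
    ∃ y ∈ Z, ∃ l, G.NB (a :: y :: l) ∧ (a :: y :: l).getLast? = some b ∧ l.length ≤ 3 := by
  have two : ∀ y ∈ Z, G.Adj a y → G.Adj b y →
      ∃ y ∈ Z, ∃ l, G.NB (a :: y :: l) ∧ (a :: y :: l).getLast? = some b ∧ l.length ≤ 3 := by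
    intro y hy h1 h2
    exact ⟨y, hy, [b], ⟨h1, by simpa using hab.symm, nb_pair.2 h2.symm⟩, rfl, by simp⟩
  have hne : ∀ y ∈ Z, y ≠ a := fun y hy h => ha (h ▸ hy)
  have hne' : ∀ y ∈ Z, b ≠ y := fun y hy h => hb (h ▸ hy)
  rcases hZ z hz z' hz' with rfl | h | ⟨x, h1, h2⟩
  · exact two z hz haz hbz
  · refine ⟨z, hz, [z', b], ⟨haz, by simpa using hne z' hz', h, by simpa using hne' z hz,
      nb_pair.2 hbz.symm⟩, rfl, by simp⟩
  · by_cases hxa : x = a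
    · subst hxa; exact two z' hz' h2 hbz
    by_cases hxb : x = b
    · subst hxb; exact two z hz haz h1.symm
    by_cases hzz : z' = z
    · subst hzz; exact two z' hz' haz hbz
    · exact ⟨z, hz, [x, z', b], ⟨haz, by simpa using hxa, h1, by simpa using hzz, h2,
        by simpa using Ne.symm hxb, nb_pair.2 hbz.symm⟩, rfl, by simp⟩

/-- Each of the two paths has at most four edges, so two different ones would close a cycle of
length at most 8. This is where girth 9 enters. -/
lemma second_eq_of_short_paths (hg : 9 ≤ G.girth) {a b y y' : V} {l l' : List V}
    (h : G.NB (a :: y :: l)) (h' : G.NB (a :: y' :: l')) (hb : (a :: y :: l).getLast? = some b)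
    (hb' : (a :: y' :: l').getLast? = some b) (hl : l.length ≤ 3) (hl' : l'.length ≤ 3) :
    y = y' := by
  have := h.eq_of_getLast_eq h' (by simp; omega) hb hb'
  simp only [List.cons.injEq] at this
  exact this.1

/-- Both classes contain the second vertex of the unique path with at most four edges from `a` to
`b`. Hence at most one class of a partition into close classes, apart from those of `a` and `b`, is
adjacent to both. -/
lemma IsClose.inter_of_touches (hg : 9 ≤ G.girth) {Z Z' : Finset V} (hZ : G.IsClose Z)
    (hZ' : G.IsClose Z') {a b : V} (hab : a ≠ b) (ha : a ∉ Z) (hb : b ∉ Z) (ha' : a ∉ Z')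
    (hb' : b ∉ Z') (h1 : ∃ z ∈ Z, G.Adj a z) (h2 : ∃ z ∈ Z, G.Adj b z)
    (h1' : ∃ z ∈ Z', G.Adj a z) (h2' : ∃ z ∈ Z', G.Adj b z) : ∃ y ∈ Z, y ∈ Z' := by
  obtain ⟨z, hz, h1⟩ := h1
  obtain ⟨w, hw, h2⟩ := h2
  obtain ⟨z', hz', h1'⟩ := h1'
  obtain ⟨w', hw', h2'⟩ := h2'
  obtain ⟨y, hy, l, hl, hlb, hll⟩ := hZ.exists_short_path hab ha hb hz hw h1 h2
  obtain ⟨y', hy', l', hl', hlb', hll'⟩ := hZ'.exists_short_path hab ha' hb' hz' hw' h1' h2'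
  have := second_eq_of_short_paths hg hl hl' hlb hlb' hll hll'
  exact ⟨y, hy, this ▸ hy'⟩

/-- If `a` and `b` were adjacent, the short path through `Z` would have to be the edge itself, whose
second vertex `b` is not in `Z`. -/
lemma IsClose.not_adj_of_touches (hg : 9 ≤ G.girth) {Z : Finset V} (hZ : G.IsClose Z)
    {a b : V} (ha : a ∉ Z) (hb : b ∉ Z) (h1 : ∃ z ∈ Z, G.Adj a z)
    (h2 : ∃ z ∈ Z, G.Adj b z) : ¬ G.Adj a b := by
  intro h
  obtain ⟨z, hz, h1⟩ := h1
  obtain ⟨w, hw, h2⟩ := h2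
  obtain ⟨y, hy, l, hl, hlb, hll⟩ := hZ.exists_short_path h.ne ha hb hz hw h1 h2
  have := second_eq_of_short_paths hg hl (nb_pair.2 h) hlb rfl hll (by simp)
  exact hb (this ▸ hy)

lemma eq_of_common_neighbors (hg : 9 ≤ G.girth) {a b y y' : V} (hab : a ≠ b) (h1 : G.Adj a y)
    (h2 : G.Adj y b) (h1' : G.Adj a y') (h2' : G.Adj y' b) : y = y' :=
  second_eq_of_short_paths hg (l := [b]) (l' := [b]) (b := b)
    ⟨h1, by simpa using hab.symm, nb_pair.2 h2⟩ ⟨h1', by simpa using hab.symm, nb_pair.2 h2'⟩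
    rfl rfl (by simp) (by simp)

open Classical in
lemma card_filter_adj [Fintype V] (v : V) :
    (Finset.univ.filter fun z => G.Adj v z).card = (G.neighborSet v).ncard := by
  rw [← Set.ncard_coe_finset]
  congr 1
  ext
  simp

section Partition

variable [Fintype V] [DecidableEq V]

variable (G) in
/-- All classes have at most two vertices, which are at distance at most two, and the classes with
two vertices have large red degree. -/
structure PairInvariant (Δ : ℕ) (P : Finpartition (Finset.univ : Finset V)) : Prop where
  card_le : ∀ X ∈ P.parts, X.card ≤ 2
  close : ∀ X ∈ P.parts, G.IsClose X
  red : ∀ X ∈ P.parts, X.card = 2 → 2 * Δ - 2 ≤ (G.redParts P.parts X).card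

variable {P P' : Finpartition (Finset.univ : Finset V)} {Δ : ℕ}

lemma notMem_of_mem_parts {X Y : Finset V} (hX : X ∈ P.parts) (hY : Y ∈ P.parts) (hXY : X ≠ Y)
    {x : V} (hx : x ∈ X) : x ∉ Y :=
  Finset.disjoint_left.1 (P.disjoint hX hY hXY) hx

lemma mem_redParts_union {X Y Z : Finset V} (hX : X ∈ P.parts) (hY : Y ∈ P.parts) (hXY : X ≠ Y)
    (hP' : P'.parts = insert (X ∪ Y) (P.parts \ {X, Y})) (hZ : Z ∈ P.parts) (hZX : Z ≠ X)
    (hZY : Z ≠ Y) (h1 : G.Touches (X ∪ Y) Z) (h2 : ¬ G.FullyAdjacent (X ∪ Y) Z) :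
    Z ∈ G.redParts P'.parts (X ∪ Y) := by
  rw [mem_redParts]
  refine ⟨by rw [hP']; simp [hZ, hZX, hZY], ?_, h1, h2⟩
  rintro rfl
  exact Trigraph.union_notMem_parts hX hY hXY hZ

lemma mem_redParts_union_left {X Y Z : Finset V} (hX : X ∈ P.parts) (hY : Y ∈ P.parts)
    (hXY : X ≠ Y) (hP' : P'.parts = insert (X ∪ Y) (P.parts \ {X, Y}))
    (hZ : Z ∈ G.redParts P.parts X) (hZY : Z ≠ Y) : Z ∈ G.redParts P'.parts (X ∪ Y) := by
  rw [mem_redParts] at hZ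
  obtain ⟨h1, h2, ⟨x, hx, h3⟩, h4⟩ := hZ
  exact mem_redParts_union hX hY hXY hP' h1 h2 hZY ⟨x, Finset.mem_union_left _ hx, h3⟩
    fun h => h4 fun x hx => h x (Finset.mem_union_left _ hx)

lemma mem_redParts_union_right {X Y Z : Finset V} (hX : X ∈ P.parts) (hY : Y ∈ P.parts)
    (hXY : X ≠ Y) (hP' : P'.parts = insert (X ∪ Y) (P.parts \ {X, Y}))
    (hZ : Z ∈ G.redParts P.parts Y) (hZX : Z ≠ X) : Z ∈ G.redParts P'.parts (X ∪ Y) := by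
  rw [mem_redParts] at hZ
  obtain ⟨h1, h2, ⟨x, hx, h3⟩, h4⟩ := hZ
  exact mem_redParts_union hX hY hXY hP' h1 hZX h2 ⟨x, Finset.mem_union_right _ hx, h3⟩
    fun h => h4 fun x hx => h x (Finset.mem_union_right _ hx)

/-- Merging two pairs creates too many red neighbours. -/
lemma PairInvariant.red_union_pairs (hinv : G.PairInvariant Δ P) (hg : 9 ≤ G.girth) (hΔ : 7 ≤ Δ)
    {X Y : Finset V} (hX : X ∈ P.parts) (hY : Y ∈ P.parts) (hXY : X ≠ Y) (hX2 : X.card = 2)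
    (hY2 : Y.card = 2) (hP' : P'.parts = insert (X ∪ Y) (P.parts \ {X, Y})) :
    2 * Δ - 1 ≤ (G.redParts P'.parts (X ∪ Y)).card := by
  classical
  have h1 : (G.redParts P.parts X).erase Y ∪ (G.redParts P.parts Y).erase X ⊆
      G.redParts P'.parts (X ∪ Y) := by
    intro Z hZ
    rw [Finset.mem_union, Finset.mem_erase, Finset.mem_erase] at hZ
    rcases hZ with ⟨h, hZ⟩ | ⟨h, hZ⟩
    · exact mem_redParts_union_left hX hY hXY hP' hZ h
    · exact mem_redParts_union_right hX hY hXY hP' hZ h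
  have h2 := Finset.card_le_card h1
  have h3 := Finset.card_union_add_card_inter ((G.redParts P.parts X).erase Y)
    ((G.redParts P.parts Y).erase X)
  -- Each of the four pairs in `X ×ˢ Y` has at most one class adjacent to both members. The merged
  -- class therefore has at least 2 (2 Δ - 3) - 4 red neighbours.
  have h4 : ((G.redParts P.parts X).erase Y ∩ (G.redParts P.parts Y).erase X).card ≤ 4 := by
    have h5 : (G.redParts P.parts X).erase Y ∩ (G.redParts P.parts Y).erase X ⊆
        (X ×ˢ Y).biUnion fun p => P.parts.filter fun Z =>
          Z ≠ X ∧ Z ≠ Y ∧ (∃ z ∈ Z, G.Adj p.1 z) ∧ ∃ z ∈ Z, G.Adj p.2 z := by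
      intro Z hZ
      simp only [Finset.mem_inter, Finset.mem_erase, mem_redParts] at hZ
      obtain ⟨⟨-, hZP, hZX, ⟨x, hx, hx'⟩, -⟩, -, -, hZY, ⟨y, hy, hy'⟩, -⟩ := hZ
      simp only [Finset.mem_biUnion, Finset.mem_product, Finset.mem_filter]
      exact ⟨(x, y), ⟨hx, hy⟩, hZP, hZX, hZY, hx', hy'⟩
    refine (Finset.card_le_card h5).trans ((Finset.card_biUnion_le_card_mul _ _ 1 ?_).trans ?_)
    · rintro ⟨x, y⟩ hxy
      rw [Finset.mem_product] at hxy
      rw [Finset.card_le_one]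
      intro Z hZ Z' hZ'
      simp only [Finset.mem_filter] at hZ hZ'
      obtain ⟨hZ, hZX, hZY, hZ1, hZ2⟩ := hZ
      obtain ⟨hZ', hZX', hZY', hZ1', hZ2'⟩ := hZ'
      obtain ⟨w, hw, hw'⟩ := (hinv.close Z hZ).inter_of_touches hg (hinv.close Z' hZ')
        (a := x) (b := y) (fun h => notMem_of_mem_parts hX hY hXY hxy.1 (h ▸ hxy.2))
        (notMem_of_mem_parts hX hZ hZX.symm hxy.1) (notMem_of_mem_parts hY hZ hZY.symm hxy.2)
        (notMem_of_mem_parts hX hZ' hZX'.symm hxy.1) (notMem_of_mem_parts hY hZ' hZY'.symm hxy.2)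
        hZ1 hZ2 hZ1' hZ2'
      by_contra hne
      exact notMem_of_mem_parts hZ hZ' hne hw hw'
    · rw [Finset.card_product, hX2, hY2]
  have h5 := Finset.pred_card_le_card_erase (s := G.redParts P.parts X) (a := Y)
  have h6 := Finset.pred_card_le_card_erase (s := G.redParts P.parts Y) (a := X)
  have h7 := hinv.red X hX hX2
  have h8 := hinv.red Y hY hY2
  omega

/-- Merging a pair with a single vertex creates too many red neighbours. -/
lemma PairInvariant.red_union_singleton (hinv : G.PairInvariant Δ P) (hg : 9 ≤ G.girth)
    (hΔ : 7 ≤ Δ) (hdeg : ∀ v, (G.neighborSet v).ncard = Δ) {X : Finset V} {w : V}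
    (hX : X ∈ P.parts) (hY : {w} ∈ P.parts) (hXY : X ≠ {w}) (hX2 : X.card = 2)
    (hP' : P'.parts = insert (X ∪ {w}) (P.parts \ {X, {w}})) :
    2 * Δ - 1 ≤ (G.redParts P'.parts (X ∪ {w})).card := by
  classical
  set N : Finset V := Finset.univ.filter fun z => G.Adj w z with hN
  have hNcard : N.card = Δ := (card_filter_adj w).trans (hdeg w)
  set I := N.image P.part with hI
  -- Classes have at most two members, so Δ ≥ 7 neighbours of `w` occupy at least four classes.
  have hIcard : 4 ≤ I.card := by
    have : N.card ≤ 2 * I.card := Finset.card_le_mul_card_image (f := P.part) N 2 (by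
      intro Z hZ
      obtain ⟨z, -, rfl⟩ := Finset.mem_image.1 hZ
      refine le_trans (Finset.card_le_card ?_) (hinv.card_le _ (P.part_mem.2 (Finset.mem_univ z)))
      intro y hy
      rw [Finset.mem_filter] at hy
      rw [← hy.2]
      exact P.mem_part (Finset.mem_univ y))
    rw [hNcard] at this
    omega
  have hIP : ∀ Z ∈ I, Z ∈ P.parts ∧ ∃ z ∈ Z, G.Adj w z := by
    intro Z hZ
    obtain ⟨z, hz, rfl⟩ := Finset.mem_image.1 hZ
    exact ⟨P.part_mem.2 (Finset.mem_univ z), z, P.mem_part (Finset.mem_univ z), by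
      simpa [hN] using hz⟩
  have hIw : ∀ Z ∈ I, Z ≠ {w} := by
    rintro Z hZ rfl
    obtain ⟨-, z, hz, h⟩ := hIP _ hZ
    rw [Finset.mem_singleton] at hz
    exact h.ne hz.symm
  have hwX : w ∉ X := fun h => notMem_of_mem_parts hX hY hXY h (Finset.mem_singleton_self w)
  -- Each of the two vertices of `X` accounts for at most one bad class, so at least two of the four
  -- are new red neighbours. They outweigh the possible loss of `{w}`.
  have hbad : (I.filter fun Z => Z = X ∨ G.Touches X Z).card ≤ 2 := by
    have h1 : (I.filter fun Z => Z = X ∨ G.Touches X Z) ⊆ X.biUnion fun x => I.filter fun Z =>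
        (Z = X ∧ G.Adj x w) ∨ (Z ≠ X ∧ ∃ z ∈ Z, G.Adj x z) := by
      intro Z hZ
      rw [Finset.mem_filter] at hZ
      simp only [Finset.mem_biUnion, Finset.mem_filter]
      by_cases hZX : Z = X
      · obtain ⟨-, z, hz, h⟩ := hIP _ hZ.1
        exact ⟨z, hZX ▸ hz, hZ.1, Or.inl ⟨hZX, h.symm⟩⟩
      · obtain ⟨x, hx, h⟩ := hZ.2.resolve_left hZX
        exact ⟨x, hx, hZ.1, Or.inr ⟨hZX, h⟩⟩
    refine (Finset.card_le_card h1).trans ((Finset.card_biUnion_le_card_mul _ _ 1 ?_).trans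
      (by rw [hX2]))
    intro x hx
    have hxw : x ≠ w := fun h => hwX (h ▸ hx)
    have hmix : ∀ Z ∈ I, Z ≠ X → (∃ z ∈ Z, G.Adj x z) → ¬ G.Adj x w := fun Z hZ hZX h =>
      (hinv.close Z (hIP Z hZ).1).not_adj_of_touches hg
        (notMem_of_mem_parts hX (hIP Z hZ).1 hZX.symm hx)
        (notMem_of_mem_parts hY (hIP Z hZ).1 (hIw Z hZ).symm (Finset.mem_singleton_self w))
        h (hIP Z hZ).2
    rw [Finset.card_le_one]
    intro Z hZ Z' hZ'
    rw [Finset.mem_filter] at hZ hZ'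
    obtain ⟨hZ, ⟨h1, h2⟩ | ⟨h1, h2⟩⟩ := hZ <;> obtain ⟨hZ', ⟨h1', h2'⟩ | ⟨h1', h2'⟩⟩ := hZ'
    · rw [h1, h1']
    · exact absurd h2 (hmix Z' hZ' h1' h2')
    · exact absurd h2' (hmix Z hZ h1 h2)
    · obtain ⟨y, hy, hy'⟩ := (hinv.close Z (hIP Z hZ).1).inter_of_touches hg
        (hinv.close Z' (hIP Z' hZ').1) hxw
        (notMem_of_mem_parts hX (hIP Z hZ).1 h1.symm hx)
        (notMem_of_mem_parts hY (hIP Z hZ).1 (hIw Z hZ).symm (Finset.mem_singleton_self w))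
        (notMem_of_mem_parts hX (hIP Z' hZ').1 h1'.symm hx)
        (notMem_of_mem_parts hY (hIP Z' hZ').1 (hIw Z' hZ').symm (Finset.mem_singleton_self w))
        h2 (hIP Z hZ).2 h2' (hIP Z' hZ').2
      by_contra hne
      exact notMem_of_mem_parts (hIP Z hZ).1 (hIP Z' hZ').1 hne hy hy'
  have hsplit := Finset.card_filter_add_card_filter_not (s := I)
    (fun Z => Z = X ∨ G.Touches X Z)
  set New := I.filter fun Z => ¬ (Z = X ∨ G.Touches X Z) with hNew
  have hsub : (G.redParts P.parts X).erase {w} ∪ New ⊆ G.redParts P'.parts (X ∪ {w}) := by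
    intro Z hZ
    rw [Finset.mem_union, Finset.mem_erase] at hZ
    rcases hZ with ⟨h, hZ⟩ | hZ
    · exact mem_redParts_union_left hX hY hXY hP' hZ h
    · rw [hNew, Finset.mem_filter, not_or] at hZ
      obtain ⟨hZI, hZX, hZt⟩ := hZ
      obtain ⟨hZP, z, hz, hwz⟩ := hIP Z hZI
      refine mem_redParts_union hX hY hXY hP' hZP hZX (hIw Z hZI) ⟨w, by simp, z, hz, hwz⟩ ?_
      intro h
      obtain ⟨x, hx⟩ := P.nonempty_of_mem_parts hX
      exact hZt ⟨x, hx, z, hz, h x (Finset.mem_union_left _ hx) z hz⟩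
  have hdisj : Disjoint ((G.redParts P.parts X).erase {w}) New := by
    rw [Finset.disjoint_left]
    intro Z hZ hZ'
    rw [Finset.mem_erase, mem_redParts] at hZ
    rw [hNew, Finset.mem_filter] at hZ'
    exact hZ'.2 (Or.inr hZ.2.2.2.1)
  have h1 := Finset.card_le_card hsub
  rw [Finset.card_union_of_disjoint hdisj] at h1
  have h2 := Finset.pred_card_le_card_erase (s := G.redParts P.parts X) (a := {w})
  have h3 := hinv.red X hX hX2
  omega

end Partition

end SimpleGraph

namespace SimpleGraph

variable {V : Type*} {G : SimpleGraph V} {a b : V}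

lemma touches_singleton_left {X : Finset V} : G.Touches {a} X ↔ ∃ x ∈ X, G.Adj a x := by
  simp [Touches]

lemma fullyAdjacent_singleton_left {X : Finset V} :
    G.FullyAdjacent {a} X ↔ ∀ x ∈ X, G.Adj a x := by
  simp [FullyAdjacent]

lemma isClose_pair [DecidableEq V] (h : G.Adj a b ∨ ∃ x, G.Adj a x ∧ G.Adj x b) :
    G.IsClose ({a} ∪ {b} : Finset V) := by
  have h' : G.Adj b a ∨ ∃ x, G.Adj b x ∧ G.Adj x a := by
    rcases h with h | ⟨x, h1, h2⟩
    · exact Or.inl h.symm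
    · exact Or.inr ⟨x, h2.symm, h1.symm⟩
  intro z hz z' hz'
  rw [Finset.mem_union, Finset.mem_singleton, Finset.mem_singleton] at hz hz'
  rcases hz with rfl | rfl <;> rcases hz' with rfl | rfl
  · exact Or.inl rfl
  · exact Or.inr h
  · exact Or.inr h'
  · exact Or.inl rfl

variable [Fintype V] [DecidableEq V] {P P' : Finpartition (Finset.univ : Finset V)} {Δ : ℕ}

/-- A pair that is joined completely to `{a}` and not joined to `{b}` would get one more red
neighbour when `{a}` and `{b}` are merged. -/
lemma PairInvariant.touches_of_fullyAdjacent (hinv : G.PairInvariant Δ P)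
    (ha : {a} ∈ P.parts) (hb : {b} ∈ P.parts) (hab : a ≠ b)
    (hP' : P'.parts = insert ({a} ∪ {b}) (P.parts \ {{a}, {b}}))
    (hbound : ∀ Z ∈ P'.parts, (G.redParts P'.parts Z).card ≤ 2 * Δ - 2) {Q : Finset V}
    (hQ : Q ∈ P.parts) (hQ2 : Q.card = 2) (hfull : ∀ q ∈ Q, G.Adj a q) : ∃ q ∈ Q, G.Adj b q := by
  by_contra! hno
  have hne : ∀ v, Q ≠ {v} := by
    rintro v rfl
    simp at hQ2
  have hA := Trigraph.union_notMem_parts ha hb (by simpa using hab)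
  have hQP' : Q ∈ P'.parts := by
    rw [hP']
    simp [hQ, hne]
  -- Neither `{a}`, joined completely, nor `{b}`, not joined at all, was a red neighbour of `Q`, so
  -- the merge takes none away.
  have hsub : insert ({a} ∪ {b}) (G.redParts P.parts Q) ⊆ G.redParts P'.parts Q := by
    intro Z hZ
    rw [Finset.mem_insert] at hZ
    rcases hZ with rfl | hZ
    · obtain ⟨q, hq⟩ := P.nonempty_of_mem_parts hQ
      refine mem_redParts.2 ⟨by rw [hP']; simp, fun h => hA (h ▸ hQ),
        ⟨q, hq, a, by simp, (hfull q hq).symm⟩, fun h => hno q hq (h q hq b (by simp)).symm⟩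
    · rw [mem_redParts] at hZ ⊢
      obtain ⟨h1, h2, ⟨q, hq, z, hz, h3⟩, h4⟩ := hZ
      refine ⟨?_, h2, ⟨q, hq, z, hz, h3⟩, h4⟩
      have hZa : Z ≠ {a} := by
        rintro rfl
        exact h4 (fullyAdjacent_singleton_left.2 hfull).symm
      have hZb : Z ≠ {b} := by
        rintro rfl
        rw [Finset.mem_singleton] at hz
        exact hno q hq (hz ▸ h3.symm)
      rw [hP']
      simp [h1, hZa, hZb]
  have h1 := Finset.card_le_card hsub
  rw [Finset.card_insert_of_notMem fun h => hA (mem_redParts.1 h).1] at h1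
  have h2 := hbound Q hQP'
  have h3 := hinv.red Q hQ hQ2
  omega

/-- Merging `{a}` and `{b}`: the neighbours of `a` and of `b` outside of the class `Q` lie in
pairwise distinct red neighbours of the new class. -/
lemma PairInvariant.card_le_card_redParts_erase (hinv : G.PairInvariant Δ P)
    (ha : {a} ∈ P.parts) (hb : {b} ∈ P.parts) (hab : a ≠ b)
    (hP' : P'.parts = insert ({a} ∪ {b}) (P.parts \ {{a}, {b}}))
    (hbound : ∀ Z ∈ P'.parts, (G.redParts P'.parts Z).card ≤ 2 * Δ - 2) {Q Na Nb : Finset V}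
    (hQ : ∀ Z ∈ P.parts, Z ≠ {a} → Z ≠ {b} → (∃ z ∈ Z, G.Adj a z) → (∃ z ∈ Z, G.Adj b z) → Z = Q)
    (hNa : ∀ z ∈ Na, G.Adj a z ∧ z ∉ Q ∧ z ≠ b) (hNb : ∀ z ∈ Nb, G.Adj b z ∧ z ∉ Q ∧ z ≠ a) :
    Na.card + Nb.card ≤ ((G.redParts P'.parts ({a} ∪ {b})).erase Q).card := by
  have hpart : ∀ z, P.part z ∈ P.parts := fun z => P.part_mem.2 (Finset.mem_univ z)
  have hmem : ∀ z, z ∈ P.part z := fun z => P.mem_part (Finset.mem_univ z)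
  have hne : ∀ z v, z ≠ v → P.part z ≠ {v} := by
    intro z v h h'
    have := hmem z
    rw [h', Finset.mem_singleton] at this
    exact h this
  have hne' : ({a} : Finset V) ≠ {b} := by simpa using hab
  have hQz : ∀ z, z ∉ Q → P.part z ≠ Q := by
    rintro z hz rfl
    exact hz (hmem z)
  have hanb : ∀ z ∈ Na, ∀ q ∈ P.part z, ¬ G.Adj b q := fun z hz q hq h =>
    hQz z (hNa z hz).2.1 (hQ _ (hpart z) (hne z a (hNa z hz).1.ne') (hne z b (hNa z hz).2.2)
      ⟨z, hmem z, (hNa z hz).1⟩ ⟨q, hq, h⟩)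
  have hbna : ∀ z ∈ Nb, ∀ q ∈ P.part z, ¬ G.Adj a q := fun z hz q hq h =>
    hQz z (hNb z hz).2.1 (hQ _ (hpart z) (hne z a (hNb z hz).2.2) (hne z b (hNb z hz).1.ne')
      ⟨q, hq, h⟩ ⟨z, hmem z, (hNb z hz).1⟩)
  have hpair : ∀ z z', z ≠ z' → P.part z = P.part z' →
      (P.part z).card = 2 ∧ ∀ q ∈ P.part z, q = z ∨ q = z' := by
    intro z z' hzz h
    have h1 : ({z, z'} : Finset V) ⊆ P.part z := by
      intro q hq
      rw [Finset.mem_insert, Finset.mem_singleton] at hq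
      rcases hq with rfl | rfl
      · exact hmem q
      · rw [h]; exact hmem q
    have h2 : ({z, z'} : Finset V) = P.part z := by
      refine Finset.eq_of_subset_of_card_le h1 ?_
      rw [Finset.card_pair hzz]
      exact hinv.card_le _ (hpart z)
    rw [← h2]
    exact ⟨Finset.card_pair hzz, by simp⟩
  -- Two neighbours of `a` in one class form a pair joined completely to `a`. The bound on red
  -- degrees then makes that class adjacent to `b` too, which only `Q` may be.
  have hinj : Set.InjOn P.part (Na ∪ Nb : Finset V) := by
    intro z hz z' hz' h
    by_contra hzz
    obtain ⟨h2, hq⟩ := hpair z z' hzz h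
    rw [Finset.mem_coe, Finset.mem_union] at hz hz'
    rcases hz with hz | hz <;> rcases hz' with hz' | hz'
    · obtain ⟨q, hq1, hq2⟩ := hinv.touches_of_fullyAdjacent ha hb hab hP' hbound (hpart z) h2
        (fun q hq' => by
          rcases hq q hq' with rfl | rfl
          · exact (hNa _ hz).1
          · exact (hNa _ hz').1)
      exact hanb z hz q hq1 hq2
    · exact hanb z hz z' (h ▸ hmem z') (hNb z' hz').1
    · exact hbna z hz z' (h ▸ hmem z') (hNa z' hz').1
    · obtain ⟨q, hq1, hq2⟩ := hinv.touches_of_fullyAdjacent hb ha hab.symm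
        (by rw [Finset.union_comm, Finset.pair_comm]; exact hP') hbound (hpart z) h2
        (fun q hq' => by
          rcases hq q hq' with rfl | rfl
          · exact (hNb _ hz).1
          · exact (hNb _ hz').1)
      exact hbna z hz q hq1 hq2
  have hdisj : Disjoint Na Nb := by
    rw [Finset.disjoint_left]
    exact fun z hz hz' => hanb z hz z (hmem z) (hNb z hz').1
  rw [← Finset.card_union_of_disjoint hdisj, ← Finset.card_image_of_injOn hinj]
  refine Finset.card_le_card ?_
  intro Z hZ
  obtain ⟨z, hz, rfl⟩ := Finset.mem_image.1 hZ
  rw [Finset.mem_erase]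
  rcases Finset.mem_union.1 hz with hz | hz
  · exact ⟨hQz z (hNa z hz).2.1, mem_redParts_union ha hb hne' hP' (hpart z)
      (hne z a (hNa z hz).1.ne') (hne z b (hNa z hz).2.2)
      ⟨a, by simp, z, hmem z, (hNa z hz).1⟩
      fun h => hanb z hz z (hmem z) (h b (by simp) z (hmem z))⟩
  · exact ⟨hQz z (hNb z hz).2.1, mem_redParts_union ha hb hne' hP' (hpart z)
      (hne z a (hNb z hz).2.2) (hne z b (hNb z hz).1.ne')
      ⟨b, by simp, z, hmem z, (hNb z hz).1⟩
      fun h => hbna z hz z (hmem z) (h a (by simp) z (hmem z))⟩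

/-- If two singletons are merged without creating a class of large red degree, then their vertices
are at distance at most two, the new class has red degree `2 * Δ - 2`, and no class has red edges
to both singletons. -/
lemma PairInvariant.merge_singletons (hinv : G.PairInvariant Δ P) (hg : 9 ≤ G.girth) (hΔ : 7 ≤ Δ)
    (hdeg : ∀ v, (G.neighborSet v).ncard = Δ)
    (ha : {a} ∈ P.parts) (hb : {b} ∈ P.parts) (hab : a ≠ b)
    (hP' : P'.parts = insert ({a} ∪ {b}) (P.parts \ {{a}, {b}}))
    (hbound : ∀ Z ∈ P'.parts, (G.redParts P'.parts Z).card ≤ 2 * Δ - 2) :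
    (G.Adj a b ∨ ∃ x, G.Adj a x ∧ G.Adj x b) ∧
    2 * Δ - 2 ≤ (G.redParts P'.parts ({a} ∪ {b})).card ∧
    ∀ Z ∈ P.parts, Z ≠ {a} → Z ≠ {b} → (∃ z ∈ Z, G.Adj a z) → (∃ z ∈ Z, G.Adj b z) →
      (∀ z ∈ Z, G.Adj a z) ∨ ∀ z ∈ Z, G.Adj b z := by
  classical
  have hred := hbound ({a} ∪ {b}) (by rw [hP']; simp)
  have hNcard : ∀ v, (Finset.univ.filter fun z => G.Adj v z).card = Δ :=
    fun v => (card_filter_adj v).trans (hdeg v)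
  by_cases hT : ∃ Q ∈ P.parts, Q ≠ {a} ∧ Q ≠ {b} ∧ (∃ z ∈ Q, G.Adj a z) ∧ ∃ z ∈ Q, G.Adj b z
  · obtain ⟨Q, hQ, hQa, hQb, hta, htb⟩ := hT
    have haQ : a ∉ Q := notMem_of_mem_parts ha hQ hQa.symm (Finset.mem_singleton_self a)
    have hbQ : b ∉ Q := notMem_of_mem_parts hb hQ hQb.symm (Finset.mem_singleton_self b)
    have hnadj : ¬ G.Adj a b := (hinv.close Q hQ).not_adj_of_touches hg haQ hbQ hta htb
    have huniq : ∀ Z ∈ P.parts, Z ≠ {a} → Z ≠ {b} → (∃ z ∈ Z, G.Adj a z) →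
        (∃ z ∈ Z, G.Adj b z) → Z = Q := by
      intro Z hZ hZa hZb h1 h2
      by_contra hne
      obtain ⟨y, hy, hy'⟩ := (hinv.close Z hZ).inter_of_touches hg (hinv.close Q hQ) hab
        (notMem_of_mem_parts ha hZ hZa.symm (Finset.mem_singleton_self a))
        (notMem_of_mem_parts hb hZ hZb.symm (Finset.mem_singleton_self b)) haQ hbQ h1 h2 hta htb
      exact notMem_of_mem_parts hZ hQ hne hy hy'
    have hcard := hinv.card_le_card_redParts_erase ha hb hab hP' hbound huniq
      (Na := (Finset.univ.filter fun z => G.Adj a z) \ Q)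
      (Nb := (Finset.univ.filter fun z => G.Adj b z) \ Q)
      (by
        intro z hz
        rw [Finset.mem_sdiff, Finset.mem_filter] at hz
        exact ⟨hz.1.2, hz.2, fun h => hnadj (h ▸ hz.1.2)⟩)
      (by
        intro z hz
        rw [Finset.mem_sdiff, Finset.mem_filter] at hz
        exact ⟨hz.1.2, hz.2, fun h => hnadj (h ▸ hz.1.2).symm⟩)
    rw [Finset.card_sdiff, Finset.card_sdiff, hNcard, hNcard] at hcard
    set ka := (Q ∩ Finset.univ.filter fun z => G.Adj a z).card with hka
    set kb := (Q ∩ Finset.univ.filter fun z => G.Adj b z).card with hkb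
    have hQ2 := hinv.card_le Q hQ
    have hkaQ : ka ≤ Q.card := Finset.card_le_card Finset.inter_subset_left
    have hkbQ : kb ≤ Q.card := Finset.card_le_card Finset.inter_subset_left
    have hfull : ∀ v, (Q ∩ Finset.univ.filter fun z => G.Adj v z).card = Q.card →
        ∀ z ∈ Q, G.Adj v z := by
      intro v h z hz
      have := Finset.eq_of_subset_of_card_le Finset.inter_subset_left h.ge
      rw [← this] at hz
      simpa using (Finset.mem_inter.1 hz).2
    have hclose : ((∀ z ∈ Q, G.Adj a z) ∨ ∀ z ∈ Q, G.Adj b z) →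
        ∃ x, G.Adj a x ∧ G.Adj x b := by
      rintro (h | h)
      · obtain ⟨z, hz, hz'⟩ := htb
        exact ⟨z, h z hz, hz'.symm⟩
      · obtain ⟨z, hz, hz'⟩ := hta
        exact ⟨z, hz', (h z hz).symm⟩
    have hsuff : ((∀ z ∈ Q, G.Adj a z) ∨ ∀ z ∈ Q, G.Adj b z) ∧
        2 * Δ - 2 ≤ (G.redParts P'.parts ({a} ∪ {b})).card := by
      -- If `Q` is joined completely to both vertices, it is a single vertex, since `a` and `b` have
      -- at most one common neighbour. The other neighbours give 2 (Δ - 1) red classes.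
      by_cases hAQ : G.FullyAdjacent ({a} ∪ {b}) Q
      · have h1 : Q.card ≤ 1 := by
          rw [Finset.card_le_one]
          intro q hq q' hq'
          exact eq_of_common_neighbors hg hab (hAQ a (by simp) q hq) (hAQ b (by simp) q hq).symm
            (hAQ a (by simp) q' hq') (hAQ b (by simp) q' hq').symm
        refine ⟨Or.inl fun z hz => hAQ a (by simp) z hz, ?_⟩
        have := Finset.card_erase_le (s := G.redParts P'.parts ({a} ∪ {b})) (a := Q)
        omega
      -- Now `Q` itself is a red neighbour, so 2 Δ - ka - kb + 1 ≤ 2 Δ - 2 and `ka + kb ≥ 3`. As `Q`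
      -- has at most two vertices, it is a pair joined completely to exactly one of `a` and `b`.
      · have hQred : Q ∈ G.redParts P'.parts ({a} ∪ {b}) := by
          obtain ⟨z, hz, hz'⟩ := hta
          exact mem_redParts_union ha hb (by simpa using hab) hP' hQ hQa hQb
            ⟨a, by simp, z, hz, hz'⟩ hAQ
        have hlt := Finset.card_erase_add_one hQred
        by_cases h1 : ka = Q.card
        · refine ⟨Or.inl (hfull a h1), ?_⟩
          have h2 : kb ≠ Q.card := by
            intro h2
            refine hAQ fun x hx y hy => ?_
            rw [Finset.mem_union, Finset.mem_singleton, Finset.mem_singleton] at hx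
            rcases hx with rfl | rfl
            · exact hfull _ h1 y hy
            · exact hfull _ h2 y hy
          omega
        · by_cases h2 : kb = Q.card
          · exact ⟨Or.inr (hfull b h2), by omega⟩
          · omega
    refine ⟨Or.inr (hclose hsuff.1), hsuff.2, ?_⟩
    intro Z hZ hZa hZb h1 h2
    rw [huniq Z hZ hZa hZb h1 h2]
    exact hsuff.1
  · have hnone : ∀ Z ∈ P.parts, Z ≠ {a} → Z ≠ {b} → (∃ z ∈ Z, G.Adj a z) →
        ¬ ∃ z ∈ Z, G.Adj b z := fun Z hZ h1 h2 h3 h4 => hT ⟨Z, hZ, h1, h2, h3, h4⟩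
    -- No class is adjacent to both vertices, so the exceptional class is taken to be empty. If `a`
    -- and `b` are not adjacent, all 2 Δ neighbours count, which exceeds the bound.
    have hcard := hinv.card_le_card_redParts_erase ha hb hab hP' hbound (Q := ∅)
      (fun Z hZ h1 h2 h3 h4 => absurd h4 (hnone Z hZ h1 h2 h3))
      (Na := (Finset.univ.filter fun z => G.Adj a z).erase b)
      (Nb := (Finset.univ.filter fun z => G.Adj b z).erase a)
      (by
        intro z hz
        rw [Finset.mem_erase, Finset.mem_filter] at hz
        exact ⟨hz.2.2, by simp, hz.1⟩)
      (by
        intro z hz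
        rw [Finset.mem_erase, Finset.mem_filter] at hz
        exact ⟨hz.2.2, by simp, hz.1⟩)
    have hle := Finset.card_erase_le (s := G.redParts P'.parts ({a} ∪ {b})) (a := ∅)
    by_cases hadj : G.Adj a b
    · refine ⟨Or.inl hadj, ?_, fun Z hZ h1 h2 h3 h4 => absurd h4 (hnone Z hZ h1 h2 h3)⟩
      rw [Finset.card_erase_of_mem (by simpa using hadj),
        Finset.card_erase_of_mem (by simpa using hadj.symm), hNcard, hNcard] at hcard
      omega
    · rw [Finset.erase_eq_of_notMem (by simpa using hadj),
        Finset.erase_eq_of_notMem (by simpa using fun h => hadj h.symm), hNcard, hNcard] at hcard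
      omega

lemma PairInvariant.of_merge_singletons (hinv : G.PairInvariant Δ P) (hg : 9 ≤ G.girth)
    (hΔ : 7 ≤ Δ) (hdeg : ∀ v, (G.neighborSet v).ncard = Δ)
    (ha : {a} ∈ P.parts) (hb : {b} ∈ P.parts) (hab : a ≠ b)
    (hP' : P'.parts = insert ({a} ∪ {b}) (P.parts \ {{a}, {b}}))
    (hbound : ∀ Z ∈ P'.parts, (G.redParts P'.parts Z).card ≤ 2 * Δ - 2) :
    G.PairInvariant Δ P' := by
  obtain ⟨hclose, hred, hexcl⟩ := hinv.merge_singletons hg hΔ hdeg ha hb hab hP' hbound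
  have hA := Trigraph.union_notMem_parts ha hb (by simpa using hab)
  have hcases : ∀ X ∈ P'.parts, X = {a} ∪ {b} ∨ (X ∈ P.parts ∧ X ≠ {a} ∧ X ≠ {b}) := by
    intro X hX
    rw [hP'] at hX
    simpa [not_or] using hX
  refine ⟨fun X hX => ?_, fun X hX => ?_, fun X hX hX2 => ?_⟩ <;>
    rcases hcases X hX with rfl | ⟨hXP, hXa, hXb⟩
  · exact Finset.card_union_le _ _
  · exact hinv.card_le X hXP
  · exact isClose_pair hclose
  · exact hinv.close X hXP
  · exact hred
  · refine (hinv.red X hXP hX2).trans ?_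
    have hnot : ¬ (({a} : Finset V) ∈ G.redParts P.parts X ∧ {b} ∈ G.redParts P.parts X) := by
      rintro ⟨h1, h2⟩
      rw [mem_redParts] at h1 h2
      rcases hexcl X hXP hXa hXb (touches_singleton_left.1 h1.2.2.1.symm)
        (touches_singleton_left.1 h2.2.2.1.symm) with h | h
      · exact h1.2.2.2 (fullyAdjacent_singleton_left.2 h).symm
      · exact h2.2.2.2 (fullyAdjacent_singleton_left.2 h).symm
    have hAX : ({a} ∪ {b} : Finset V) ≠ X := fun h => hA (h ▸ hXP)
    have hmem : ∀ v ∈ ({a} ∪ {b} : Finset V), {v} ∈ G.redParts P.parts X →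
        ({a} ∪ {b}) ∈ G.redParts P'.parts X := by
      intro v hv h
      rw [mem_redParts] at h ⊢
      obtain ⟨-, -, ⟨x, hx, y, hy, h1⟩, h2⟩ := h
      rw [Finset.mem_singleton] at hy
      subst hy
      exact ⟨by rw [hP']; simp, hAX, ⟨x, hx, y, hv, h1⟩, fun h => h2 fun x hx z hz => by
        rw [Finset.mem_singleton] at hz
        exact h x hx z (hz ▸ hv)⟩
    -- An old pair loses a red neighbour only if both singletons were red neighbours, and this is
    -- excluded by `hnot`. Replacing either singleton by the merged class is therefore injective.
    refine Finset.card_le_card_of_injOn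
      (fun Z => if Z = {a} ∨ Z = {b} then {a} ∪ {b} else Z) ?_ ?_
    · intro Z hZ
      dsimp only
      split_ifs with h
      · rcases h with rfl | rfl
        · exact hmem a (by simp) hZ
        · exact hmem b (by simp) hZ
      · rw [not_or] at h
        rw [Finset.mem_coe, mem_redParts] at hZ ⊢
        exact ⟨by rw [hP']; simp [hZ.1, h.1, h.2], hZ.2⟩
    · intro Z hZ Z' hZ' h
      have hZne : Z ≠ {a} ∪ {b} := fun h => hA (h ▸ (mem_redParts.1 hZ).1)
      have hZne' : Z' ≠ {a} ∪ {b} := fun h => hA (h ▸ (mem_redParts.1 hZ').1)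
      dsimp only at h
      split_ifs at h with h1 h2 h2
      · rcases h1 with rfl | rfl <;> rcases h2 with rfl | rfl
        · rfl
        · exact absurd ⟨hZ, hZ'⟩ hnot
        · exact absurd ⟨hZ', hZ⟩ hnot
        · rfl
      · exact absurd h.symm hZne'
      · exact absurd h hZne
      · exact h

end SimpleGraph

/-! ### Contraction sequences as sequences of quotients -/

namespace Trigraph

variable {V : Type*} [Fintype V] [DecidableEq V] {T T' : Trigraph V} {G : SimpleGraph V}

/-- The adjacencies of `T` are those of the quotient of `G` by the partition underlying `T`. -/
def IsQuotient (T : Trigraph V) (G : SimpleGraph V) : Prop :=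
  ∀ X ∈ T.nodes.parts, ∀ Y ∈ T.nodes.parts, X ≠ Y →
    (T.black.Adj X Y ↔ G.FullyAdjacent X Y) ∧ (Y ∈ T.neighbors X ↔ G.Touches X Y)

lemma isQuotient_ofGraph (G : SimpleGraph V) : (ofGraph G).IsQuotient G := by
  have key : ∀ x y, (ofGraph G).black.Adj {x} {y} ↔ G.Adj x y := by
    intro x y
    simp only [ofGraph]
    constructor
    · rintro ⟨-, u, v, h, hu, hv⟩
      rw [Finset.singleton_injective hu, Finset.singleton_injective hv] at h
      exact h
    · intro h
      exact ⟨by simpa using h.ne, x, y, h, rfl, rfl⟩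
  have hred : ∀ X Y, ¬ (ofGraph G).red.Adj X Y := fun X Y h => h
  intro X hX Y hY hXY
  obtain ⟨x, rfl⟩ : ∃ x, X = {x} := by
    obtain ⟨x, -, h⟩ := Finpartition.mem_bot_iff.1 hX
    exact ⟨x, h.symm⟩
  obtain ⟨y, rfl⟩ : ∃ y, Y = {y} := by
    obtain ⟨y, -, h⟩ := Finpartition.mem_bot_iff.1 hY
    exact ⟨y, h.symm⟩
  simp [key, hred, neighbors, SimpleGraph.FullyAdjacent, SimpleGraph.Touches]

/-- Contraction turns adjacency into a disjunction and black adjacency into a conjunction over the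
two nodes. So every trigraph of a contraction sequence is determined by its partition, and red
degrees can be computed in `G`. -/
lemma IsContraction.isQuotient {X Y : Finset V} (h : T.IsContraction T' X Y)
    (hT : T.IsQuotient G) : T'.IsQuotient G := by
  have hcases : ∀ Z ∈ T'.nodes.parts, Z = X ∪ Y ∨ (Z ∈ T.nodes.parts ∧ Z ≠ X ∧ Z ≠ Y) := by
    intro Z hZ
    rw [h.parts_eq] at hZ
    simpa [not_or] using hZ
  have hunion : ∀ W ∈ T.nodes.parts, W ≠ X → W ≠ Y →
      (T'.black.Adj (X ∪ Y) W ↔ G.FullyAdjacent (X ∪ Y) W) ∧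
      (W ∈ T'.neighbors (X ∪ Y) ↔ G.Touches (X ∪ Y) W) := by
    intro W hW hWX hWY
    have hX := hT X h.left_mem W hW hWX.symm
    have hY := hT Y h.right_mem W hW hWY.symm
    constructor
    · rw [← SimpleGraph.mem_neighborSet, h.black_union, Set.mem_inter_iff,
        SimpleGraph.mem_neighborSet, SimpleGraph.mem_neighborSet, hX.1, hY.1]
      simp only [SimpleGraph.FullyAdjacent, Finset.mem_union, or_imp, forall_and]
    · rw [h.neighbors_union, Set.mem_sdiff, Set.mem_union, hX.2, hY.2]
      simp only [SimpleGraph.Touches, Finset.mem_union, Set.mem_insert_iff,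
        Set.mem_singleton_iff, hWX, hWY, or_self, not_false_eq_true, and_true, or_and_right,
        exists_or]
  intro Z hZ W hW hZW
  rcases hcases Z hZ with rfl | ⟨hZ, hZX, hZY⟩ <;> rcases hcases W hW with rfl | ⟨hW, hWX, hWY⟩
  · exact absurd rfl hZW
  · exact hunion W hW hWX hWY
  · obtain ⟨h1, h2⟩ := hunion Z hZ hZX hZY
    constructor
    · rw [SimpleGraph.adj_comm, h1]
      exact ⟨SimpleGraph.FullyAdjacent.symm, SimpleGraph.FullyAdjacent.symm⟩
    · have : X ∪ Y ∈ T'.neighbors Z ↔ Z ∈ T'.neighbors (X ∪ Y) := by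
        simp only [neighbors, Set.mem_ofPred_eq, SimpleGraph.adj_comm]
      rw [this, h2]
      exact ⟨SimpleGraph.Touches.symm, SimpleGraph.Touches.symm⟩
  · have hZ' : Z ∈ T.nodes.parts \ {X, Y} := by simp [hZ, hZX, hZY]
    have hW' : W ∈ T.nodes.parts \ {X, Y} := by simp [hW, hWX, hWY]
    have := hT Z hZ W hW hZW
    simp only [neighbors, Set.mem_ofPred_eq] at this ⊢
    rw [h.black_other Z hZ' W hW', h.red_other Z hZ' W hW']
    exact this

lemma IsQuotient.card_redParts_le (hT : T.IsQuotient G) {d : ℕ} (hd : T.RedDegreeLE d)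
    {X : Finset V} (hX : X ∈ T.nodes.parts) : (G.redParts T.nodes.parts X).card ≤ d := by
  refine le_trans ?_ (hd X hX)
  rw [← Set.ncard_coe_finset]
  refine Set.ncard_le_ncard ?_ (Set.toFinite _)
  intro Z hZ
  rw [Finset.mem_coe, SimpleGraph.mem_redParts] at hZ
  obtain ⟨h1, h2, h3, h4⟩ := hZ
  have := hT X hX Z h1 h2.symm
  exact (this.2.2 h3).resolve_left fun h => h4 (this.1.1 h)

end Trigraph

namespace SimpleGraph

variable {V : Type*} {G : SimpleGraph V} [Fintype V] [DecidableEq V] {Δ : ℕ}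

lemma PairInvariant.of_isContraction {T T' : Trigraph V} {X Y : Finset V}
    (hinv : G.PairInvariant Δ T.nodes) (hg : 9 ≤ G.girth) (hΔ : 7 ≤ Δ)
    (hdeg : ∀ v, (G.neighborSet v).ncard = Δ) (h : T.IsContraction T' X Y)
    (hbound : ∀ Z ∈ T'.nodes.parts, (G.redParts T'.nodes.parts Z).card ≤ 2 * Δ - 2) :
    G.PairInvariant Δ T'.nodes := by
  have hXc := hinv.card_le X h.left_mem
  have hYc := hinv.card_le Y h.right_mem
  have hX0 := (T.nodes.nonempty_of_mem_parts h.left_mem).card_pos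
  have hY0 := (T.nodes.nonempty_of_mem_parts h.right_mem).card_pos
  have hred := hbound (X ∪ Y) (by rw [h.parts_eq]; simp)
  obtain hX2 | hX1 : X.card = 2 ∨ X.card = 1 := by omega
  · obtain hY2 | hY1 : Y.card = 2 ∨ Y.card = 1 := by omega
    · have := hinv.red_union_pairs hg hΔ h.left_mem h.right_mem h.ne hX2 hY2 h.parts_eq
      omega
    · obtain ⟨w, rfl⟩ := Finset.card_eq_one.1 hY1
      have := hinv.red_union_singleton hg hΔ hdeg h.left_mem h.right_mem h.ne hX2 h.parts_eq
      omega
  · obtain ⟨a, rfl⟩ := Finset.card_eq_one.1 hX1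
    obtain hY2 | hY1 : Y.card = 2 ∨ Y.card = 1 := by omega
    · have := hinv.red_union_singleton hg hΔ hdeg h.right_mem h.left_mem h.ne.symm hY2
        (by rw [Finset.union_comm, Finset.pair_comm]; exact h.parts_eq)
      rw [Finset.union_comm] at this
      omega
    · obtain ⟨b, rfl⟩ := Finset.card_eq_one.1 hY1
      exact hinv.of_merge_singletons hg hΔ hdeg h.left_mem h.right_mem
        (by simpa using h.ne) h.parts_eq hbound

lemma pairInvariant_ofGraph : G.PairInvariant Δ (Trigraph.ofGraph G).nodes := by
  have hsing : ∀ X ∈ (Trigraph.ofGraph G).nodes.parts, ∃ x, X = {x} := by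
    intro X hX
    obtain ⟨x, -, h⟩ := Finpartition.mem_bot_iff.1 hX
    exact ⟨x, h.symm⟩
  refine ⟨fun X hX => ?_, fun X hX => ?_, fun X hX hX2 => ?_⟩ <;> obtain ⟨x, rfl⟩ := hsing X hX
  · simp
  · intro z hz z' hz'
    rw [Finset.mem_singleton] at hz hz'
    exact Or.inl (hz.trans hz'.symm)
  · simp at hX2

/-- A regular graph of girth at least nine has no contraction sequence of small red degree. -/
theorem HasContractionSequence.le {d : ℕ} [Nonempty V] (h : G.HasContractionSequence d)
    (hg : 9 ≤ G.girth) (hΔ : 7 ≤ Δ) (hdeg : ∀ v, (G.neighborSet v).ncard = Δ) :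
    2 * Δ - 1 ≤ d := by
  by_contra! hd
  obtain ⟨T, hn, h1, hstep, hred⟩ := h
  have key : ∀ k i, 1 ≤ i → i + k = Fintype.card V →
      G.PairInvariant Δ (T i).nodes ∧ (T i).IsQuotient G := by
    intro k
    induction k with
    | zero =>
      intro i _ hi
      rw [add_zero] at hi
      rw [hi, hn]
      exact ⟨pairInvariant_ofGraph, Trigraph.isQuotient_ofGraph G⟩
    | succ k ih =>
      intro i hi hik
      obtain ⟨hinv, hq⟩ := ih (i + 1) (by omega) (by omega)
      obtain ⟨X, Y, hXY⟩ := hstep i hi (by omega)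
      have hq' := hXY.isQuotient hq
      refine ⟨hinv.of_isContraction hg hΔ hdeg hXY fun Z hZ => ?_, hq'⟩
      have := hq'.card_redParts_le (hred i hi (by omega)) hZ
      omega
  have hpos : 0 < Fintype.card V := Fintype.card_pos
  have hinv := (key (Fintype.card V - 1) 1 le_rfl (by omega)).1
  -- The last class is the whole vertex set. It would have at most two vertices, although a vertex
  -- has Δ neighbours.
  have hcard := hinv.card_le Finset.univ (by rw [h1]; simp)
  obtain ⟨v⟩ := ‹Nonempty V›
  have := Set.ncard_le_ncard (Set.subset_univ (G.neighborSet v)) (Set.toFinite _)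
  rw [hdeg, Set.ncard_univ, Nat.card_eq_fintype_card] at this
  rw [Finset.card_univ] at hcard
  omega

end SimpleGraph

/-! ### The theorem -/

theorem mainTheorem5 (Δ r g : ℕ) (hΔ : 7 ≤ Δ) (hr : 1 ≤ r) (hg : 4 * r + 1 ≤ g) :
    ∃ (V : Type) (_ : Fintype V) (_ : DecidableEq V) (G : SimpleGraph V)
      (_ : DecidableRel G.Adj),
      (⊤ : SimpleGraph (Fin (Δ + 1))).IsGirthDoublingTower G ∧
      G.IsRegularOfDegree Δ ∧
      g ≤ G.girth ∧
      2 * Δ - 1 ≤ G.twinWidth ∧ G.twinWidth ≤ 2 * Δ ∧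
      (G.strongColoringNumber r : ℝ) ≥
        (Δ : ℝ) / 2 * (((Δ : ℝ) - 2) / 4) ^ (2 ^ Nat.log 2 r - 1) ∧
      (Δ : ℝ) / 2 * (((Δ : ℝ) - 2) / 4) ^ (2 ^ Nat.log 2 r - 1) ≥
        (G.twinWidth : ℝ) / 4 * (((G.twinWidth : ℝ) - 4) / 8) ^ (2 ^ Nat.log 2 r - 1) := by
  -- Girth 9 is needed for the twin-width, girth `g` for the statement and for the colouring number.
  obtain ⟨V, G, hG, hgirth⟩ := SimpleGraph.exists_tower Δ (by omega) (max g 9)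
  have hlift := hG.isIteratedTwoLift
  have hV : Finite V := hlift.finite
  have hV' : Nonempty V := hlift.nonempty
  classical
  let _ : Fintype V := Fintype.ofFinite V
  have hK : ∀ v, ((⊤ : SimpleGraph (Fin (Δ + 1))).neighborSet v).ncard = Δ := by
    intro v
    rw [SimpleGraph.neighborSet_top, Set.ncard_compl, Set.ncard_singleton,
      Nat.card_eq_fintype_card, Fintype.card_fin]
    omega
  have hdeg := hlift.ncard_neighborSet hK
  have hreg : G.IsRegularOfDegree Δ := by
    intro v
    rw [← hdeg v, ← SimpleGraph.card_neighborFinset_eq_degree, ← Set.ncard_coe_finset,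
      SimpleGraph.coe_neighborFinset]
  have hg9 : 9 ≤ G.girth := (le_max_right _ _).trans hgirth
  have hgg : g ≤ G.girth := (le_max_left _ _).trans hgirth
  have hseq : G.HasContractionSequence (2 * Δ) :=
    (hlift.collapsible hK
      (SimpleGraph.collapsible_of_card_le (by rw [Fintype.card_fin]; omega) id)
      ).hasContractionSequence
  have hlower : 2 * Δ - 1 ≤ G.twinWidth :=
    SimpleGraph.HasContractionSequence.le
      (Nat.sInf_mem (s := {d | G.HasContractionSequence d}) ⟨_, hseq⟩) hg9 hΔ hdeg
  have hupper : G.twinWidth ≤ 2 * Δ := Nat.sInf_le hseq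
  refine ⟨V, inferInstance, inferInstance, G, inferInstance, hG, hreg, hgg, hlower, hupper,
    SimpleGraph.strongColoringNumber_ge hΔ hr hreg (by omega), ?_⟩
  have h1 : (G.twinWidth : ℝ) ≤ 2 * Δ := by exact_mod_cast hupper
  -- From 2 Δ - 1 with Δ ≥ 7; it keeps the base of the power nonnegative, so that the upper bound 2
  -- Δ can be substituted monotonically.
  have h2 : (13 : ℝ) ≤ G.twinWidth := by
    have : 13 ≤ G.twinWidth := by omega
    exact_mod_cast this
  refine mul_le_mul (by linarith) (pow_le_pow_left₀ (by linarith) (by linarith) _)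
    (pow_nonneg (by linarith) _) (by linarith)
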